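/- Let $\mathbb K\in\{\mathbb R,\mathbb C\}$, let $G$ be a Hausdorff locally convex space over $\mathbb K$, let $M$ be a (Hausdorff, second countable) smooth manifold of finite dimension $N\ge 1$, with or without boundary, and let $U\subseteq M$ be open. *Notation.* For an open set $W\subseteq M$ let $\mathcal A(W)$ be the ring of smooth real functions on $W$, $\Gamma(W,TM)$ the $\mathcal A(W)$-module of smooth vector fields on $W$, and $\mathrm{Alt}^k(W,M)$ the $\mathcal A(W)$-module of alternating $\mathcal A(W)$-multilinear maps $\Gamma(W,TM)^k\to\mathcal A(W)$, $k\ge 0$. Let $\mathcal A(W,G)$ be the $\mathcal A(W)$-module of maps $f:W\to G$ such that $f\circ\phi^{-1}$ is $\mathcal C^\infty$ in the sense of Bastiani for every smooth chart $\phi$ of $M$ with domain contained in $W$; that is, all iterated directional derivatives of $f\circ\phi^{-1}$ exist at the interior points of the image of $\phi$ and are (or, at boundary points, extend to) continuous functions of the point and the directions. Put $$\mathrm{Alt}^k(W,M;G)=\mathcal A(W,G)\otimes_{\mathcal A(W)}\mathrm{Alt}^k(W,M),\qquad \mathrm{Alt}^\bullet(W,M;G)=\bigoplus_{k\ge 0}\mathrm{Alt}^k(W,M;G).$$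 For open $V\subseteq W$ the restriction $\theta\mapsto\theta|_V$, $\mathrm{Alt}^\bullet(W,M;G)\to\mathrm{Alt}^\bullet(V,M;G)$, is the pullback along the inclusion, i.e. the additive map with $f\otimes\omega\mapsto f|_V\otimes\omega|_V$. *Differential on a chart.* Let $\phi$ be a chart with domain $V$ and coordinate differentials $dx_1,\dots,dx_N$. For $f\in\mathcal A(V,G)$ let $\partial_j^{\phi}f\in\mathcal A(V,G)$ be the directional derivative of $f\circ\phi^{-1}$ along the $j$-th standard basis vector (extended continuously to boundary points), composed with $\phi$. Every $\theta\in\mathrm{Alt}^k(V,M;G)$ has a unique decomposition $\theta=\sum_{J} f_J\otimes dx_J$ with $f_J\in\mathcal A(V,G)$, where $J=(j_1<\dots<j_k)$ ranges over the strictly increasing multi-indices in $\{1,\dots,N\}$ and $dx_J=dx_{j_1}\wedge\dots\wedge dx_{j_k}$. Put $$d_{\phi}\theta=\sum_{J}\sum_{j=1}^N\partial_j^{\phi}f_J\otimes(dx_j\wedge dx_J)\in\mathrm{Alt}^{k+1}(V,M;G),$$ and extend $d_\phi$ to $\mathrm{Alt}^\bullet(V,M;G)$ degree by degree. **Theorem.**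 Let $(\phi_\alpha)_{\alpha\in D}$ be smooth charts of $M$ whose domains $U_\alpha$ are contained in $U$ and cover $U$. Then there is a unique map $d:\mathrm{Alt}^\bullet(U,M;G)\to\mathrm{Alt}^\bullet(U,M;G)$ such that $d(\mathrm{Alt}^k(U,M;G))\subseteq\mathrm{Alt}^{k+1}(U,M;G)$ for all $k\ge 0$ and $$(d\theta)|_{U_\alpha}=d_{\phi_\alpha}(\theta|_{U_\alpha})\qquad\text{for all }\theta\in\mathrm{Alt}^\bullet(U,M;G),\ \alpha\in D.$$ -/

import Mathlib

open Set Filter Topology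
open scoped Manifold ContDiff TensorProduct DirectSum

namespace GForm

universe u v

section Bastiani

variable {G : Type v} [AddCommGroup G] [Module ℝ G] [TopologicalSpace G]

/-- `f'` is the derivative of `f` at `x` in the direction `v`, as the limit of the difference
quotients in the topological vector space `G`. -/
def HasDirDeriv {E : Type u} [AddCommGroup E] [Module ℝ E] (f : E → G) (f' : G) (x v : E) : Prop :=
  Tendsto (fun t : ℝ => t⁻¹ • (f (x + t • v) - f x)) (𝓝[≠] 0) (𝓝 f')

/-- `df (x, v)` is the directional derivative of `f` at every interior point `x` of `S`, in every
direction `v`. -/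
def IsDirDerivOn {E : Type u} [NormedAddCommGroup E] [NormedSpace ℝ E] (S : Set E) (f : E → G)
    (df : E × E → G) : Prop :=
  ∀ x ∈ interior S, ∀ v : E, HasDirDeriv f (df (x, v)) x v

/-- `C^k` maps in the sense of Bastiani, on a set `S` which in all uses is contained in the closure
of its interior (an open set, or a relatively open subset of a half-space). `f` is `C^0` if it is
continuous on `S`; `f` is `C^(k+1)` if it is continuous on `S`, all its directional derivatives
exist at the interior points of `S`, and `(x, v) ↦ D_v f (x)` is (or extends to) a `C^k` map on
`S × E`. -/
def BastianiOn (G : Type v) [AddCommGroup G] [Module ℝ G] [TopologicalSpace G] :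
    ℕ → ∀ (E : Type u) [NormedAddCommGroup E] [NormedSpace ℝ E], Set E → (E → G) → Prop
  | 0, _, _, _, S, f => ContinuousOn f S
  | k + 1, E, _, _, S, f => ContinuousOn f S ∧
      ∃ df : E × E → G, IsDirDerivOn S f df ∧ BastianiOn G k (E × E) (S ×ˢ univ) df

/-- `C^∞` maps in the sense of Bastiani. -/
def BastianiSmoothOn {E : Type u} [NormedAddCommGroup E] [NormedSpace ℝ E] (S : Set E)
    (f : E → G) : Prop :=
  ∀ k : ℕ, BastianiOn G k E S f

variable {E : Type u} [NormedAddCommGroup E] [NormedSpace ℝ E]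

lemma HasDirDeriv.congr {f g : E → G} {f' : G} {x v : E} {S : Set E} (h : HasDirDeriv f f' x v)
    (hx : x ∈ interior S) (hfg : EqOn f g S) : HasDirDeriv g f' x v := by
  refine Tendsto.congr' ?_ h
  have h0 : Tendsto (fun t : ℝ => x + t • v) (𝓝[≠] 0) (𝓝 x) := by
    have : Tendsto (fun t : ℝ => x + t • v) (𝓝 0) (𝓝 (x + (0 : ℝ) • v)) :=
      Continuous.tendsto (by fun_prop) 0
    simp only [zero_smul, add_zero] at this
    exact this.mono_left nhdsWithin_le_nhds
  filter_upwards [h0 (isOpen_interior.mem_nhds hx)] with t ht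
  rw [hfg (interior_subset ht), hfg (interior_subset hx)]

lemma HasDirDeriv.unique [T2Space G] {f : E → G} {a b : G} {x v : E} (ha : HasDirDeriv f a x v)
    (hb : HasDirDeriv f b x v) : a = b :=
  tendsto_nhds_unique ha hb

lemma BastianiOn.continuousOn {k : ℕ} {S : Set E} {f : E → G} (h : BastianiOn G k E S f) :
    ContinuousOn f S := by
  cases k with
  | zero => exact h
  | succ k => exact h.1

lemma BastianiOn.congr {k : ℕ} {S : Set E} {f g : E → G} (h : BastianiOn G k E S f)
    (hfg : EqOn f g S) : BastianiOn G k E S g := by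
  cases k with
  | zero => exact ContinuousOn.congr h hfg.symm
  | succ k =>
    obtain ⟨h1, df, h2, h3⟩ := h
    exact ⟨h1.congr hfg.symm, df, fun x hx v => (h2 x hx v).congr hx hfg, h3⟩

lemma interior_prod_univ' {E : Type u} [TopologicalSpace E] {S : Set E} :
    interior (S ×ˢ (univ : Set E)) = interior S ×ˢ univ := by
  rw [interior_prod_eq, interior_univ]

/-- The derivative of a Bastiani map is unique on the whole of `S × E`. -/
lemma IsDirDerivOn.eqOn [T2Space G] {S : Set E} (hS : S ⊆ closure (interior S)) {f : E → G}
    {a b : E × E → G} (ha : IsDirDerivOn S f a) (hb : IsDirDerivOn S f b)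
    (hac : ContinuousOn a (S ×ˢ univ)) (hbc : ContinuousOn b (S ×ˢ univ)) :
    EqOn a b (S ×ˢ univ) := by
  have key : EqOn a b (interior S ×ˢ univ) := by
    rintro ⟨x, v⟩ ⟨hx, -⟩
    exact (ha x hx v).unique (hb x hx v)
  refine key.of_subset_closure hac hbc (prod_mono interior_subset subset_rfl) ?_
  rw [closure_prod_eq, closure_univ]
  exact prod_mono hS subset_rfl

lemma BastianiOn.mono_left {k l : ℕ} (hkl : k ≤ l) {S : Set E} {f : E → G}
    (h : BastianiOn G l E S f) : BastianiOn G k E S f := by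
  induction k generalizing l E with
  | zero => exact h.continuousOn
  | succ k ih =>
    obtain ⟨l, rfl⟩ : ∃ l', l = l' + 1 := ⟨l - 1, by omega⟩
    obtain ⟨h1, df, h2, h3⟩ := h
    exact ⟨h1, df, h2, ih (by omega) h3⟩

/-- The derivative of a Bastiani-smooth map, on `S × E`. -/
noncomputable def BastianiSmoothOn.deriv {S : Set E} {f : E → G} (h : BastianiSmoothOn S f) :
    E × E → G :=
  (h 1).2.choose

lemma BastianiSmoothOn.isDirDerivOn {S : Set E} {f : E → G} (h : BastianiSmoothOn S f) :
    IsDirDerivOn S f h.deriv :=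
  (h 1).2.choose_spec.1

lemma BastianiSmoothOn.continuousOn_deriv {S : Set E} {f : E → G} (h : BastianiSmoothOn S f) :
    ContinuousOn h.deriv (S ×ˢ univ) :=
  (h 1).2.choose_spec.2

lemma BastianiSmoothOn.smooth_deriv [T2Space G] {S : Set E} (hS : S ⊆ closure (interior S))
    {f : E → G} (h : BastianiSmoothOn S f) : BastianiSmoothOn (S ×ˢ univ) h.deriv := by
  intro k
  obtain ⟨-, df, h2, h3⟩ := h (k + 1)
  exact h3.congr (h2.eqOn hS h.isDirDerivOn h3.continuousOn h.continuousOn_deriv)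

lemma BastianiOn.add [IsTopologicalAddGroup G] {k : ℕ} {S : Set E} {f g : E → G}
    (hf : BastianiOn G k E S f) (hg : BastianiOn G k E S g) :
    BastianiOn G k E S (fun x => f x + g x) := by
  induction k generalizing E with
  | zero => exact ContinuousOn.add hf hg
  | succ k ih =>
    obtain ⟨h1, df, h2, h3⟩ := hf
    obtain ⟨h1', dg, h2', h3'⟩ := hg
    refine ⟨h1.add h1', fun p => df p + dg p, fun x hx v => ?_, ih h3 h3'⟩
    refine ((h2 x hx v).add (h2' x hx v)).congr fun t => ?_
    dsimp only; module

lemma BastianiOn.zero {k : ℕ} {S : Set E} : BastianiOn G k E S (fun _ => 0) := by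
  induction k generalizing E with
  | zero => exact continuousOn_const
  | succ k ih =>
    refine ⟨continuousOn_const, fun _ => 0, fun x hx v => ?_, ih⟩
    simp only [HasDirDeriv, sub_self, smul_zero]
    exact tendsto_const_nhds

lemma BastianiOn.neg [IsTopologicalAddGroup G] {k : ℕ} {S : Set E} {f : E → G}
    (hf : BastianiOn G k E S f) : BastianiOn G k E S (fun x => - f x) := by
  induction k generalizing E with
  | zero => exact ContinuousOn.neg hf
  | succ k ih =>
    obtain ⟨h1, df, h2, h3⟩ := hf
    refine ⟨h1.neg, fun p => - df p, fun x hx v => ?_, ih h3⟩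
    refine (h2 x hx v).neg.congr fun t => ?_
    dsimp only; module

/-- Mean value inclusion for curves in a locally convex space. -/
lemma sub_mem_of_hasDirDeriv [IsTopologicalAddGroup G] [ContinuousSMul ℝ G] [LocallyConvexSpace ℝ G]
    {γ γ' : ℝ → G} {C : Set G} (hC : Convex ℝ C) (hC' : IsClosed C)
    (hγ : ∀ s ∈ Icc (0 : ℝ) 1, HasDirDeriv γ (γ' s) s 1) (h : ∀ s ∈ Icc (0 : ℝ) 1, γ' s ∈ C) :
    γ 1 - γ 0 ∈ C := by
  by_contra hne
  obtain ⟨L, c, hL1, hL2⟩ := geometric_hahn_banach_closed_point hC hC' hne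
  have hd : ∀ s ∈ Icc (0 : ℝ) 1, HasDerivAt (fun s => L (γ s)) (L (γ' s)) s := by
    intro s hs
    rw [hasDerivAt_iff_tendsto_slope_zero]
    refine ((L.continuous.tendsto _).comp (hγ s hs)).congr fun t => ?_
    simp
  obtain ⟨s, hs, hs'⟩ := exists_hasDerivAt_eq_slope (fun s => L (γ s)) (fun s => L (γ' s))
    one_pos (fun s hs => (hd s hs).continuousAt.continuousWithinAt)
    (fun s hs => hd s (Ioo_subset_Icc_self hs))
  have := hL1 _ (h s (Ioo_subset_Icc_self hs))
  simp only [map_sub] at hL2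
  simp only [sub_zero, div_one] at hs'
  linarith

lemma HasDirDeriv.comp_line {f : E → G} {a b : E} {s : ℝ} {c : ℝ} (hc : c ≠ 0) {f' : G} {w : E}
    [ContinuousSMul ℝ G]
    (hab : b = c • w) (h : HasDirDeriv f f' (a + s • b) w) :
    HasDirDeriv (fun r : ℝ => c⁻¹ • f (a + r • b)) f' s 1 := by
  have h0 : Tendsto (fun t : ℝ => c * t) (𝓝[≠] 0) (𝓝[≠] 0) := by
    refine tendsto_nhdsWithin_iff.2 ⟨?_, ?_⟩
    · have : Tendsto (fun t : ℝ => c * t) (𝓝 0) (𝓝 (c * 0)) := Continuous.tendsto (by fun_prop) 0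
      rw [mul_zero] at this
      exact this.mono_left nhdsWithin_le_nhds
    · filter_upwards [self_mem_nhdsWithin] with t ht
      exact mul_ne_zero hc ht
  refine (Tendsto.comp h h0).congr fun t => ?_
  simp only [Function.comp, smul_eq_mul, mul_one]
  rw [← smul_sub, smul_smul, mul_inv, mul_comm]
  congr 3
  rw [hab, add_smul, smul_smul t, mul_comm t, add_assoc]

/-- Chain rule for directional derivatives. -/
lemma IsDirDerivOn.comp [IsTopologicalAddGroup G] [ContinuousSMul ℝ G] [LocallyConvexSpace ℝ G]
    {E' : Type u} [NormedAddCommGroup E'] [NormedSpace ℝ E'] {S : Set E} {g : E → G}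
    {dg : E × E → G} (h : IsDirDerivOn S g dg) (hc : ContinuousOn dg (S ×ˢ univ))
    {T : E' → E} {x v : E'} {w : E} (hx : T x ∈ interior S) (hT : HasDirDeriv T w x v) :
    HasDirDeriv (fun y => g (T y)) (dg (T x, w)) x v := by
  intro W hW
  obtain ⟨W', hW', hW'c, hW'W⟩ := exists_mem_nhds_isClosed_subset hW
  obtain ⟨B, ⟨hB, hBc⟩, hBW⟩ := (LocallyConvexSpace.convex_basis (𝕜 := ℝ) (dg (T x, w))).mem_iff.1 hW'
  have hCW : closure B ⊆ W := (closure_minimal hBW hW'c).trans hW'W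
  have hat : ContinuousAt dg (T x, w) := hc.continuousAt (by
    rw [← mem_interior_iff_mem_nhds, interior_prod_univ']; exact ⟨hx, mem_univ _⟩)
  have hn := hat hB
  rw [nhds_prod_eq, mem_map, mem_prod_iff] at hn
  obtain ⟨V₁, hV₁, V₂, hV₂, hV⟩ := hn
  obtain ⟨r, hr, hrV⟩ := Metric.mem_nhds_iff.1
    (inter_mem hV₁ (isOpen_interior.mem_nhds hx))
  have hw : ∀ᶠ t : ℝ in 𝓝[≠] 0, t⁻¹ • (T (x + t • v) - T x) ∈ V₂ := hT hV₂
  have hTc : ∀ᶠ t : ℝ in 𝓝[≠] 0, T (x + t • v) ∈ Metric.ball (T x) r := by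
    have ht0 : Tendsto (fun t : ℝ => t) (𝓝[≠] 0) (𝓝 0) := nhdsWithin_le_nhds
    have h1 := (ht0.smul hT).const_add (T x)
    rw [zero_smul, add_zero] at h1
    filter_upwards [h1 (Metric.ball_mem_nhds _ hr), self_mem_nhdsWithin] with t ht ht'
    rw [mem_preimage, smul_smul, mul_inv_cancel₀ ht', one_smul] at ht
    simpa using ht
  rw [mem_map]
  filter_upwards [hw, hTc, self_mem_nhdsWithin] with t ht1 ht2 ht3
  apply hCW
  set b := T (x + t • v) - T x with hb
  have hseg : ∀ s ∈ Icc (0 : ℝ) 1, T x + s • b ∈ Metric.ball (T x) r := by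
    intro s hs
    have := (convex_ball (T x) r).add_smul_sub_mem (Metric.mem_ball_self hr) ht2 hs
    simpa [hb] using this
  have := sub_mem_of_hasDirDeriv (G := G) (C := closure B)
    (γ := fun s : ℝ => t⁻¹ • g (T x + s • b))
    (γ' := fun s : ℝ => dg (T x + s • b, t⁻¹ • b)) hBc.closure isClosed_closure
    (fun s hs => HasDirDeriv.comp_line ht3 (by rw [smul_smul, mul_inv_cancel₀ ht3, one_smul])
      (h _ (hrV (hseg s hs)).2 _))
    (fun s hs => subset_closure (hV ⟨(hrV (hseg s hs)).1, ht1⟩))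
  rw [← smul_sub] at this
  simpa [hb] using this

lemma _root_.HasFDerivAt.hasDirDeriv {F : Type*} [NormedAddCommGroup F] [NormedSpace ℝ F]
    {T : E → F} {T' : E →L[ℝ] F} {x : E} (h : HasFDerivAt T T' x) (v : E) :
    HasDirDeriv T (T' v) x v := by
  have := (h.hasLineDerivAt v).tendsto_slope_zero
  exact this

/-- A Bastiani map precomposed with a smooth map of normed spaces which sends interior points to
interior points is Bastiani. -/
lemma BastianiOn.comp [IsTopologicalAddGroup G] [ContinuousSMul ℝ G] [LocallyConvexSpace ℝ G]
    {k : ℕ} {E' : Type u} [NormedAddCommGroup E'] [NormedSpace ℝ E'] {S : Set E} {g : E → G}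
    (hg : BastianiOn G k E S g) {S' : Set E'} {T : E' → E} (hS' : UniqueDiffOn ℝ S')
    (hT : ContDiffOn ℝ ∞ T S') (hm : MapsTo T S' S) (hmi : MapsTo T (interior S') (interior S)) :
    BastianiOn G k E' S' (fun x => g (T x)) := by
  induction k generalizing E E' with
  | zero => exact ContinuousOn.comp hg hT.continuousOn hm
  | succ k ih =>
    obtain ⟨h1, dg, h2, h3⟩ := hg
    refine ⟨h1.comp hT.continuousOn hm, fun p => dg (T p.1, fderivWithin ℝ T S' p.1 p.2),
      fun x hx v => ?_, ih (T := fun p : E' × E' => (T p.1, fderivWithin ℝ T S' p.1 p.2)) h3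
        (hS'.prod uniqueDiffOn_univ) ?_ ?_ ?_⟩
    · have hxn : S' ∈ 𝓝 x := mem_interior_iff_mem_nhds.1 hx
      refine h2.comp h3.continuousOn (hmi hx) ?_
      have := (hT.differentiableOn (by simp) x (mem_of_mem_nhds hxn)).hasFDerivWithinAt.hasFDerivAt hxn
      exact this.hasDirDeriv v
    · refine (hT.comp contDiffOn_fst fun p hp => hp.1).prodMk ?_
      have := hT.fderivWithin (m := ∞) hS' (by simp)
      exact (this.comp contDiffOn_fst fun p hp => hp.1).clm_apply contDiffOn_snd
    · exact fun p hp => ⟨hm hp.1, mem_univ _⟩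
    · intro p hp
      rw [interior_prod_univ'] at hp ⊢
      exact ⟨hmi hp.1, mem_univ _⟩

lemma bastianiOn_of_contDiffOn {k : ℕ} {F : Type*} [NormedAddCommGroup F] [NormedSpace ℝ F]
    {S : Set E} (hS : UniqueDiffOn ℝ S) {f : E → F} (hf : ContDiffOn ℝ ∞ f S) :
    BastianiOn F k E S f := by
  induction k generalizing E with
  | zero => exact hf.continuousOn
  | succ k ih =>
    refine ⟨hf.continuousOn, fun p => fderivWithin ℝ f S p.1 p.2, fun x hx v => ?_,
      ih (hS.prod uniqueDiffOn_univ) ?_⟩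
    · have hxn : S ∈ 𝓝 x := mem_interior_iff_mem_nhds.1 hx
      exact ((hf.differentiableOn (by simp) x
        (mem_of_mem_nhds hxn)).hasFDerivWithinAt.hasFDerivAt hxn).hasDirDeriv v
    · have := hf.fderivWithin (m := ∞) hS (by simp)
      exact (this.comp contDiffOn_fst fun p hp => hp.1).clm_apply contDiffOn_snd

lemma BastianiOn.smul [IsTopologicalAddGroup G] [ContinuousSMul ℝ G] [LocallyConvexSpace ℝ G]
    {k : ℕ} {S : Set E} (hS : UniqueDiffOn ℝ S) {h : E → ℝ} {f : E → G}
    (hh : ContDiffOn ℝ ∞ h S) (hf : BastianiOn G k E S f) :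
    BastianiOn G k E S (fun x => h x • f x) := by
  induction k generalizing E with
  | zero => exact ContinuousOn.smul hh.continuousOn hf
  | succ k ih =>
    have hf0 : BastianiOn G k E S f := hf.mono_left (Nat.le_succ k)
    obtain ⟨h1, df, h2, h3⟩ := hf
    have hS2 : UniqueDiffOn ℝ (S ×ˢ (univ : Set E)) := hS.prod uniqueDiffOn_univ
    have hfst : ContDiffOn ℝ ∞ (fun p : E × E => h p.1) (S ×ˢ univ) :=
      hh.comp contDiffOn_fst fun p hp => hp.1
    refine ⟨hh.continuousOn.smul h1,
      fun p => h p.1 • df p + fderivWithin ℝ h S p.1 p.2 • f p.1, fun x hx v => ?_,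
      (ih hS2 hfst h3).add (ih hS2 ?_ ?_)⟩
    · have hxn : S ∈ 𝓝 x := mem_interior_iff_mem_nhds.1 hx
      have hd := (hh.differentiableOn (by simp) x
        (mem_of_mem_nhds hxn)).hasFDerivWithinAt.hasFDerivAt hxn
      have hd' := hd.hasDirDeriv v
      have hcont : Tendsto (fun t : ℝ => h (x + t • v)) (𝓝[≠] 0) (𝓝 (h x)) := by
        have : ContinuousAt (fun t : ℝ => h (x + t • v)) 0 := by
          apply ContinuousAt.comp (g := h) _ (by fun_prop)
          simpa using hd.continuousAt
        have h' := this.tendsto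
        simp only [zero_smul, add_zero] at h'
        exact h'.mono_left nhdsWithin_le_nhds
      refine ((hcont.smul (h2 x hx v)).add (hd'.smul_const (f x))).congr fun t => ?_
      simp only [smul_eq_mul]
      module
    · have := hh.fderivWithin (m := ∞) hS (by simp)
      exact (this.comp contDiffOn_fst fun p hp => hp.1).clm_apply contDiffOn_snd
    · refine hf0.comp hS2 contDiffOn_fst (fun p hp => hp.1) ?_
      intro p hp
      rw [interior_prod_univ'] at hp
      exact hp.1

end Bastiani
section Algebra

variable {A P : Type*} [CommRing A] [AddCommGroup P] [Module A P]

/-- The wedge product `α ∧ ζ` of a `1`-form and a `k`-form: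
`(α ∧ ζ)(X_0, …, X_k) = ∑ i, (-1)^i α(X_i) ζ(X_0, …, X_(i-1), X_(i+1), …, X_k)`. -/
def wedgeOne {k : ℕ} (α : P →ₗ[A] A) (ζ : P [⋀^Fin k]→ₗ[A] A) : P [⋀^Fin (k + 1)]→ₗ[A] A :=
  AlternatingMap.alternatizeUncurryFin (α.smulRight ζ)

/-- The wedge product `α_0 ∧ … ∧ α_(k-1)` of `1`-forms. -/
def wedgeList : ∀ k : ℕ, (Fin k → (P →ₗ[A] A)) → P [⋀^Fin k]→ₗ[A] A
  | 0, _ => AlternatingMap.constOfIsEmpty A P (Fin 0) 1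
  | k + 1, α => wedgeOne (α 0) (wedgeList k (Fin.tail α))

lemma wedgeList_apply (k : ℕ) (α : Fin k → (P →ₗ[A] A)) (X : Fin k → P) :
    wedgeList k α X = Matrix.det (Matrix.of fun i j => α i (X j)) := by
  induction k with
  | zero => simp [wedgeList]
  | succ k ih =>
    rw [wedgeList, wedgeOne, AlternatingMap.alternatizeUncurryFin_apply, Matrix.det_succ_row_zero]
    refine Finset.sum_congr rfl fun i _ => ?_
    rw [LinearMap.smulRight_apply, AlternatingMap.smul_apply, ih, smul_eq_mul, mul_assoc]
    simp only [Matrix.of_apply, zsmul_eq_mul, Int.cast_pow, Int.cast_neg, Int.cast_one]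
    rfl

variable {N : ℕ} (b : Module.Basis (Fin N) A P) {dx : Fin N → (P →ₗ[A] A)}

lemma wedgeList_basis (hdx : ∀ i j, dx i (b j) = if i = j then 1 else 0) {k : ℕ}
    (I J : Fin k ↪o Fin N) :
    wedgeList k (fun a => dx (I a)) (fun a => b (J a)) = if I = J then 1 else 0 := by
  rw [wedgeList_apply]
  split_ifs with h
  · subst h
    convert Matrix.det_one (n := Fin k) (R := A)
    ext i j
    simp [hdx, Matrix.one_apply]
  · have hr : ¬ range I ⊆ range J := by
      intro hs
      have hf : (Finset.univ.image I) = Finset.univ.image J := by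
        refine Finset.eq_of_subset_of_card_le (fun x hx => ?_) ?_
        · simp only [Finset.mem_image, Finset.mem_univ, true_and] at hx ⊢
          exact hs hx
        · rw [Finset.card_image_of_injective _ J.injective,
            Finset.card_image_of_injective _ I.injective]
      apply h
      refine DFunLike.coe_injective ((StrictMono.range_inj I.strictMono J.strictMono).1 ?_)
      have := congrArg (fun s : Finset (Fin N) => (s : Set (Fin N))) hf
      simpa using this
    obtain ⟨_, ⟨i, rfl⟩, hi⟩ := not_subset.1 hr
    refine Matrix.det_eq_zero_of_row_eq_zero i fun j => ?_
    rw [Matrix.of_apply, hdx, if_neg]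
    exact fun h => hi ⟨j, h.symm⟩

lemma alt_decomp (hdx : ∀ i j, dx i (b j) = if i = j then 1 else 0) {k : ℕ}
    (ζ : P [⋀^Fin k]→ₗ[A] A) :
    ζ = ∑ I : Fin k ↪o Fin N, ζ (fun a => b (I a)) • wedgeList k (fun a => dx (I a)) := by
  have key : ∀ J : Fin k ↪o Fin N, ζ (fun a => b (J a)) =
      (∑ I : Fin k ↪o Fin N, ζ (fun a => b (I a)) • wedgeList k (fun a => dx (I a)))
        (fun a => b (J a)) := by
    intro J
    let ev : (P [⋀^Fin k]→ₗ[A] A) →+ A :=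
      { toFun := fun η => η (fun a => b (J a)), map_zero' := rfl, map_add' := fun _ _ => rfl }
    refine Eq.trans ?_ (map_sum ev _ _).symm
    simp [ev, AlternatingMap.smul_apply, wedgeList_basis b hdx]
  refine b.ext_alternating fun v hv => ?_
  set σ := Tuple.sort v
  have hm : StrictMono (v ∘ σ) :=
    (Tuple.monotone_sort v).strictMono_of_injective (hv.comp σ.injective)
  have h1 := key (OrderEmbedding.ofStrictMono _ hm)
  have e : ∀ η : P [⋀^Fin k]→ₗ[A] A, η (fun a => b (OrderEmbedding.ofStrictMono _ hm a)) =
      Equiv.Perm.sign σ • η (fun a => b (v a)) := fun η => η.map_perm (fun a => b (v a)) σ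
  rw [e, e] at h1
  exact (MulAction.injective _) h1

/-- Unique decomposition of the elements of `Q ⊗ Alt^k(P)`, where `P` is free. -/
lemma existsUnique_decomp (hdx : ∀ i j, dx i (b j) = if i = j then 1 else 0) {k : ℕ}
    {Q : Type*} [AddCommGroup Q] [Module A Q] (θ : Q ⊗[A] (P [⋀^Fin k]→ₗ[A] A)) :
    ∃! c : (Fin k ↪o Fin N) → Q,
      θ = ∑ I : Fin k ↪o Fin N, c I ⊗ₜ[A] wedgeList k (fun a => dx (I a)) := by
  let ev : (Fin k ↪o Fin N) → (Q ⊗[A] (P [⋀^Fin k]→ₗ[A] A)) →ₗ[A] Q := fun J =>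
    TensorProduct.lift (LinearMap.mk₂ A (fun (f : Q) (ζ : P [⋀^Fin k]→ₗ[A] A) =>
      ζ (fun a => b (J a)) • f) (fun _ _ _ => smul_add _ _ _) (fun c f ζ => smul_comm _ _ _)
      (fun f ζ η => by rw [AlternatingMap.add_apply, add_smul])
      (fun c f ζ => by rw [AlternatingMap.smul_apply, smul_assoc]))
  have hev : ∀ J f ζ, ev J (f ⊗ₜ ζ) = ζ (fun a => b (J a)) • f := fun J f ζ => rfl
  refine ⟨fun J => ev J θ, ?_, ?_⟩
  · induction θ using TensorProduct.induction_on with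
    | zero => simp
    | tmul f ζ =>
      simp only [hev]
      conv_lhs => rw [alt_decomp b hdx ζ]
      simp only [TensorProduct.tmul_sum, TensorProduct.smul_tmul]
    | add x y hx hy =>
      simp only [map_add, TensorProduct.add_tmul, Finset.sum_add_distrib]
      exact congrArg₂ (· + ·) hx hy
  · intro c hc
    funext J
    rw [hc, map_sum]
    simp [hev, wedgeList_basis b hdx]

end Algebra

set_option linter.unusedSectionVars false
open TopologicalSpace

section Manifold

variable {N : ℕ} {H : Type*} [TopologicalSpace H]
  (I : ModelWithCorners ℝ (EuclideanSpace ℝ (Fin N)) H)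
  {M : Type*} [TopologicalSpace M] [ChartedSpace H M]

/-- The algebra of smooth real functions on the open set `U`. -/
abbrev SmoothFn (U : Opens M) : Type _ := C^∞⟮I, U; 𝓘(ℝ, ℝ), ℝ⟯

open Classical in
/-- Extension by zero of a section of the tangent bundle over `U`. -/
noncomputable def extField {U : Opens M} (X : ∀ x : U, TangentSpace I (x : M)) (y : M) :
    TangentSpace I y :=
  if h : y ∈ U then X ⟨y, h⟩ else 0

variable {I} in
lemma extField_of_mem {U : Opens M} (X : ∀ x : U, TangentSpace I (x : M)) (x : U) :
    extField I X x = X x := by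
  simp [extField]

section

variable [IsManifold I ∞ M]

variable {I}

lemma contMDiff_field_iff {U : Opens M} (X : ∀ x : U, TangentSpace I (x : M)) :
    ContMDiff I I.tangent ∞ (fun x : U => (⟨x, X x⟩ : TangentBundle I M)) ↔
      ∀ x ∈ U, ContMDiffAt I I.tangent ∞ (fun y => (⟨y, extField I X y⟩ : TangentBundle I M)) x := by
  have key : (fun x : U => (⟨x, X x⟩ : TangentBundle I M)) =
      fun x : U => (fun y => (⟨y, extField I X y⟩ : TangentBundle I M)) (x : M) := by
    funext x; simp only [extField_of_mem]
  constructor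
  · intro h x hx
    have h' := h ⟨x, hx⟩
    rw [key] at h'
    exact (contMDiffAt_subtype_iff (U := U) (x := ⟨x, hx⟩)
      (f := fun y => (⟨y, extField I X y⟩ : TangentBundle I M))).1 h'
  · intro h x
    rw [key]
    exact contMDiffAt_subtype_iff.2 (h x x.2)

lemma contMDiff_field_of {U : Opens M} (X : ∀ x : U, TangentSpace I (x : M))
    (Y : ∀ y : M, TangentSpace I y) (hXY : ∀ x : U, X x = Y x)
    (h : ∀ x ∈ U, ContMDiffAt I I.tangent ∞ (fun y => (⟨y, Y y⟩ : TangentBundle I M)) x) :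
    ContMDiff I I.tangent ∞ (fun x : U => (⟨x, X x⟩ : TangentBundle I M)) := by
  have key : (fun x : U => (⟨x, X x⟩ : TangentBundle I M)) =
      fun x : U => (fun y => (⟨y, Y y⟩ : TangentBundle I M)) (x : M) := by
    funext x; simp only [hXY]
  intro x
  rw [key]
  exact contMDiffAt_subtype_iff.2 (h x x.2)

lemma contMDiffAt_extend_fn {U : Opens M} (h : SmoothFn I U) {x : M} (hx : x ∈ U) :
    ContMDiffAt I 𝓘(ℝ, ℝ) ∞ (Function.extend Subtype.val h 0) x := by
  have := h.contMDiff ⟨x, hx⟩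
  refine (contMDiffAt_subtype_iff (U := U) (x := ⟨x, hx⟩)).1 ?_
  simpa [Subtype.val_injective.extend_apply] using this

variable (I)

/-- Smooth sections over `U` of the tangent bundle of `M`. -/
def smoothFields (U : Opens M) : AddSubgroup (∀ x : U, TangentSpace I (x : M)) where
  carrier := {X | ContMDiff I I.tangent ∞ (fun x : U => (⟨x, X x⟩ : TangentBundle I M))}
  add_mem' := by
    intro X Y hX hY
    refine contMDiff_field_of _ (extField I X + extField I Y) (fun x => ?_) fun x hx =>
      ((contMDiff_field_iff X).1 hX x hx).add_section ((contMDiff_field_iff Y).1 hY x hx)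
    simp [extField_of_mem]
  zero_mem' := contMDiff_field_of _ (fun _ => 0) (fun _ => rfl) fun x _ =>
    Bundle.contMDiffAt_zeroSection ℝ (TangentSpace I : M → Type _)
  neg_mem' := by
    intro X hX
    refine contMDiff_field_of _ (-extField I X) (fun x => ?_) fun x hx =>
      ((contMDiff_field_iff X).1 hX x hx).neg_section
    simp [extField_of_mem]

/-- Pointwise multiplication of vector fields by functions. -/
noncomputable instance instModuleFields (U : Opens M) :
    Module (SmoothFn I U) (smoothFields I U) where
  smul h X := ⟨fun x => h x • X.1 x, by
    refine contMDiff_field_of _ (Function.extend Subtype.val h 0 • extField I X.1) (fun x => ?_)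
      fun x hx => (contMDiffAt_extend_fn h hx).smul_section ((contMDiff_field_iff X.1).1 X.2 x hx)
    simp [extField_of_mem]⟩
  one_smul X := Subtype.ext (funext fun x => one_smul ℝ (X.1 x))
  mul_smul g h X := Subtype.ext (funext fun x => mul_smul (g x) (h x) (X.1 x))
  smul_zero h := Subtype.ext (funext fun x => smul_zero (h x))
  smul_add h X Y := Subtype.ext (funext fun x => smul_add (h x) (X.1 x) (Y.1 x))
  add_smul g h X := Subtype.ext (funext fun x => add_smul (g x) (h x) (X.1 x))
  zero_smul X := Subtype.ext (funext fun x => zero_smul ℝ (X.1 x))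

lemma smoothFields_smul_apply {U : Opens M} (h : SmoothFn I U) (X : smoothFields I U) (x : U) :
    (h • X).1 x = h x • X.1 x := rfl

end

section Maps

variable (G : Type*) [AddCommGroup G] [Module ℝ G] [TopologicalSpace G]

variable {G} in
/-- The representation of `f : U → G` in the chart `φ` with source contained in `U`; it is only
relevant on `(φ.extend I).target`, the image of the chart in the model vector space. -/
noncomputable def chartRep {U : Opens M} (φ : OpenPartialHomeomorph M H) (f : U → G) :
    EuclideanSpace ℝ (Fin N) → G :=
  fun y => Function.extend Subtype.val f 0 ((φ.extend I).symm y)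

variable {G I} in
lemma extend_apply_of_mem {U : Opens M} (f : U → G) {x : M} (hx : x ∈ U) :
    Function.extend Subtype.val f 0 x = f ⟨x, hx⟩ :=
  Subtype.val_injective.extend_apply f 0 ⟨x, hx⟩

variable {I} in
lemma symm_mem {U : Opens M} {φ : OpenPartialHomeomorph M H} (hφU : φ.source ⊆ U)
    {y : EuclideanSpace ℝ (Fin N)} (hy : y ∈ (φ.extend I).target) : (φ.extend I).symm y ∈ U := by
  have := (φ.extend I).map_target hy
  rw [φ.extend_source] at this
  exact hφU this

variable {G I} in
lemma chartRep_apply {U : Opens M} {φ : OpenPartialHomeomorph M H} (hφU : φ.source ⊆ U)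
    (f : U → G) {y : EuclideanSpace ℝ (Fin N)} (hy : y ∈ (φ.extend I).target) :
    chartRep I φ f y = f ⟨(φ.extend I).symm y, symm_mem hφU hy⟩ :=
  extend_apply_of_mem f _

variable {I} in
lemma uniqueDiffOn_target (φ : OpenPartialHomeomorph M H) :
    UniqueDiffOn ℝ (φ.extend I).target := by
  rw [φ.extend_target]; exact I.uniqueDiffOn_preimage φ.open_target

variable {I} in
lemma interior_target (φ : OpenPartialHomeomorph M H) :
    interior (φ.extend I).target = I.symm ⁻¹' φ.target ∩ interior (range I) := by
  rw [φ.extend_target, interior_inter, (φ.open_target.preimage I.continuous_symm).interior_eq]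

variable {I} in
lemma target_subset_closure (φ : OpenPartialHomeomorph M H) :
    (φ.extend I).target ⊆ closure (interior (φ.extend I).target) := by
  rw [interior_target, φ.extend_target]
  intro y hy
  have := I.range_subset_closure_interior hy.2
  exact (φ.open_target.preimage I.continuous_symm).inter_closure ⟨hy.1, this⟩

variable [IsManifold I ∞ M]

variable {I} in
lemma contDiffOn_chartRep {U : Opens M} {φ : OpenPartialHomeomorph M H}
    (hφ : φ ∈ IsManifold.maximalAtlas I ∞ M) (hφU : φ.source ⊆ U) (h : SmoothFn I U) :
    ContDiffOn ℝ ∞ (chartRep I φ h) (φ.extend I).target := by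
  rw [← contMDiffOn_iff_contDiffOn]
  have h1 := contMDiffOn_extend_symm hφ
  rw [← φ.extend_target'] at h1
  intro y hy
  exact (contMDiffAt_extend_fn h (symm_mem hφU hy)).comp_contMDiffWithinAt y (h1 y hy)

variable [IsTopologicalAddGroup G]

/-- The maps `f : U → G` which are Bastiani-smooth in every smooth chart of `M` with domain
contained in `U`. -/
def smoothMaps (U : Opens M) : AddSubgroup (U → G) where
  carrier := {f | ∀ φ ∈ IsManifold.maximalAtlas I ∞ M, φ.source ⊆ U →
    BastianiSmoothOn (φ.extend I).target (chartRep I φ f)}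
  add_mem' := by
    intro f g hf hg φ hφ hφU k
    refine ((hf φ hφ hφU k).add (hg φ hφ hφU k)).congr fun y hy => ?_
    simp [chartRep_apply hφU _ hy]
  zero_mem' := by
    intro φ hφ hφU k
    refine BastianiOn.zero.congr fun y hy => ?_
    simp [chartRep_apply hφU _ hy]
  neg_mem' := by
    intro f hf φ hφ hφU k
    refine (hf φ hφ hφU k).neg.congr fun y hy => ?_
    simp [chartRep_apply hφU _ hy]

variable [ContinuousSMul ℝ G] [LocallyConvexSpace ℝ G]

/-- Pointwise multiplication of `G`-valued maps by functions. -/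
noncomputable instance instModuleMaps (U : Opens M) :
    Module (SmoothFn I U) (smoothMaps I G U) where
  smul h f := ⟨fun x => h x • f.1 x, by
    intro φ hφ hφU k
    refine (BastianiOn.smul (uniqueDiffOn_target φ) (contDiffOn_chartRep hφ hφU h)
      (f.2 φ hφ hφU k)).congr fun y hy => ?_
    simp [chartRep_apply hφU _ hy]⟩
  one_smul f := Subtype.ext (funext fun x => one_smul ℝ (f.1 x))
  mul_smul g h f := Subtype.ext (funext fun x => mul_smul (g x) (h x) (f.1 x))
  smul_zero h := Subtype.ext (funext fun x => smul_zero (h x))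
  smul_add h f g := Subtype.ext (funext fun x => smul_add (h x) (f.1 x) (g.1 x))
  add_smul g h f := Subtype.ext (funext fun x => add_smul (g x) (h x) (f.1 x))
  zero_smul f := Subtype.ext (funext fun x => zero_smul ℝ (f.1 x))

lemma smoothMaps_smul_apply {U : Opens M} (h : SmoothFn I U) (f : smoothMaps I G U) (x : U) :
    (h • f).1 x = h x • f.1 x := rfl

end Maps

section Forms

variable [IsManifold I ∞ M]

/-- `Alt^k(U, M)`: alternating `k`-forms on the module of vector fields over `U`, with values in
the smooth functions on `U`. -/
abbrev Alt (U : Opens M) (k : ℕ) : Type _ :=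
  (smoothFields I U) [⋀^Fin k]→ₗ[SmoothFn I U] (SmoothFn I U)

variable (G : Type*) [AddCommGroup G] [Module ℝ G] [TopologicalSpace G]
  [IsTopologicalAddGroup G] [ContinuousSMul ℝ G] [LocallyConvexSpace ℝ G]

/-- `Alt^k(U, M; G)`, the `G`-valued smooth `k`-forms on `U`. -/
abbrev GAlt (U : Opens M) (k : ℕ) : Type _ :=
  (smoothMaps I G U) ⊗[SmoothFn I U] (Alt I U k)

/-- `Alt^•(U, M; G)`, the `G`-valued smooth forms on `U`. -/
abbrev GForms (U : Opens M) : Type _ :=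
  ⨁ k : ℕ, GAlt I G U k

end Forms

section Restriction

variable [IsManifold I ∞ M]

/-- Restriction of smooth functions to a smaller open set. -/
noncomputable abbrev resFn {U V : Opens M} (h : V ≤ U) : SmoothFn I U →+* SmoothFn I V :=
  ContMDiffMap.restrictRingHom I 𝓘(ℝ, ℝ) ℝ h

/-- Restriction of vector fields to a smaller open set. -/
def resField {U V : Opens M} (h : V ≤ U) (X : smoothFields I U) : smoothFields I V :=
  ⟨fun x => X.1 (Opens.inclusion h x), X.2.comp (contMDiff_inclusion h)⟩

section

variable (G : Type*) [AddCommGroup G] [Module ℝ G] [TopologicalSpace G]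
  [IsTopologicalAddGroup G]

/-- Restriction of `G`-valued smooth maps to a smaller open set. -/
def resMap {U V : Opens M} (h : V ≤ U) : smoothMaps I G U →+ smoothMaps I G V where
  toFun f := ⟨fun x => f.1 (Opens.inclusion h x), by
    intro φ hφ hφV k
    have hφU : φ.source ⊆ U := fun x hx => h (hφV hx)
    refine (f.2 φ hφ hφU k).congr fun y hy => ?_
    rw [chartRep_apply hφU _ hy, chartRep_apply hφV _ hy]⟩
  map_zero' := rfl
  map_add' _ _ := rfl

end

variable {I} [T2Space M]

lemma exists_cutoff {V : Opens M} {p : M} (hp : p ∈ V) :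
    ∃ χ : M → ℝ, ContMDiff I 𝓘(ℝ, ℝ) ∞ χ ∧ χ =ᶠ[𝓝 p] 1 ∧ tsupport χ ⊆ V := by
  obtain ⟨f, -, hf⟩ := (SmoothBumpFunction.nhds_basis_tsupport (I := I) p).mem_iff.1
    (V.isOpen.mem_nhds hp)
  exact ⟨f, f.contMDiff, f.eventuallyEq_one, hf⟩

/-- A smooth function on `V` multiplied by a cutoff function, as a smooth function on `U`. -/
noncomputable def cutFn (U : Opens M) {V : Opens M} {χ : M → ℝ} (hχ : ContMDiff I 𝓘(ℝ, ℝ) ∞ χ)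
    (hs : tsupport χ ⊆ V) (g : SmoothFn I V) : SmoothFn I U :=
  ⟨fun x => χ x * Function.extend Subtype.val g 0 (x : M), by
    intro x
    refine (contMDiffAt_subtype_iff (U := U) (x := x)
      (f := fun y : M => χ y * Function.extend Subtype.val g 0 y)).2 ?_
    by_cases hx : (x : M) ∈ V
    · exact (hχ x).mul (contMDiffAt_extend_fn g hx)
    · have : ∀ᶠ y in 𝓝 (x : M), χ y = 0 := by
        have := notMem_tsupport_iff_eventuallyEq.1 fun h => hx (hs h)
        exact this
      refine contMDiffAt_const (c := (0 : ℝ)) |>.congr_of_eventuallyEq ?_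
      filter_upwards [this] with y hy
      rw [hy, zero_mul]⟩

/-- A vector field on `V` multiplied by a cutoff function, as a vector field on `U`. -/
noncomputable def cutField (U : Opens M) {V : Opens M} {χ : M → ℝ}
    (hχ : ContMDiff I 𝓘(ℝ, ℝ) ∞ χ) (hs : tsupport χ ⊆ V) (Y : smoothFields I V) :
    smoothFields I U :=
  ⟨fun x => χ x • extField I Y.1 x, by
    refine contMDiff_field_of _ (fun y => χ y • extField I Y.1 y) (fun _ => rfl) fun x _ => ?_
    by_cases hx : x ∈ V
    · exact (hχ x).smul_section ((contMDiff_field_iff Y.1).1 Y.2 x hx)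
    · have : ∀ᶠ y in 𝓝 x, χ y = 0 := by
        have := notMem_tsupport_iff_eventuallyEq.1 fun h => hx (hs h)
        exact this
      refine (Bundle.contMDiffAt_zeroSection ℝ (TangentSpace I : M → Type _)).congr_of_eventuallyEq ?_
      filter_upwards [this] with y hy
      simp [hy, Bundle.zeroSection]⟩

/-- The value at `q` of a form evaluated on vector fields depends only on these near `q`. -/
lemma alt_congr {U : Opens M} {k : ℕ} (ζ : Alt I U k) {X Y : Fin k → smoothFields I U} {q : U}
    (h : ∀ i, ∀ᶠ x in 𝓝 q, (X i).1 x = (Y i).1 x) : ζ X q = ζ Y q := by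
  have hev : ∀ᶠ x in 𝓝 q, ∀ i, (X i).1 x = (Y i).1 x := eventually_all.2 h
  obtain ⟨W, hWs, hWo, hqW⟩ := eventually_nhds_iff.1 hev
  set V : Opens M := ⟨Subtype.val '' W, U.isOpen.isOpenMap_subtype_val W hWo⟩ with hV
  obtain ⟨χ, hχ, hχ1, hχs⟩ := exists_cutoff (I := I) (V := V) (p := q) ⟨q, hqW, rfl⟩
  set ψ : SmoothFn I U := ⟨fun x => χ x, hχ.comp contMDiff_subtype_val⟩ with hψ
  have hψq : ψ q = 1 := hχ1.self_of_nhds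
  have hXY : (fun i => ψ • X i) = fun i => ψ • Y i := by
    funext i
    refine Subtype.ext (funext fun x => ?_)
    rw [smoothFields_smul_apply, smoothFields_smul_apply]
    by_cases hx : x ∈ W
    · rw [hWs x hx i]
    · have h0 : χ x = 0 := by
        refine image_eq_zero_of_notMem_tsupport fun h => ?_
        obtain ⟨y, hy, hyx⟩ := hχs h
        exact hx (Subtype.ext hyx ▸ hy)
      have : ψ x = 0 := h0
      rw [this, zero_smul, zero_smul]
  have e : ∀ Z : Fin k → smoothFields I U, ζ (fun i => ψ • Z i) q = ζ Z q := by
    intro Z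
    have := ζ.toMultilinearMap.map_smul_univ (fun _ => ψ) Z
    have h2 : ζ (fun i => ψ • Z i) = (∏ _i : Fin k, ψ) • ζ Z := this
    rw [h2, Finset.prod_const, smul_eq_mul, ContMDiffMap.coe_mul, Pi.mul_apply,
      ContMDiffMap.coe_pow, Pi.pow_apply, hψq, one_pow, one_mul]
  rw [← e X, ← e Y, hXY]

lemma eventually_cutField {U V : Opens M} (h : V ≤ U) {χ : M → ℝ}
    (hχ : ContMDiff I 𝓘(ℝ, ℝ) ∞ χ) (hs : tsupport χ ⊆ V) {p : M} (hp : p ∈ V)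
    (h1 : χ =ᶠ[𝓝 p] 1) (Y : smoothFields I V) :
    ∀ᶠ x : U in 𝓝 ⟨p, h hp⟩, (cutField U hχ hs Y).1 x = extField I Y.1 x := by
  have : ∀ᶠ x : U in 𝓝 ⟨p, h hp⟩, χ x = 1 := by
    have hc : Tendsto (Subtype.val : U → M) (𝓝 ⟨p, h hp⟩) (𝓝 p) :=
      continuous_subtype_val.tendsto _
    exact hc.eventually h1
  filter_upwards [this] with x hx
  simp [cutField, hx]

/-- The value at `p ∈ V` of the restriction of `ζ` evaluated on the vector fields `Y`: multiply
the `Y i` by a cutoff function equal to `1` near `p`, extend them by zero to `U` and apply `ζ`. -/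
noncomputable def resVal {U V : Opens M} (h : V ≤ U) {k : ℕ} (ζ : Alt I U k)
    (Y : Fin k → smoothFields I V) (p : V) : ℝ :=
  ζ (fun i => cutField U (exists_cutoff (I := I) p.2).choose_spec.1
    (exists_cutoff (I := I) p.2).choose_spec.2.2 (Y i)) (Opens.inclusion h p)

lemma resVal_eq {U V : Opens M} (h : V ≤ U) {k : ℕ} (ζ : Alt I U k)
    (Y : Fin k → smoothFields I V) (p : V) (X : Fin k → smoothFields I U)
    (hX : ∀ i, ∀ᶠ x : U in 𝓝 (Opens.inclusion h p), (X i).1 x = extField I (Y i).1 x) :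
    resVal h ζ Y p = ζ X (Opens.inclusion h p) := by
  refine alt_congr ζ fun i => ?_
  filter_upwards [hX i, eventually_cutField h (exists_cutoff (I := I) p.2).choose_spec.1
    (exists_cutoff (I := I) p.2).choose_spec.2.2 p.2
    (exists_cutoff (I := I) p.2).choose_spec.2.1 (Y i)] with x hx hx'
  rw [hx]
  exact hx'

lemma exists_near {U V : Opens M} (h : V ≤ U) (p : V) (Y : smoothFields I V) :
    ∃ X : smoothFields I U,
      ∀ᶠ x : U in 𝓝 (Opens.inclusion h p), X.1 x = extField I Y.1 x :=
  ⟨_, eventually_cutField h (exists_cutoff (I := I) p.2).choose_spec.1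
    (exists_cutoff (I := I) p.2).choose_spec.2.2 p.2
    (exists_cutoff (I := I) p.2).choose_spec.2.1 Y⟩

lemma contMDiff_resVal {U V : Opens M} (h : V ≤ U) {k : ℕ} (ζ : Alt I U k)
    (Y : Fin k → smoothFields I V) : ContMDiff I 𝓘(ℝ, ℝ) ∞ (resVal h ζ Y) := by
  intro p
  choose X hX using fun i => exists_near h p (Y i)
  have hζ : ContMDiffAt I 𝓘(ℝ, ℝ) ∞ (fun q : V => ζ X (Opens.inclusion h q)) p :=
    ((ζ X).contMDiff.comp (contMDiff_inclusion h)) p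
  refine hζ.congr_of_eventuallyEq ?_
  have hc : Tendsto (Opens.inclusion h) (𝓝 p) (𝓝 (Opens.inclusion h p)) :=
    (contMDiff_inclusion (I := I) (n := ∞) h).continuous.tendsto p
  filter_upwards [hc.eventually (eventually_all.2 hX).eventually_nhds] with q hq
  exact resVal_eq h ζ Y q X fun i => hq.mono fun x hx => hx i

lemma resVal_update {U V : Opens M} (h : V ≤ U) {k : ℕ} (ζ : Alt I U k)
    (Y : Fin k → smoothFields I V) (p : V) [DecidableEq (Fin k)] (i : Fin k)
    (Z : smoothFields I V)
    (X : Fin k → smoothFields I U) (W : smoothFields I U)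
    (hX : ∀ i, ∀ᶠ x : U in 𝓝 (Opens.inclusion h p), (X i).1 x = extField I (Y i).1 x)
    (hW : ∀ᶠ x : U in 𝓝 (Opens.inclusion h p), W.1 x = extField I Z.1 x) :
    resVal h ζ (Function.update Y i Z) p = ζ (Function.update X i W) (Opens.inclusion h p) := by
  refine resVal_eq h ζ _ p _ fun j => ?_
  by_cases hj : j = i
  · subst hj; simpa using hW
  · simpa [Function.update_of_ne hj] using hX j

/-- The restriction `Alt^k(U, M) → Alt^k(V, M)`, that is, the pullback of forms along the inclusion
of `V` in `U`. It is characterized by `resAlt_resField` below. -/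
noncomputable def resAlt {U V : Opens M} (h : V ≤ U) {k : ℕ} (ζ : Alt I U k) : Alt I V k where
  toFun Y := ⟨resVal h ζ Y, contMDiff_resVal h ζ Y⟩
  map_update_add' := by
    intro _ Y i Z Z'
    ext p
    choose X hX using fun i => exists_near h p (Y i)
    obtain ⟨W, hW⟩ := exists_near h p Z
    obtain ⟨W', hW'⟩ := exists_near h p Z'
    have h1 := resVal_update h ζ Y p i (Z + Z') X (W + W') hX (by
      filter_upwards [hW, hW'] with x hx hx'
      have e : extField I (Z + Z').1 x = extField I Z.1 x + extField I Z'.1 x := by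
        by_cases hxV : (x : M) ∈ V <;> simp [extField, hxV]
      rw [e, ← hx, ← hx']; rfl)
    have h2 := resVal_update h ζ Y p i Z X W hX hW
    have h3 := resVal_update h ζ Y p i Z' X W' hX hW'
    have h4 := DFunLike.congr_fun (ζ.map_update_add X i W W') (Opens.inclusion h p)
    exact h1.trans (h4.trans (congrArg₂ (· + ·) h2.symm h3.symm))
  map_update_smul' := by
    intro _ Y i g Z
    ext p
    choose X hX using fun i => exists_near h p (Y i)
    obtain ⟨W, hW⟩ := exists_near h p Z
    obtain ⟨χ, hχ, hχ1, hχs⟩ := exists_cutoff (I := I) p.2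
    have hev : ∀ᶠ x : U in 𝓝 (Opens.inclusion h p), χ x = 1 := by
      have hc : Tendsto (Subtype.val : U → M) (𝓝 (Opens.inclusion h p)) (𝓝 p) :=
        continuous_subtype_val.tendsto _
      exact hc.eventually hχ1
    have hVm : ∀ᶠ x : U in 𝓝 (Opens.inclusion h p), (x : M) ∈ V := by
      have hc : Tendsto (Subtype.val : U → M) (𝓝 (Opens.inclusion h p)) (𝓝 p) :=
        continuous_subtype_val.tendsto _
      exact hc.eventually (V.isOpen.mem_nhds p.2)
    set g' := cutFn U hχ hχs g with hg'
    have hgx : ∀ x : U, χ x = 1 → ∀ hx : (x : M) ∈ V, g' x = g ⟨x, hx⟩ := by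
      intro x hx hxV
      change χ x * Function.extend Subtype.val g 0 (x : M) = _
      rw [hx, one_mul, extend_apply_of_mem _ hxV]
    have h1 := resVal_update h ζ Y p i (g • Z) X (g' • W) hX (by
      filter_upwards [hW, hev, hVm] with x hx hx1 hxV
      have e : extField I (g • Z).1 x = g ⟨x, hxV⟩ • extField I Z.1 x := by
        simp [extField, hxV, smoothFields_smul_apply]
      rw [e, ← hx, smoothFields_smul_apply, hgx x hx1 hxV])
    have h2 := resVal_update h ζ Y p i Z X W hX hW
    have h4 := DFunLike.congr_fun (ζ.map_update_smul X i g' W) (Opens.inclusion h p)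
    refine h1.trans (h4.trans ?_)
    change g' (Opens.inclusion h p) * _ = g p * _
    rw [hgx _ hev.self_of_nhds p.2]
    exact congrArg (g p * ·) h2.symm
  map_eq_zero_of_eq' := by
    intro Y i j hij hne
    ext p
    change ζ _ _ = 0
    rw [ζ.map_eq_zero_of_eq _ (by simp only [hij]) hne]
    rfl

/-- The restriction of `ζ`, evaluated on restrictions of vector fields, is the restriction of the
value of `ζ`. -/
lemma resAlt_resField {U V : Opens M} (h : V ≤ U) {k : ℕ} (ζ : Alt I U k)
    (X : Fin k → smoothFields I U) :
    resAlt h ζ (fun i => resField I h (X i)) = resFn I h (ζ X) := by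
  ext p
  refine resVal_eq h ζ _ p X fun i => ?_
  have hc : Tendsto (Subtype.val : U → M) (𝓝 (Opens.inclusion h p)) (𝓝 p) :=
    continuous_subtype_val.tendsto _
  filter_upwards [hc.eventually (V.isOpen.mem_nhds p.2)] with x hx
  exact (extField_of_mem (resField I h (X i)).1 ⟨x, hx⟩).symm

lemma resAlt_add {U V : Opens M} (h : V ≤ U) {k : ℕ} (ζ η : Alt I U k) :
    resAlt h (ζ + η) = resAlt h ζ + resAlt h η := rfl

lemma resAlt_smul {U V : Opens M} (h : V ≤ U) {k : ℕ} (g : SmoothFn I U) (ζ : Alt I U k) :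
    resAlt h (g • ζ) = resFn I h g • resAlt h ζ := rfl

variable (I) (G : Type*) [AddCommGroup G] [Module ℝ G] [TopologicalSpace G]
  [IsTopologicalAddGroup G] [ContinuousSMul ℝ G] [LocallyConvexSpace ℝ G]

/-- The restriction (pullback along the inclusion) `Alt^k(U, M; G) → Alt^k(V, M; G)`: the additive
map with `f ⊗ ζ ↦ f|_V ⊗ ζ|_V`. -/
noncomputable def resGAlt {U V : Opens M} (h : V ≤ U) (k : ℕ) : GAlt I G U k →+ GAlt I G V k :=
  TensorProduct.liftAddHom
    { toFun := fun f =>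
        { toFun := fun ζ => resMap I G h f ⊗ₜ[SmoothFn I V] resAlt h ζ
          map_zero' := by
            have : resAlt h (0 : Alt I U k) = 0 := rfl
            rw [this, TensorProduct.tmul_zero]
          map_add' := fun ζ η => by rw [resAlt_add, TensorProduct.tmul_add] }
      map_zero' := by ext ζ; simp
      map_add' := fun f g => by ext ζ; simp [TensorProduct.add_tmul] }
    (fun g f ζ => by
      have : resMap I G h (g • f) = resFn I h g • resMap I G h f := rfl
      simp only [AddMonoidHom.coe_mk, ZeroHom.coe_mk]
      rw [this, resAlt_smul, TensorProduct.smul_tmul])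

lemma resGAlt_tmul {U V : Opens M} (h : V ≤ U) (k : ℕ) (f : smoothMaps I G U) (ζ : Alt I U k) :
    resGAlt I G h k (f ⊗ₜ ζ) = resMap I G h f ⊗ₜ resAlt h ζ := rfl

/-- The restriction `Alt^•(U, M; G) → Alt^•(V, M; G)`. -/
noncomputable def resGForms {U V : Opens M} (h : V ≤ U) : GForms I G U →+ GForms I G V :=
  DirectSum.map fun k => resGAlt I G h k

end Restriction

section Chart

variable [IsManifold I ∞ M]

/-- The domain of a chart, as an open set. -/
def chartDom (φ : OpenPartialHomeomorph M H) : Opens M := ⟨φ.source, φ.open_source⟩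

variable {φ : OpenPartialHomeomorph M H}

section Partial

variable {G : Type*} [AddCommGroup G] [Module ℝ G] [TopologicalSpace G]
  [IsTopologicalAddGroup G] [ContinuousSMul ℝ G] [LocallyConvexSpace ℝ G] [T2Space G]

variable {I}

lemma smoothMaps_rep (hφ : φ ∈ IsManifold.maximalAtlas I ∞ M) (f : smoothMaps I G (chartDom φ)) :
    BastianiSmoothOn (φ.extend I).target (chartRep I φ f.1) :=
  f.2 φ hφ subset_rfl

/-- The transition map between two charts sends interior points to interior points. -/
lemma transition_interior {ψ : OpenPartialHomeomorph M H}
    (hφ : φ ∈ IsManifold.maximalAtlas I ∞ M) (hψ : ψ ∈ IsManifold.maximalAtlas I ∞ M)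
    (hs : ψ.source ⊆ φ.source) :
    ContDiffOn ℝ ∞ (fun y => φ.extend I ((ψ.extend I).symm y)) (ψ.extend I).target ∧
    MapsTo (fun y => φ.extend I ((ψ.extend I).symm y)) (ψ.extend I).target (φ.extend I).target ∧
    MapsTo (fun y => φ.extend I ((ψ.extend I).symm y)) (interior (ψ.extend I).target)
      (interior (φ.extend I).target) := by
  have hsrc : (I.extendCoordChange ψ φ).source = (ψ.extend I).target := by
    rw [ModelWithCorners.extendCoordChange, PartialEquiv.trans_source, PartialEquiv.symm_source,
      inter_eq_left]
    intro y hy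
    have := (ψ.extend I).map_target hy
    rw [ψ.extend_source] at this
    rw [mem_preimage, φ.extend_source]
    exact hs this
  have hcd := ModelWithCorners.contDiffOn_extendCoordChange hψ hφ
  have hinv := fun x => ModelWithCorners.isInvertible_fderivWithin_extendCoordChange (x := x) (n := ∞) (by simp)
    hψ hφ
  rw [hsrc] at hcd
  have hm : MapsTo (fun y => φ.extend I ((ψ.extend I).symm y)) (ψ.extend I).target
      (φ.extend I).target := by
    intro y hy
    have := (ψ.extend I).map_target hy
    rw [ψ.extend_source] at this
    exact (φ.extend I).map_source (by rw [φ.extend_source]; exact hs this)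
  refine ⟨hcd, hm, ?_⟩
  intro y hy
  have hyn : (ψ.extend I).target ∈ 𝓝 y := mem_interior_iff_mem_nhds.1 hy
  have hd : DifferentiableAt ℝ (I.extendCoordChange ψ φ) y :=
    (hcd.differentiableOn (by simp) y (interior_subset hy)).differentiableAt hyn
  have h2 := hinv y (by rw [hsrc]; exact interior_subset hy)
  rw [hsrc, fderivWithin_of_mem_nhds hyn] at h2
  have := hd.mem_interior_convex_of_surjective_fderiv hyn I.convex_range I.isClosed_range
    I.nonempty_interior (hm.mono_right φ.extend_target_subset_range) h2.surjective
  have h3 := hm (interior_subset hy)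
  rw [φ.extend_target] at h3
  rw [interior_target]
  exact ⟨h3.1, this⟩

/-- The `j`-th partial derivative in the chart `φ` of a `G`-valued smooth map on the domain of
`φ`: the Bastiani derivative, in the direction of the `j`-th standard basis vector, of the
representation of the map in the chart. -/
noncomputable def partialDeriv (hφ : φ ∈ IsManifold.maximalAtlas I ∞ M) (j : Fin N)
    (f : smoothMaps I G (chartDom φ)) : smoothMaps I G (chartDom φ) :=
  ⟨fun x => (smoothMaps_rep hφ f).deriv (φ.extend I x, EuclideanSpace.single j 1), by
    intro ψ hψ hs k
    obtain ⟨h1, h2, h3⟩ := transition_interior hφ hψ hs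
    have hd := (smoothMaps_rep hφ f).smooth_deriv (target_subset_closure φ) k
    refine BastianiOn.congr (hd.comp (S' := (ψ.extend I).target)
      (T := fun y => (φ.extend I ((ψ.extend I).symm y), EuclideanSpace.single j (1 : ℝ)))
      (uniqueDiffOn_target ψ) (h1.prodMk contDiffOn_const) (fun y hy => ⟨h2 hy, mem_univ _⟩)
      (fun y hy => ?_)) fun y hy => ?_
    · rw [interior_prod_univ']
      exact ⟨h3 hy, mem_univ _⟩
    · rw [chartRep_apply hs _ hy]⟩

end Partial

section Coordinates

variable {I}

lemma mdiffAt_extend (hφ : φ ∈ IsManifold.maximalAtlas I ∞ M) {x : M} (hx : x ∈ φ.source) :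
    MDifferentiableAt I 𝓘(ℝ, EuclideanSpace ℝ (Fin N)) (φ.extend I) x :=
  (φ.contMDiffAt_extend hφ hx).mdifferentiableAt (by simp)

/-- The derivative at `p` of the chart `φ`, as a map into the model vector space. -/
noncomputable def chartDeriv (φ : OpenPartialHomeomorph M H) (p : M) :
    TangentSpace I p →ₗ[ℝ] EuclideanSpace ℝ (Fin N) :=
  (mfderiv I 𝓘(ℝ, EuclideanSpace ℝ (Fin N)) (φ.extend I) p).toLinearMap

lemma contMDiffAt_chartDeriv (hφ : φ ∈ IsManifold.maximalAtlas I ∞ M)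
    {Y : ∀ y : M, TangentSpace I y} {x : M} (hx : x ∈ φ.source)
    (hY : ContMDiffAt I I.tangent ∞ (fun y => (⟨y, Y y⟩ : TangentBundle I M)) x) :
    ContMDiffAt I 𝓘(ℝ, EuclideanSpace ℝ (Fin N)) ∞ (fun y => chartDeriv φ y (Y y)) x := by
  have h1 := (φ.contMDiffOn_extend hφ).contMDiffOn_tangentMapWithin (m := ∞) (by simp)
    φ.open_source.uniqueMDiffOn
  have hn : Bundle.TotalSpace.proj ⁻¹' φ.source ∈ 𝓝 (⟨x, Y x⟩ : TangentBundle I M) :=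
    (FiberBundle.continuous_proj _ _).continuousAt.preimage_mem_nhds (φ.open_source.mem_nhds hx)
  have h2 := (h1 ⟨x, Y x⟩ hx).contMDiffAt hn
  have h3 := h2.comp x hY
  have h4 := (contMDiff_snd_tangentBundle_modelSpace (EuclideanSpace ℝ (Fin N))
    𝓘(ℝ, EuclideanSpace ℝ (Fin N)) (n := ∞)).contMDiffAt.comp x h3
  refine h4.congr_of_eventuallyEq ?_
  filter_upwards [φ.open_source.mem_nhds hx] with y hy
  simp only [Function.comp, tangentMapWithin]
  rw [mfderivWithin_of_isOpen φ.open_source hy]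
  rfl

/-- The coordinate differential `dx_j` of the chart `φ`: `dx_j(X)(p)` is the `j`-th component of
the derivative at `p` of the chart applied to `X(p)`. -/
noncomputable def coordDiff (hφ : φ ∈ IsManifold.maximalAtlas I ∞ M) (j : Fin N) :
    smoothFields I (chartDom φ) →ₗ[SmoothFn I (chartDom φ)] SmoothFn I (chartDom φ) where
  toFun X := ⟨fun p => chartDeriv φ (p : M) (X.1 p) j, by
    intro p
    have h1 := contMDiffAt_chartDeriv hφ p.2 ((contMDiff_field_iff X.1).1 X.2 p p.2)
    have h2 := (EuclideanSpace.proj (𝕜 := ℝ) j).contMDiff (n := ∞) |>.contMDiffAt.comp (p : M) h1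
    refine ((contMDiffAt_subtype_iff (U := chartDom φ) (x := p)).2 h2).congr_of_eventuallyEq
      (Eventually.of_forall fun q => ?_)
    simp [extField_of_mem]⟩
  map_add' X Y := by
    ext p
    exact congrArg (fun v : EuclideanSpace ℝ (Fin N) => v j)
      ((chartDeriv φ (p : M)).map_add (X.1 p) (Y.1 p))
  map_smul' h X := by
    ext p
    exact congrArg (fun v : EuclideanSpace ℝ (Fin N) => v j)
      ((chartDeriv φ (p : M)).map_smul (h p) (X.1 p))

lemma mfderiv_extend_comp (hφ : φ ∈ IsManifold.maximalAtlas I ∞ M) {x : M} (hx : x ∈ φ.source) :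
    (mfderiv I 𝓘(ℝ, EuclideanSpace ℝ (Fin N)) (φ.extend I) x) ∘L
      (mfderivWithin 𝓘(ℝ, EuclideanSpace ℝ (Fin N)) I (φ.extend I).symm (φ.extend I).target
        (φ.extend I x)) = ContinuousLinearMap.id _ _ := by
  have hx' : x ∈ (φ.extend I).source := by rwa [φ.extend_source]
  have hy := (φ.extend I).map_source hx'
  have U : UniqueMDiffWithinAt 𝓘(ℝ, EuclideanSpace ℝ (Fin N)) (φ.extend I).target
      (φ.extend I x) := (uniqueDiffOn_target φ _ hy).uniqueMDiffWithinAt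
  have h1 := contMDiffOn_extend_symm hφ
  rw [← φ.extend_target'] at h1
  rw [← mfderiv_comp_mfderivWithin_of_eq (mdiffAt_extend hφ hx)
    ((h1 _ hy).mdifferentiableWithinAt (by simp)) U ((φ.extend I).left_inv hx'),
    ← mfderivWithin_id U]
  exact mfderivWithin_congr (fun z hz => (φ.extend I).right_inv hz) ((φ.extend I).right_inv hy)

lemma mfderiv_symm_comp (hφ : φ ∈ IsManifold.maximalAtlas I ∞ M) {x : M} (hx : x ∈ φ.source) :
    (mfderivWithin 𝓘(ℝ, EuclideanSpace ℝ (Fin N)) I (φ.extend I).symm (φ.extend I).target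
        (φ.extend I x)) ∘L (mfderiv I 𝓘(ℝ, EuclideanSpace ℝ (Fin N)) (φ.extend I) x) =
      ContinuousLinearMap.id _ _ := by
  have hx' : x ∈ (φ.extend I).source := by rwa [φ.extend_source]
  have hy := (φ.extend I).map_source hx'
  have U : UniqueMDiffWithinAt I φ.source x := φ.open_source.uniqueMDiffWithinAt hx
  have h1 := contMDiffOn_extend_symm hφ
  rw [← φ.extend_target'] at h1
  rw [← mfderivWithin_of_isOpen φ.open_source hx, ← mfderivWithin_comp _
    ((h1 _ hy).mdifferentiableWithinAt (by simp))
    (mdiffAt_extend hφ hx).mdifferentiableWithinAt ?_ U, ← mfderivWithin_id U]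
  · exact mfderivWithin_congr (fun z hz => (φ.extend I).left_inv (by rwa [φ.extend_source]))
      ((φ.extend I).left_inv hx')
  · intro z hz
    exact (φ.extend I).map_source (by rwa [φ.extend_source])

/-- The derivative at `φ p` of the inverse of the chart `φ`. -/
noncomputable def chartSymmDeriv (φ : OpenPartialHomeomorph M H) (p : M) :
    EuclideanSpace ℝ (Fin N) →ₗ[ℝ] TangentSpace I p :=
  (mfderivWithin 𝓘(ℝ, EuclideanSpace ℝ (Fin N)) I (φ.extend I).symm (φ.extend I).target
        (φ.extend I p)).toLinearMap

lemma chartDeriv_symm (hφ : φ ∈ IsManifold.maximalAtlas I ∞ M) {x : M} (hx : x ∈ φ.source)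
    (v : EuclideanSpace ℝ (Fin N)) : chartDeriv (I := I) φ x (chartSymmDeriv φ x v) = v :=
  DFunLike.congr_fun (mfderiv_extend_comp hφ hx) v

lemma chartSymmDeriv_deriv (hφ : φ ∈ IsManifold.maximalAtlas I ∞ M) {x : M} (hx : x ∈ φ.source)
    (v : TangentSpace I x) : chartSymmDeriv φ x (chartDeriv φ x v) = v :=
  DFunLike.congr_fun (mfderiv_symm_comp hφ hx) v

/-- The coordinate vector field `∂_j` of the chart `φ`. -/
noncomputable def coordField (hφ : φ ∈ IsManifold.maximalAtlas I ∞ M) (j : Fin N) :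
    smoothFields I (chartDom φ) :=
  ⟨fun p => chartSymmDeriv φ p (EuclideanSpace.single j (1 : ℝ)), by
    have h1 := contMDiffOn_extend_symm hφ
    rw [← φ.extend_target'] at h1
    have h2 := h1.contMDiffOn_tangentMapWithin (m := ∞) (by simp)
      (uniqueDiffOn_target φ).uniqueMDiffOn
    have h3 : ContMDiff 𝓘(ℝ, EuclideanSpace ℝ (Fin N)) 𝓘(ℝ, EuclideanSpace ℝ (Fin N)).tangent ∞
        (fun y => (⟨y, EuclideanSpace.single j (1 : ℝ)⟩ :
          TangentBundle 𝓘(ℝ, EuclideanSpace ℝ (Fin N)) (EuclideanSpace ℝ (Fin N)))) :=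
      contMDiff_vectorSpace_iff_contDiff.2
        (contDiff_const (c := EuclideanSpace.single j (1 : ℝ)))
    have h4 : ContMDiffOn I I.tangent ∞ _ φ.source :=
      h2.comp (h3.comp_contMDiffOn (φ.contMDiffOn_extend hφ)) fun x hx =>
        (φ.extend I).map_source (by rwa [φ.extend_source])
    refine (h4.comp_contMDiff (contMDiff_subtype_val (U := chartDom φ)) fun x => x.2).congr
      fun p => ?_
    have : (p : M) = (φ.extend I).symm (φ.extend I p) := (φ.extend_left_inv p.2).symm
    exact (Bundle.TotalSpace.mk.injEq _ _ _ _).symm ▸ ⟨this, HEq.rfl⟩⟩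

lemma coordDiff_coordField (hφ : φ ∈ IsManifold.maximalAtlas I ∞ M) (i j : Fin N) :
    coordDiff hφ i (coordField hφ j) = if i = j then 1 else 0 := by
  ext p
  have h2 : coordDiff hφ i (coordField hφ j) p =
      (EuclideanSpace.single j (1 : ℝ) : EuclideanSpace ℝ (Fin N)) i :=
    congrArg (fun v : EuclideanSpace ℝ (Fin N) => v i) (chartDeriv_symm hφ p.2 _)
  rw [h2]
  split_ifs with h <;> simp [h]

lemma coordDiff_injective (hφ : φ ∈ IsManifold.maximalAtlas I ∞ M)
    {X : smoothFields I (chartDom φ)} (h : ∀ j, coordDiff hφ j X = 0) : X = 0 := by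
  refine Subtype.ext (funext fun p => ?_)
  have h0 : chartDeriv φ (p : M) (X.1 p) = 0 := by
    ext j
    exact DFunLike.congr_fun (h j) p
  rw [← chartSymmDeriv_deriv hφ p.2 (X.1 p), h0, map_zero]
  rfl

/-- The coordinate vector fields are a basis of the module of vector fields on a chart domain. -/
noncomputable def coordBasis (hφ : φ ∈ IsManifold.maximalAtlas I ∞ M) :
    Module.Basis (Fin N) (SmoothFn I (chartDom φ)) (smoothFields I (chartDom φ)) :=
  Module.Basis.ofEquivFun <| LinearEquiv.ofLinearMap (LinearMap.pi (coordDiff hφ))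
    (Fintype.linearCombination _ (coordField hφ))
    (by
      refine LinearMap.ext fun c => funext fun i => ?_
      simp [Fintype.linearCombination_apply, coordDiff_coordField])
    (by
      refine LinearMap.ext fun X => ?_
      rw [← sub_eq_zero]
      refine coordDiff_injective hφ fun j => ?_
      simp [Fintype.linearCombination_apply, coordDiff_coordField])

lemma coordBasis_apply (hφ : φ ∈ IsManifold.maximalAtlas I ∞ M) (j : Fin N) :
    coordBasis hφ j = coordField hφ j := by
  simp [coordBasis, Module.Basis.coe_ofEquivFun, Fintype.linearCombination_apply, Pi.single_apply]

end Coordinates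

end Chart
section ChartDifferential

variable [IsManifold I ∞ M] {φ : OpenPartialHomeomorph M H}

variable {I}

/-- `dx_{I(0)} ∧ … ∧ dx_{I(k-1)}` for a strictly increasing multi-index `I`. -/
noncomputable def coordForm (hφ : φ ∈ IsManifold.maximalAtlas I ∞ M) {k : ℕ}
    (J : Fin k ↪o Fin N) : Alt I (chartDom φ) k :=
  wedgeList k fun a => coordDiff hφ (J a)

variable {G : Type*} [AddCommGroup G] [Module ℝ G] [TopologicalSpace G]
  [IsTopologicalAddGroup G] [ContinuousSMul ℝ G] [LocallyConvexSpace ℝ G]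

/-- Unique decomposition of `G`-valued smooth forms on the domain of a chart. -/
lemma existsUnique_coeff (hφ : φ ∈ IsManifold.maximalAtlas I ∞ M) {k : ℕ}
    (θ : GAlt I G (chartDom φ) k) :
    ∃! f : (Fin k ↪o Fin N) → smoothMaps I G (chartDom φ),
      θ = ∑ J, f J ⊗ₜ[SmoothFn I (chartDom φ)] coordForm hφ J :=
  existsUnique_decomp (coordBasis hφ)
    (fun i j => by rw [coordBasis_apply, coordDiff_coordField]) θ

/-- The coefficients of the unique decomposition of a `G`-valued form on a chart domain. -/
noncomputable def coeff (hφ : φ ∈ IsManifold.maximalAtlas I ∞ M) {k : ℕ}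
    (θ : GAlt I G (chartDom φ) k) : (Fin k ↪o Fin N) → smoothMaps I G (chartDom φ) :=
  (existsUnique_coeff hφ θ).choose

lemma eq_sum_coeff (hφ : φ ∈ IsManifold.maximalAtlas I ∞ M) {k : ℕ}
    (θ : GAlt I G (chartDom φ) k) :
    θ = ∑ J, coeff hφ θ J ⊗ₜ[SmoothFn I (chartDom φ)] coordForm hφ J :=
  (existsUnique_coeff hφ θ).choose_spec.1

variable [T2Space G]

/-- The differential of a `G`-valued `k`-form on the domain of a chart `φ`: if `θ = ∑_J f_J ⊗ dx_J`
then `dθ = ∑_J ∑_j ∂_j f_J ⊗ (dx_j ∧ dx_J)`. -/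
noncomputable def chartDiffAlt (hφ : φ ∈ IsManifold.maximalAtlas I ∞ M) {k : ℕ}
    (θ : GAlt I G (chartDom φ) k) : GAlt I G (chartDom φ) (k + 1) :=
  ∑ J : Fin k ↪o Fin N, ∑ j : Fin N,
    partialDeriv hφ j (coeff hφ θ J) ⊗ₜ[SmoothFn I (chartDom φ)]
      wedgeOne (coordDiff hφ j) (coordForm hφ J)

open Classical in
/-- The differential of `G`-valued forms on the domain of a chart, degree by degree. -/
noncomputable def chartDiff (hφ : φ ∈ IsManifold.maximalAtlas I ∞ M)
    (θ : GForms I G (chartDom φ)) : GForms I G (chartDom φ) :=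
  ∑ k ∈ DFinsupp.support θ,
    DirectSum.of (fun k => GAlt I G (chartDom φ) k) (k + 1) (chartDiffAlt hφ (θ k))

end ChartDifferential

end Manifold

end GForm

/-! The difficulty is that `Alt^k(U, M; G)` is an algebraic tensor product over the functions on
`U`, and such a product is not visibly a sheaf: neither uniqueness (a form is determined by its
restrictions to a cover) nor existence (compatible local forms glue) is clear when the cover is
infinite. What saves the situation is that the vector fields on `U` have a finite dual basis: fields
`X_i` and covector fields `l_i` with `∑ l_i(v) X_i(p) = v` at every point `p` (`exists_dualBasis`).
Then every form over an open `V ≤ U` is `∑_J θ(X_J) ⊗ l_J` (`gAlt_decomp`), so it is determined by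
its finitely many coefficients `θ(X_J)`, which are `G`-valued functions. Those do form a sheaf,
being Bastiani smooth is local, and evaluation on the `X_J` commutes with restriction
(`tensorEval_resGAlt`). Separation and gluing of forms follow (`gAlt_ext_of_cover`,
`exists_gAlt_glue`).

The dual basis is finite because `M` has finite dimension. The cover of `U` by chart domains can be
refined so that finitely many colours suffice, with a locally constant choice of chart inside each
colour (`exists_finite_coloring`, `exists_local_charts`). Each colour contributes `N` cut-off
coordinate fields and `N` cut-off coordinate differentials.

It remains to see that the local differentials are compatible (`resGAlt_chartDiffAlt`). By symmetry
of second derivatives a wedge of differentials of functions is closed in any chart, so `d(f ⊗ dy_1 ∧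
… ∧ dy_k) = ∑_j ∂_j f ⊗ dx_j ∧ dy_1 ∧ … ∧ dy_k` holds for arbitrary functions `y_a`, in particular
for the coordinates of another chart. The chain rule for Bastiani derivatives turns the partial
derivatives of one chart into those of the other. Since the derivatives at boundary points are
continuous extensions, every identity between them is proved in the interior and carried over by
density. -/

namespace GForm

set_option linter.unusedSectionVars false
open TopologicalSpace

/-! ### Covering dimension: refining open covers with a bounded number of colours. -/

section Coloring

/-- `K` can be covered by finitely many sets `S c`, indexed by the colours `c : C`, such that each
`S c` splits into uniformly separated parts of arbitrarily small diameter; the part of a point `x`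
of `S c` is recorded by the label `n c x`. -/
def FinelyColorable {X : Type*} [PseudoMetricSpace X] (C : Type*) (K : Set X) : Prop :=
  ∀ ε > (0 : ℝ), ∃ r > (0 : ℝ), ∃ (S : C → Set X) (n : C → X → X), K ⊆ ⋃ c, S c ∧
    (∀ c, ∀ x ∈ S c, dist x (n c x) ≤ ε) ∧
    ∀ c, ∀ x ∈ S c, ∀ y ∈ S c, dist x y < r → n c x = n c y

namespace FinelyColorable

variable {X : Type*} [PseudoMetricSpace X] {C : Type*} {K L : Set X}

lemma mono (hKL : K ⊆ L) (h : FinelyColorable C L) : FinelyColorable C K := by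
  intro ε hε
  obtain ⟨r, hr, S, n, h1, h2⟩ := h ε hε
  exact ⟨r, hr, S, n, hKL.trans h1, h2⟩

lemma empty : FinelyColorable C (∅ : Set X) := fun _ _ =>
  ⟨1, one_pos, fun _ => ∅, fun _ => id, empty_subset _, by simp, by simp⟩

open Classical in
/-- The saturated union of a coarse colouring and a sufficiently fine one. -/
lemma union (hK : FinelyColorable C K) (hL : FinelyColorable C L) :
    FinelyColorable C (K ∪ L) := by
  intro ε hε
  obtain ⟨r, hr, S, n, hS, hn, hnr⟩ := hK (ε / 2) (by positivity)
  -- The parts of the second colouring are made so small compared with the separation `r` of the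
  -- first that none of them can be close to two different parts of the first.
  obtain ⟨s, hs, T, m, hT, hm, hms⟩ := hL (min (r / 8) (ε / 8)) (by positivity)
  set η := min (r / 4) (ε / 8) with hη
  have hη0 : 0 < η := by positivity
  have hηr : η ≤ r / 4 := min_le_left _ _
  have hηε : η ≤ ε / 8 := min_le_right _ _
  have hmr : ∀ c, ∀ x ∈ T c, dist x (m c x) ≤ r / 8 := fun c x hx =>
    (hm c x hx).trans (min_le_left _ _)
  have hmε : ∀ c, ∀ x ∈ T c, dist x (m c x) ≤ ε / 8 := fun c x hx =>
    (hm c x hx).trans (min_le_right _ _)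
  -- A fine part that comes within `η` of a coarse part of the same colour is absorbed by it and
  -- takes over its label; the other fine parts keep theirs. No new colour is spent.
  let near : C → X → X → Prop := fun c l v => v ∈ S c ∧ ∃ u ∈ T c, m c u = l ∧ dist u v < η
  let g : C → X → X := fun c l => if h : ∃ v, near c l v then n c h.choose else l
  have hg : ∀ c l, (∃ v, near c l v ∧ g c l = n c v) ∨ ((¬ ∃ v, near c l v) ∧ g c l = l) := by
    intro c l
    by_cases h : ∃ v, near c l v
    · exact Or.inl ⟨h.choose, h.choose_spec, dif_pos h⟩
    · exact Or.inr ⟨h, dif_neg h⟩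
  refine ⟨min s η, by positivity, fun c => S c ∪ T c,
    fun c x => if x ∈ S c then n c x else g c (m c x), ?_, ?_, ?_⟩
  · rintro x (hx | hx)
    · obtain ⟨c, hc⟩ := mem_iUnion.1 (hS hx)
      exact mem_iUnion.2 ⟨c, Or.inl hc⟩
    · obtain ⟨c, hc⟩ := mem_iUnion.1 (hT hx)
      exact mem_iUnion.2 ⟨c, Or.inr hc⟩
  · intro c x hx
    by_cases hxS : x ∈ S c
    · simp only [hxS, if_true]
      linarith [hn c x hxS]
    have hxT : x ∈ T c := hx.resolve_left hxS
    simp only [hxS, if_false]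
    have h1 := hmε c x hxT
    rcases hg c (m c x) with ⟨v, ⟨hv, u, hu, hul, huv⟩, h⟩ | ⟨-, h⟩
    · rw [h]
      have h2 := hmε c u hu
      rw [hul] at h2
      have h3 := hn c v hv
      have h4 := dist_triangle x (m c x) (n c v)
      have h5 := dist_triangle (m c x) u (n c v)
      have h6 := dist_triangle u v (n c v)
      rw [dist_comm (m c x) u] at h5
      linarith
    · rw [h]; linarith
  · intro c
    -- The absorbing part does not depend on the chosen witness `v`: two coarse points near the same
    -- fine part have distance less than `r/4 + r/8 + r/8 + r/4 < r`.
    have key : ∀ x ∈ S c, ∀ y ∈ T c, dist x y < min s η → g c (m c y) = n c x := by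
      intro x hx y hy hxy
      have hxy' : dist x y < η := hxy.trans_le (min_le_right _ _)
      rcases hg c (m c y) with ⟨v, ⟨hv, u, hu, hul, huv⟩, h⟩ | ⟨h, -⟩
      · rw [h]
        refine (hnr c x hx v hv ?_).symm
        have h1 := hmr c y hy
        have h2 := hmr c u hu
        rw [hul, dist_comm] at h2
        have h4 := dist_triangle x y v
        have h5 := dist_triangle y (m c y) v
        have h6 := dist_triangle (m c y) u v
        linarith
      · exact absurd ⟨x, hx, y, hy, rfl, by rwa [dist_comm]⟩ h
    intro x hx y hy hxy
    by_cases hxS : x ∈ S c <;> by_cases hyS : y ∈ S c <;> simp only [hxS, hyS, if_true, if_false]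
    · exact hnr c x hxS y hyS (by linarith [min_le_right s η])
    · exact (key x hxS y (hy.resolve_left hyS) hxy).symm
    · exact key y hyS x (hx.resolve_left hxS) (by rwa [dist_comm])
    · rw [hms c x (hx.resolve_left hxS) y (hy.resolve_left hyS) (hxy.trans_le (min_le_left _ _))]

/-- A compact set which embeds into `ℝ^N` is coloured by the parities of the cubes of a fine grid. -/
lemma of_injOn {Y : Type*} [MetricSpace Y] {K : Set Y} (hK : IsCompact K) {N : ℕ}
    {g : Y → (Fin N → ℝ)} (hg : ContinuousOn g K) (hi : InjOn g K) :
    FinelyColorable (Fin N → ZMod 2) K := by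
  rcases isEmpty_or_nonempty Y with hY | hY
  · rw [Set.eq_empty_of_isEmpty K]; exact empty
  intro ε hε
  -- The inverse of `g` is uniformly continuous on `g(K)`; this is sequential compactness of `K × K`
  -- together with injectivity.
  obtain ⟨δ, hδ, hδε⟩ : ∃ δ > (0 : ℝ), ∀ x ∈ K, ∀ y ∈ K, dist (g x) (g y) < δ → dist x y < ε := by
    by_contra! hcon
    choose x hx y hy hxy hε' using fun k : ℕ => hcon (1 / (k + 1)) Nat.one_div_pos_of_nat
    obtain ⟨⟨a, b⟩, ⟨ha, hb⟩, φ, hφ, hlim⟩ := (hK.prod hK).tendsto_subseq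
      (x := fun k => (x k, y k)) fun k => ⟨hx k, hy k⟩
    have hla : Tendsto (fun k => x (φ k)) atTop (𝓝 a) := (continuous_fst.tendsto _).comp hlim
    have hlb : Tendsto (fun k => y (φ k)) atTop (𝓝 b) := (continuous_snd.tendsto _).comp hlim
    have hga : Tendsto (fun k => g (x (φ k))) atTop (𝓝 (g a)) :=
      (hg a ha).tendsto.comp (tendsto_nhdsWithin_iff.2 ⟨hla, Eventually.of_forall fun k => hx _⟩)
    have hgb : Tendsto (fun k => g (y (φ k))) atTop (𝓝 (g b)) :=
      (hg b hb).tendsto.comp (tendsto_nhdsWithin_iff.2 ⟨hlb, Eventually.of_forall fun k => hy _⟩)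
    have h0 : dist (g a) (g b) ≤ 0 := by
      refine le_of_tendsto_of_tendsto' (hga.dist hgb)
        (tendsto_one_div_add_atTop_nhds_zero_nat.comp hφ.tendsto_atTop) fun k => (hxy _).le
    have hab : a = b := hi ha hb (dist_le_zero.1 h0)
    have h1 : ε ≤ dist a b := ge_of_tendsto' (hla.dist hlb) fun k => hε' _
    rw [hab, dist_self] at h1
    linarith
  obtain ⟨r, hr, hrδ⟩ := Metric.uniformContinuousOn_iff.1
    (hK.uniformContinuousOn_of_continuous hg) (δ / 2) (by positivity)
  set q : Y → Fin N → ℤ := fun x i => ⌊g x i / (δ / 2)⌋ with hq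
  have hclose : ∀ x ∈ K, ∀ y ∈ K, q x = q y → dist x y < ε := by
    intro x hx y hy hxy
    refine hδε x hx y hy (lt_of_le_of_lt ((dist_pi_le_iff (by positivity)).2 fun i => ?_)
      (half_lt_self hδ))
    have h1 := Int.abs_sub_lt_one_of_floor_eq_floor (congrFun hxy i)
    rw [← sub_div, abs_div, abs_of_pos (half_pos hδ), div_lt_one (half_pos hδ)] at h1
    rw [Real.dist_eq]
    exact h1.le
  -- Labels have to be points of the space, so each occupied grid cube is represented by one of its
  -- points.
  have hrep : ∀ l : Fin N → ℤ, ∃ z : Y, (∃ x ∈ K, q x = l) → z ∈ K ∧ q z = l := by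
    intro l
    by_cases h : ∃ x ∈ K, q x = l
    · exact ⟨h.choose, fun _ => h.choose_spec⟩
    · exact ⟨Classical.arbitrary Y, fun h' => absurd h' h⟩
  choose z hz using hrep
  refine ⟨r, hr, fun c => {x | x ∈ K ∧ ∀ i, (q x i : ZMod 2) = c i}, fun _ x => z (q x), ?_, ?_, ?_⟩
  · intro x hx
    exact mem_iUnion.2 ⟨fun i => (q x i : ZMod 2), hx, fun i => rfl⟩
  · rintro c x ⟨hx, -⟩
    have := hz (q x) ⟨x, hx, rfl⟩
    exact (hclose x hx _ this.1 this.2.symm).le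
  · rintro c x ⟨hx, hxc⟩ y ⟨hy, hyc⟩ hxy
    refine congrArg z (funext fun i => ?_)
    have h1 : dist (g x i) (g y i) < δ / 2 := (dist_le_pi_dist _ _ i).trans_lt (hrδ x hx y hy hxy)
    have h2 : |g x i / (δ / 2) - g y i / (δ / 2)| < 1 := by
      rw [← sub_div, abs_div, abs_of_pos (half_pos hδ), div_lt_one (half_pos hδ)]
      exact h1
    -- The cube indices of two close points differ by at most one in each coordinate; equal parity
    -- then forces equality.
    have h3 : ((q x i : ℤ) : ZMod 2) = (q y i : ℤ) := (hxc i).trans (hyc i).symm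
    obtain ⟨e, he⟩ := (ZMod.intCast_eq_intCast_iff_dvd_sub _ _ 2).1 h3
    have ha : (q x i : ℝ) ≤ _ := Int.floor_le (g x i / (δ / 2))
    have hb : _ < (q x i : ℝ) + 1 := Int.lt_floor_add_one (g x i / (δ / 2))
    have hc : (q y i : ℝ) ≤ _ := Int.floor_le (g y i / (δ / 2))
    have hd : _ < (q y i : ℝ) + 1 := Int.lt_floor_add_one (g y i / (δ / 2))
    rw [abs_lt] at h2
    have h4 : ((q y i - q x i : ℤ) : ℝ) < 2 := by push_cast; linarith
    have h5 : (-2 : ℝ) < ((q y i - q x i : ℤ) : ℝ) := by push_cast; linarith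
    have h6 : q y i - q x i < 2 := by exact_mod_cast h4
    have h7 : -2 < q y i - q x i := by exact_mod_cast h5
    simp only [Nat.cast_ofNat] at he
    omega

/-- As `union` keeps the set of colours fixed, fine colourability passes from finitely many
neighbourhoods to the compact set they cover. This is where local charts, rather than a global
embedding, suffice. -/
lemma of_isCompact (hK : IsCompact K)
    (h : ∀ x ∈ K, ∃ L ∈ 𝓝 x, FinelyColorable C L) : FinelyColorable C K :=
  hK.induction_on (p := FinelyColorable C) empty (fun _ _ hst ht => ht.mono hst)
    (fun _ _ => union) fun x hx => by
      obtain ⟨L, hL, hLC⟩ := h x hx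
      exact ⟨L, mem_nhdsWithin_of_mem_nhds hL, hLC⟩

/-- A finely colorable compact set has, for each open cover, a colouring by open sets with locally
constant labels which refines the cover. -/
lemma exists_locallyConstant {Y : Type*} [MetricSpace Y] {K : Set Y} (hK : IsCompact K)
    (hC : FinelyColorable C K) {s : Y → Set Y} (hs : ∀ x, IsOpen (s x)) (hxs : ∀ x, x ∈ s x) :
    ∃ (W : C → Set Y) (n : C → Y → Y), (∀ c, IsOpen (W c)) ∧ K ⊆ ⋃ c, W c ∧
      (∀ c, ∀ x ∈ W c, x ∈ s (n c x)) ∧ ∀ c, ∀ x ∈ W c, ∀ᶠ y in 𝓝 x, n c y = n c x := by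
  classical
  obtain ⟨ε, hε, hεs⟩ := lebesgue_number_lemma_of_metric hK hs
    (fun x _ => mem_iUnion.2 ⟨x, hxs x⟩)
  obtain ⟨r, hr, S, l, hS, hl, hlr⟩ := hC (ε / 4) (by positivity)
  -- Thickening by `ρ` makes the colour classes open. With `2ρ < r` a thickened point sees only one
  -- label, and with `ρ + ε/4 ≤ ε/2` it lies in the ball around that label used below.
  set ρ := min (r / 3) (ε / 4) with hρ
  have hρ0 : 0 < ρ := by positivity
  have hρr : ρ ≤ r / 3 := min_le_left _ _
  have hρε : ρ ≤ ε / 4 := min_le_right _ _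
  -- The label `z` of a part is replaced by the index of a member of the cover containing the ball
  -- of radius `ε/2` about `z`; for labels within `ε/4` of `K` one exists by the choice of the
  -- Lebesgue number `ε`.
  let a : Y → Y := fun z => if h : ∃ b, Metric.ball z (ε / 2) ⊆ s b then h.choose else z
  have ha : ∀ z, (∃ b, Metric.ball z (ε / 2) ⊆ s b) → Metric.ball z (ε / 2) ⊆ s (a z) := by
    intro z h
    simp only [a, dif_pos h]
    exact h.choose_spec
  let near : C → Y → Y → Prop := fun c x y => (y ∈ S c ∧ y ∈ K) ∧ dist x y < ρ
  let n : C → Y → Y := fun c x => if h : ∃ y, near c x y then a (l c h.choose) else x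
  have hn : ∀ c x y, near c x y → n c x = a (l c y) := by
    intro c x y h
    have hex : ∃ y, near c x y := ⟨y, h⟩
    have h' := hex.choose_spec
    simp only [n, dif_pos hex]
    congr 1
    refine hlr c _ h'.1.1 y h.1.1 ?_
    have h1 := h'.2
    have h2 := h.2
    have h3 := dist_triangle_left hex.choose y x
    linarith
  refine ⟨fun c => {x | ∃ y, near c x y}, n, fun c => ?_, fun x hx => ?_, ?_, ?_⟩
  · have : {x | ∃ y, near c x y} = ⋃ y ∈ S c ∩ K, Metric.ball y ρ := by
      ext x
      simp [near, and_assoc]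
    beta_reduce
    rw [this]
    exact isOpen_biUnion fun _ _ => Metric.isOpen_ball
  · obtain ⟨c, hc⟩ := mem_iUnion.1 (hS hx)
    exact mem_iUnion.2 ⟨c, x, ⟨hc, hx⟩, by simpa using hρ0⟩
  · rintro c x ⟨y, hy⟩
    rw [hn c x y hy]
    have h1 := hl c y hy.1.1
    obtain ⟨b, hb⟩ := hεs y hy.1.2
    refine ha _ ⟨b, fun w hw => hb ?_⟩ ?_
    · rw [Metric.mem_ball] at hw ⊢
      have := dist_triangle w (l c y) y
      rw [dist_comm (l c y) y] at this
      linarith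
    · rw [Metric.mem_ball]
      have := dist_triangle x y (l c y)
      have := hy.2
      linarith
  · rintro c x ⟨y, hy⟩
    have : ∀ᶠ w in 𝓝 x, dist w y < ρ :=
      (continuous_id.dist continuous_const).continuousAt.eventually_lt continuousAt_const hy.2
    filter_upwards [this] with w hw
    rw [hn c x y hy, hn c w y ⟨hy.1, hw⟩]

end FinelyColorable

/-- An open cover of a finite-dimensional space has an open refinement which is a union of finitely
many families of disjoint open sets. -/
lemma exists_finite_coloring {X : Type*} [TopologicalSpace X] [T2Space X] [LocallyCompactSpace X]
    [SecondCountableTopology X] {N : ℕ}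
    (hN : ∀ x : X, ∃ K ∈ 𝓝 x, IsCompact K ∧ ∃ g : X → (Fin N → ℝ), ContinuousOn g K ∧ InjOn g K)
    {s : X → Set X} (hs : ∀ x, IsOpen (s x)) (hxs : ∀ x, x ∈ s x) :
    ∃ (W : (Fin N → ZMod 2) × ZMod 3 → Set X) (n : (Fin N → ZMod 2) × ZMod 3 → X → X),
      (∀ c, IsOpen (W c)) ∧ (⋃ c, W c) = univ ∧
      (∀ c, ∀ x ∈ W c, x ∈ s (n c x)) ∧ ∀ c, ∀ x ∈ W c, ∀ᶠ y in 𝓝 x, n c y = n c x := by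
  classical
  let _ : MetricSpace X := TopologicalSpace.metrizableSpaceMetric X
  have hcol : ∀ K : Set X, IsCompact K → FinelyColorable (Fin N → ZMod 2) K := fun K hK =>
    FinelyColorable.of_isCompact hK fun x _ => by
      obtain ⟨L, hL, hLc, g, hg, hgi⟩ := hN x
      exact ⟨L, hL, FinelyColorable.of_injOn hLc hg hgi⟩
  -- After the shift `E 0` is empty, so the truncated subtraction in `E (k - 1)` below removes
  -- nothing when `k = 0`.
  let E : CompactExhaustion X := (CompactExhaustion.choice X).shiftr
  choose W n hWo hWK hWs hWn using fun k : ℕ =>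
    FinelyColorable.exists_locallyConstant ((E.isCompact (k + 1)).diff (isOpen_interior (s := E k)))
      (hcol _ ((E.isCompact (k + 1)).diff isOpen_interior)) hs hxs
  -- `O k` is an open neighbourhood of the `k`-th compact shell, and `O k`, `O k'` are disjoint once
  -- `k` and `k'` differ by at least three. Recording `k` modulo `3` in the colour thus keeps the
  -- shells from interfering.
  let O : ℕ → Set X := fun k => interior (E (k + 2)) \ E (k - 1)
  have hO : ∀ k, IsOpen (O k) := fun k => isOpen_interior.sdiff (E.isCompact _).isClosed
  have hOd : ∀ k k' x, x ∈ O k → x ∈ O k' → (k : ZMod 3) = k' → k = k' := by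
    have aux : ∀ k k' x, x ∈ O k → x ∈ O k' → (k : ZMod 3) = k' → ¬ k < k' := by
      intro k k' x hx hx' hkk hlt
      rw [ZMod.natCast_eq_natCast_iff] at hkk
      have h3 : k + 3 ≤ k' := by
        have := (Nat.modEq_iff_dvd' hlt.le).1 hkk
        have := Nat.le_of_dvd (by omega) this
        omega
      have h1 : x ∈ E (k' - 1) := E.subset (by omega : k + 2 ≤ k' - 1) (interior_subset hx.1)
      exact hx'.2 h1
    intro k k' x hx hx' hkk
    exact le_antisymm (not_lt.1 (aux k' k x hx' hx hkk.symm)) (not_lt.1 (aux k k' x hx hx' hkk))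
  let near : (Fin N → ZMod 2) × ZMod 3 → X → ℕ → Prop := fun c x k =>
    (k : ZMod 3) = c.2 ∧ x ∈ W k c.1 ∩ O k
  have hnear : ∀ c x k k', near c x k → near c x k' → k = k' := fun c x k k' h h' =>
    hOd k k' x h.2.2 h'.2.2 (h.1.trans h'.1.symm)
  let m : (Fin N → ZMod 2) × ZMod 3 → X → X := fun c x =>
    if h : ∃ k, near c x k then n h.choose c.1 x else x
  have hm : ∀ c x k, near c x k → m c x = n k c.1 x := by
    intro c x k h
    have hex : ∃ k, near c x k := ⟨k, h⟩
    simp only [m, dif_pos hex]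
    rw [hnear c x _ k hex.choose_spec h]
  have hopen : ∀ c (k : ℕ), (k : ZMod 3) = c.2 → IsOpen {x | near c x k} := by
    intro c k hk
    simp only [near, hk, true_and]
    exact (hWo k c.1).inter (hO k)
  refine ⟨fun c => {x | ∃ k, near c x k}, m, fun c => ?_, ?_, ?_, ?_⟩
  · have : {x | ∃ k, near c x k} = ⋃ k : ℕ, ⋃ _ : (k : ZMod 3) = c.2, {x | near c x k} := by
      ext x
      simp only [mem_ofPred_eq, mem_iUnion, near]
      tauto
    beta_reduce
    rw [this]
    exact isOpen_iUnion fun k => isOpen_iUnion fun hk => hopen c k hk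
  · refine eq_univ_of_forall fun x => ?_
    obtain ⟨k, hk, hk'⟩ : ∃ k, x ∈ E (k + 1) \ interior (E k) ∧ x ∈ O k := by
      obtain ⟨h1, h2⟩ := (CompactExhaustion.choice X).mem_sdiff_shiftr_find x
      set k := (CompactExhaustion.choice X).find x
      exact ⟨k, ⟨h1, fun h => h2 (interior_subset h)⟩, E.subset_interior_succ _ h1,
        fun h => h2 (E.subset (Nat.sub_le k 1) h)⟩
    obtain ⟨c, hc⟩ := mem_iUnion.1 (hWK k hk)
    exact mem_iUnion.2 ⟨(c, k), k, rfl, hc, hk'⟩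
  · rintro c x ⟨k, hk⟩
    rw [hm c x k hk]
    exact hWs k c.1 x hk.2.1
  · rintro c x ⟨k, hk⟩
    filter_upwards [hWn k c.1 x hk.2.1, (hopen c k hk.1).mem_nhds hk] with y hy hy'
    rw [hm c x k hk, hm c y k hy', hy]

end Coloring

/-! ### Calculus of Bastiani maps: locality, product rule, chain rule, linearity in the direction.
-/

section BastianiCalculus

universe w w'

variable {G : Type w'} [AddCommGroup G] [Module ℝ G] [TopologicalSpace G]
  {E : Type w} [NormedAddCommGroup E] [NormedSpace ℝ E]

lemma IsDirDerivOn.mono {S S' : Set E} {f : E → G} {df : E × E → G} (h : IsDirDerivOn S f df)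
    (hS : S' ⊆ S) : IsDirDerivOn S' f df :=
  fun x hx v => h x (interior_mono hS hx) v

lemma BastianiOn.mono {k : ℕ} {S S' : Set E} {f : E → G} (h : BastianiOn G k E S f)
    (hS : S' ⊆ S) : BastianiOn G k E S' f := by
  induction k generalizing E with
  | zero => exact ContinuousOn.mono h hS
  | succ k ih =>
    obtain ⟨h1, df, h2, h3⟩ := h
    exact ⟨h1.mono hS, df, h2.mono hS, ih h3 (prod_mono hS subset_rfl)⟩

lemma inter_subset_closure_interior {S O : Set E} (hS : S ⊆ closure (interior S)) (hO : IsOpen O) :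
    S ∩ O ⊆ closure (interior (S ∩ O)) := by
  rw [interior_inter, hO.interior_eq, inter_comm, inter_comm (interior S)]
  exact (inter_subset_inter_right O hS).trans hO.inter_closure

lemma prod_univ_subset_closure_interior {S : Set E} (hS : S ⊆ closure (interior S)) :
    S ×ˢ (univ : Set E) ⊆ closure (interior (S ×ˢ (univ : Set E))) := by
  rw [interior_prod_univ', closure_prod_eq, closure_univ]
  exact prod_mono hS subset_rfl

/-- Being `C^k` in the sense of Bastiani is a local property. -/
lemma BastianiOn.of_locally [T2Space G] {k : ℕ} {S : Set E} (hS : S ⊆ closure (interior S))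
    {f : E → G} (h : ∀ x ∈ S, ∃ O, IsOpen O ∧ x ∈ O ∧ BastianiOn G k E (S ∩ O) f) :
    BastianiOn G k E S f := by
  have hcont : ∀ {E : Type w} [NormedAddCommGroup E] {S : Set E} {f : E → G},
      (∀ x ∈ S, ∃ O, IsOpen O ∧ x ∈ O ∧ ContinuousOn f (S ∩ O)) → ContinuousOn f S := by
    intro E _ S f h x hx
    obtain ⟨O, hO, hxO, hc⟩ := h x hx
    exact (continuousWithinAt_inter (hO.mem_nhds hxO)).1 (hc x ⟨hx, hxO⟩)
  induction k generalizing E with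
  | zero => exact hcont h
  | succ k ih =>
    choose! O hO hxO hB using h
    choose! hc df hd hk using hB
    -- The local derivatives agree on overlaps, by uniqueness of the continuous extension from the
    -- interior; hence `p ↦ df p.1 p` is a global derivative which is locally one of them.
    have heq : ∀ x ∈ S, ∀ y ∈ S ∩ O x, ∀ v, df y (y, v) = df x (y, v) := by
      intro x hx y hy v
      have h1 : (S ∩ O x) ∩ O y ⊆ closure (interior ((S ∩ O x) ∩ O y)) :=
        inter_subset_closure_interior (inter_subset_closure_interior hS (hO x hx)) (hO y hy.1)
      have hsy : (S ∩ O x) ∩ O y ⊆ S ∩ O y := fun z hz => ⟨hz.1.1, hz.2⟩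
      have hsx : (S ∩ O x) ∩ O y ⊆ S ∩ O x := fun z hz => hz.1
      exact ((hd y hy.1).mono hsy).eqOn h1 ((hd x hx).mono hsx)
        ((hk y hy.1).continuousOn.mono (prod_mono hsy subset_rfl))
        ((hk x hx).continuousOn.mono (prod_mono hsx subset_rfl))
        (show (y, v) ∈ _ from ⟨⟨hy, hxO y hy.1⟩, mem_univ _⟩)
    refine ⟨hcont fun x hx => ⟨O x, hO x hx, hxO x hx, hc x hx⟩, fun p => df p.1 p,
      fun x hx v => ?_, ih (prod_univ_subset_closure_interior hS) fun p hp => ?_⟩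
    · have hxS := interior_subset hx
      refine hd x hxS x ?_ v
      rw [interior_inter, (hO x hxS).interior_eq]
      exact ⟨hx, hxO x hxS⟩
    · refine ⟨O p.1 ×ˢ univ, (hO _ hp.1).prod isOpen_univ, ⟨hxO _ hp.1, mem_univ _⟩, ?_⟩
      rw [prod_inter_prod, inter_self]
      refine (hk p.1 hp.1).congr fun q hq => ?_
      exact (heq p.1 hp.1 q.1 hq.1 q.2).symm

section Deriv

variable {S : Set E} {f g : E → G}

/-- The source of all formulas for `deriv`: a continuous candidate that is correct at interior
points is correct on all of `S`, since the interior is dense in `S` and `G` is Hausdorff. -/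
lemma BastianiSmoothOn.deriv_eqOn [T2Space G] (hS : S ⊆ closure (interior S))
    (h : BastianiSmoothOn S f) {df : E × E → G} (hd : IsDirDerivOn S f df)
    (hc : ContinuousOn df (S ×ˢ univ)) : EqOn h.deriv df (S ×ˢ univ) :=
  h.isDirDerivOn.eqOn hS hd h.continuousOn_deriv hc

variable [IsTopologicalAddGroup G]

lemma BastianiSmoothOn.deriv_add [T2Space G] (hS : S ⊆ closure (interior S))
    (hf : BastianiSmoothOn S f) (hg : BastianiSmoothOn S g) {F : E → G} (hF : BastianiSmoothOn S F)
    (hFe : EqOn F (fun x => f x + g x) S) {x : E} (hx : x ∈ S) (v : E) :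
    hF.deriv (x, v) = hf.deriv (x, v) + hg.deriv (x, v) := by
  refine hF.deriv_eqOn hS (df := fun p => hf.deriv p + hg.deriv p) (fun x hx v => ?_)
    (hf.continuousOn_deriv.add hg.continuousOn_deriv) (mk_mem_prod hx (mem_univ v))
  refine HasDirDeriv.congr ?_ hx hFe.symm
  refine ((hf.isDirDerivOn x hx v).add (hg.isDirDerivOn x hx v)).congr fun t => ?_
  dsimp only; module

variable [ContinuousSMul ℝ G]

lemma HasDirDeriv.smul {h : E → ℝ} {h' : E →L[ℝ] ℝ} {f' : G} {x v : E} (hh : HasFDerivAt h h' x)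
    (hf : HasDirDeriv f f' x v) :
    HasDirDeriv (fun y => h y • f y) (h x • f' + h' v • f x) x v := by
  have hcont : Tendsto (fun t : ℝ => h (x + t • v)) (𝓝[≠] 0) (𝓝 (h x)) := by
    have : ContinuousAt (fun t : ℝ => h (x + t • v)) 0 := by
      apply ContinuousAt.comp (g := h) _ (by fun_prop)
      simpa using hh.continuousAt
    have h' := this.tendsto
    simp only [zero_smul, add_zero] at h'
    exact h'.mono_left nhdsWithin_le_nhds
  refine ((hcont.smul hf).add ((hh.hasDirDeriv v).smul_const (f x))).congr fun t => ?_
  simp only [smul_eq_mul]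
  module

lemma BastianiSmoothOn.deriv_smul [T2Space G] (hS : S ⊆ closure (interior S))
    (hSu : UniqueDiffOn ℝ S) {h : E → ℝ} (hh : ContDiffOn ℝ ∞ h S) (hf : BastianiSmoothOn S f)
    {F : E → G} (hF : BastianiSmoothOn S F) (hFe : EqOn F (fun x => h x • f x) S) {x : E}
    (hx : x ∈ S) (v : E) :
    hF.deriv (x, v) = h x • hf.deriv (x, v) + fderivWithin ℝ h S x v • f x := by
  refine hF.deriv_eqOn hS
    (df := fun p => h p.1 • hf.deriv p + fderivWithin ℝ h S p.1 p.2 • f p.1) (fun x hx v => ?_)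
    ?_ (mk_mem_prod hx (mem_univ v))
  · have hxn : S ∈ 𝓝 x := mem_interior_iff_mem_nhds.1 hx
    exact (HasDirDeriv.smul ((hh.differentiableOn (by simp) x
      (mem_of_mem_nhds hxn)).hasFDerivWithinAt.hasFDerivAt hxn) (hf.isDirDerivOn x hx v)).congr hx
      hFe.symm
  · have h1 : ContinuousOn (fun p : E × E => fderivWithin ℝ h S p.1 p.2) (S ×ˢ univ) :=
      ((hh.continuousOn_fderivWithin hSu (by simp)).comp continuousOn_fst fun p hp => hp.1).clm_apply
        continuousOn_snd
    exact ((hh.continuousOn.comp continuousOn_fst fun p hp => hp.1).smul hf.continuousOn_deriv).add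
      (h1.smul ((hf 0).continuousOn.comp continuousOn_fst fun p hp => hp.1))

variable [LocallyConvexSpace ℝ G]

/-- The chain rule holds at interior points, which `T` sends to interior points, and extends by
continuity. `F` is only required to agree with the composite on `S'`, because chart representations
are meaningful only on the image of the chart. -/
lemma BastianiSmoothOn.deriv_comp [T2Space G] {E' : Type w} [NormedAddCommGroup E']
    [NormedSpace ℝ E'] {S' : Set E'} (hS' : S' ⊆ closure (interior S')) (hSu : UniqueDiffOn ℝ S')
    (hf : BastianiSmoothOn S f) {T : E' → E} (hT : ContDiffOn ℝ ∞ T S') (hm : MapsTo T S' S)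
    (hmi : MapsTo T (interior S') (interior S)) {F : E' → G} (hF : BastianiSmoothOn S' F)
    (hFe : EqOn F (fun x => f (T x)) S') {x : E'} (hx : x ∈ S') (v : E') :
    hF.deriv (x, v) = hf.deriv (T x, fderivWithin ℝ T S' x v) := by
  refine hF.deriv_eqOn hS' (df := fun p => hf.deriv (T p.1, fderivWithin ℝ T S' p.1 p.2))
    (fun x hx v => ?_) ?_ (mk_mem_prod hx (mem_univ v))
  · have hxn : S' ∈ 𝓝 x := mem_interior_iff_mem_nhds.1 hx
    refine HasDirDeriv.congr ?_ hx hFe.symm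
    exact hf.isDirDerivOn.comp hf.continuousOn_deriv (hmi hx)
      (((hT.differentiableOn (by simp) x
        (mem_of_mem_nhds hxn)).hasFDerivWithinAt.hasFDerivAt hxn).hasDirDeriv v)
  · refine hf.continuousOn_deriv.comp (ContinuousOn.prodMk
      (hT.continuousOn.comp continuousOn_fst fun p hp => hp.1) ?_) fun p hp => ⟨hm hp.1, mem_univ _⟩
    exact ((hT.continuousOn_fderivWithin hSu (by simp)).comp continuousOn_fst
      fun p hp => hp.1).clm_apply continuousOn_snd

/-- The directional derivative is additive in the direction at interior points. -/
lemma IsDirDerivOn.map_add [T2Space G] {df : E × E → G} (h : IsDirDerivOn S f df)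
    (hc : ContinuousOn df (S ×ˢ univ)) {x : E} (hx : x ∈ interior S) (v w : E) :
    df (x, v + w) = df (x, v) + df (x, w) := by
  -- The base point `x + t • v` moves with `t`, so the definition of the directional derivative does
  -- not apply. The mean value inclusion puts the quotient into a closed convex set containing the
  -- derivatives along the short segment, and these are close to `df (x, w)` by continuity of `df`.
  have key : Tendsto (fun t : ℝ => t⁻¹ • (f (x + t • v + t • w) - f (x + t • v))) (𝓝[≠] 0)
      (𝓝 (df (x, w))) := by
    intro W hW
    obtain ⟨W', hW', hW'c, hW'W⟩ := exists_mem_nhds_isClosed_subset hW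
    obtain ⟨B, ⟨hB, hBc⟩, hBW⟩ :=
      (LocallyConvexSpace.convex_basis (𝕜 := ℝ) (df (x, w))).mem_iff.1 hW'
    have hCW : closure B ⊆ W := (closure_minimal hBW hW'c).trans hW'W
    have hat : ContinuousAt df (x, w) := hc.continuousAt (by
      rw [← mem_interior_iff_mem_nhds, interior_prod_univ']; exact ⟨hx, mem_univ _⟩)
    have hn := hat hB
    rw [nhds_prod_eq, mem_map, mem_prod_iff] at hn
    obtain ⟨V₁, hV₁, V₂, hV₂, hV⟩ := hn
    obtain ⟨r, hr, hrV⟩ := Metric.mem_nhds_iff.1 (inter_mem hV₁ (isOpen_interior.mem_nhds hx))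
    have hball : ∀ u : E, ∀ᶠ t : ℝ in 𝓝[≠] 0, x + t • u ∈ Metric.ball x r := by
      intro u
      have h1 : Tendsto (fun t : ℝ => x + t • u) (𝓝 0) (𝓝 (x + (0 : ℝ) • u)) :=
        Continuous.tendsto (by fun_prop) 0
      rw [zero_smul, add_zero] at h1
      exact (h1.mono_left nhdsWithin_le_nhds) (Metric.ball_mem_nhds _ hr)
    rw [mem_map]
    filter_upwards [hball v, hball (v + w), self_mem_nhdsWithin] with t ht1 ht2 ht3
    apply hCW
    have hseg : ∀ s ∈ Icc (0 : ℝ) 1, (x + t • v) + s • (t • w) ∈ Metric.ball x r := by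
      intro s hs
      have := (convex_ball x r).add_smul_sub_mem ht1 ht2 hs
      have e : x + t • (v + w) - (x + t • v) = t • w := by module
      rwa [e] at this
    have := sub_mem_of_hasDirDeriv (G := G) (C := closure B)
      (γ := fun s : ℝ => t⁻¹ • f ((x + t • v) + s • (t • w)))
      (γ' := fun s : ℝ => df ((x + t • v) + s • (t • w), w)) hBc.closure isClosed_closure
      (fun s hs => HasDirDeriv.comp_line ht3 rfl (h _ (hrV (hseg s hs)).2 _))
      (fun s hs => subset_closure (hV ⟨(hrV (hseg s hs)).1, mem_of_mem_nhds hV₂⟩))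
    rw [← smul_sub] at this
    simpa using this
  refine (h x hx (v + w)).unique ?_
  refine ((h x hx v).add key).congr fun t => ?_
  have e : x + t • (v + w) = x + t • v + t • w := by module
  rw [e, ← smul_add]
  congr 1
  abel

lemma IsDirDerivOn.map_smul [T2Space G] {df : E × E → G} (h : IsDirDerivOn S f df)
    {x : E} (hx : x ∈ interior S) (c : ℝ) (v : E) : df (x, c • v) = c • df (x, v) := by
  refine (h x hx (c • v)).unique ?_
  rcases eq_or_ne c 0 with rfl | hc
  · simp [HasDirDeriv]
  · have h0 : Tendsto (fun t : ℝ => t * c) (𝓝[≠] 0) (𝓝[≠] 0) := by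
      refine tendsto_nhdsWithin_iff.2 ⟨?_, ?_⟩
      · have : Tendsto (fun t : ℝ => t * c) (𝓝 0) (𝓝 (0 * c)) := Continuous.tendsto (by fun_prop) 0
        rw [zero_mul] at this
        exact this.mono_left nhdsWithin_le_nhds
      · filter_upwards [self_mem_nhdsWithin] with t ht
        exact mul_ne_zero ht hc
    refine (((h x hx v).comp h0).const_smul c).congr fun t => ?_
    simp only [Function.comp]
    rw [smul_smul, smul_smul, mul_inv, mul_left_comm, mul_inv_cancel₀ hc, mul_one]

/-- The Bastiani derivative as a linear function of the direction, also at boundary points. -/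
noncomputable def BastianiSmoothOn.derivLin [T2Space G] (hS : S ⊆ closure (interior S))
    (h : BastianiSmoothOn S f) {x : E} (hx : x ∈ S) : E →ₗ[ℝ] G where
  toFun v := h.deriv (x, v)
  map_add' v w := by
    have h1 : ∀ u : E, ContinuousOn (fun x => h.deriv (x, u)) S := fun u =>
      h.continuousOn_deriv.comp (continuousOn_id.prodMk continuousOn_const)
        fun y hy => ⟨hy, mem_univ _⟩
    exact EqOn.of_subset_closure (fun y hy => h.isDirDerivOn.map_add h.continuousOn_deriv hy v w)
      (h1 _) ((h1 v).add (h1 w)) interior_subset hS hx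
  map_smul' c v := by
    have h1 : ∀ u : E, ContinuousOn (fun x => h.deriv (x, u)) S := fun u =>
      h.continuousOn_deriv.comp (continuousOn_id.prodMk continuousOn_const)
        fun y hy => ⟨hy, mem_univ _⟩
    exact EqOn.of_subset_closure (fun y hy => h.isDirDerivOn.map_smul hy c v)
      (h1 _) ((h1 v).const_smul c) interior_subset hS hx

lemma BastianiSmoothOn.deriv_sum [T2Space G] (hS : S ⊆ closure (interior S))
    (h : BastianiSmoothOn S f) {x : E} (hx : x ∈ S) {ι : Type*} (s : Finset ι) (c : ι → ℝ)
    (v : ι → E) : h.deriv (x, ∑ i ∈ s, c i • v i) = ∑ i ∈ s, c i • h.deriv (x, v i) := by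
  exact (map_sum (h.derivLin hS hx) (fun i => c i • v i) s).trans
    (Finset.sum_congr rfl fun i _ => (h.derivLin hS hx).map_smul (c i) (v i))

end Deriv

end BastianiCalculus

/-! ### Algebra of wedge products, dual bases and differentials defined by derivations. -/

section WedgeAlgebra

variable {A P : Type*} [CommRing A] [AddCommGroup P] [Module A P]

lemma alt_sum_apply {k : ℕ} {ι : Type*} (s : Finset ι) (ζ : ι → P [⋀^Fin k]→ₗ[A] A)
    (X : Fin k → P) : (∑ i ∈ s, ζ i) X = ∑ i ∈ s, ζ i X :=
  map_sum (⟨⟨fun η => η X, rfl⟩, fun _ _ => rfl⟩ : (P [⋀^Fin k]→ₗ[A] A) →+ A) ζ s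

lemma wedgeOne_apply {k : ℕ} (α : P →ₗ[A] A) (ζ : P [⋀^Fin k]→ₗ[A] A) (X : Fin (k + 1) → P) :
    wedgeOne α ζ X = ∑ i : Fin (k + 1), (-1 : ℤ) ^ (i : ℕ) • (α (X i) * ζ (i.removeNth X)) := by
  rw [wedgeOne, AlternatingMap.alternatizeUncurryFin_apply]
  rfl

/-- The wedge product of a `1`-form and a `k`-form as a bilinear map. -/
noncomputable def wedgeOneBilin (A P : Type*) [CommRing A] [AddCommGroup P] [Module A P] (k : ℕ) :
    (P →ₗ[A] A) →ₗ[A] (P [⋀^Fin k]→ₗ[A] A) →ₗ[A] (P [⋀^Fin (k + 1)]→ₗ[A] A) :=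
  LinearMap.mk₂ A wedgeOne
    (fun α β ζ => by
      ext X
      simp only [wedgeOne_apply, AlternatingMap.add_apply, LinearMap.add_apply, add_mul, smul_add,
        Finset.sum_add_distrib])
    (fun c α ζ => by
      ext X
      simp only [wedgeOne_apply, AlternatingMap.smul_apply, LinearMap.smul_apply, smul_eq_mul,
        Finset.mul_sum, mul_smul_comm, mul_assoc])
    (fun α ζ η => by
      ext X
      simp only [wedgeOne_apply, AlternatingMap.add_apply, mul_add, smul_add,
        Finset.sum_add_distrib])
    (fun c α ζ => by
      ext X
      simp only [wedgeOne_apply, AlternatingMap.smul_apply, smul_eq_mul,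
        Finset.mul_sum, mul_smul_comm, mul_left_comm])

lemma wedgeOneBilin_apply {k : ℕ} (α : P →ₗ[A] A) (ζ : P [⋀^Fin k]→ₗ[A] A) :
    wedgeOneBilin A P k α ζ = wedgeOne α ζ := rfl

/-- Two successive alternatizations of a map symmetric in its first two arguments give zero, and
`(x, y) ↦ α(x) α(y) ζ` is symmetric. Anticommutativity follows by polarization. -/
lemma wedgeOne_self {k : ℕ} (α : P →ₗ[A] A) (ζ : P [⋀^Fin k]→ₗ[A] A) :
    wedgeOne α (wedgeOne α ζ) = 0 := by
  have h := AlternatingMap.alternatizeUncurryFin_alternatizeUncurryFinLM_comp_of_symmetric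
    (f := α.smulRight (α.smulRight ζ)) (fun x y => by
      simp only [LinearMap.smulRight_apply, LinearMap.smul_apply, smul_smul, mul_comm])
  rw [← h, wedgeOne]
  congr 1
  ext x : 1
  simp only [LinearMap.smulRight_apply, LinearMap.comp_apply, map_smul]
  rfl

lemma wedgeOne_anticomm {k : ℕ} (α β : P →ₗ[A] A) (ζ : P [⋀^Fin k]→ₗ[A] A) :
    wedgeOne α (wedgeOne β ζ) = -wedgeOne β (wedgeOne α ζ) := by
  have h := wedgeOne_self (α + β) ζ
  simp only [← wedgeOneBilin_apply, map_add, LinearMap.add_apply] at h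
  simp only [wedgeOneBilin_apply, wedgeOne_self, zero_add, add_zero] at h
  exact eq_neg_of_add_eq_zero_right h

/-- The algebraic core of `d ∘ d = 0`: the terms of `(i, j)` and `(j, i)` cancel, and the diagonal
terms vanish on their own, so no division by two is involved. -/
lemma sum_symm_wedgeOne {k n : ℕ} (s : Fin n → Fin n → A) (hs : ∀ i j, s i j = s j i)
    (α : Fin n → (P →ₗ[A] A)) (ζ : P [⋀^Fin k]→ₗ[A] A) :
    ∑ i, ∑ j, s i j • wedgeOne (α i) (wedgeOne (α j) ζ) = 0 := by
  rw [← Finset.sum_product']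
  refine Finset.sum_involution (fun p _ => p.swap) (fun p _ => ?_) (fun p _ hp hsw => ?_)
    (fun p _ => by simp) (fun p _ => by simp)
  · rw [wedgeOne_anticomm (α p.1)]
    simp [hs p.1 p.2]
  · refine hp ?_
    have : p.2 = p.1 := congrArg Prod.fst hsw
    rw [this, wedgeOne_self, smul_zero]

section Evaluation

variable {Q : Type*} [AddCommGroup Q] [Module A Q]

/-- Evaluation of a `Q`-valued form on vector fields. -/
noncomputable def tensorEval (Q : Type*) [AddCommGroup Q] [Module A Q] {k : ℕ} (X : Fin k → P) :
    Q ⊗[A] (P [⋀^Fin k]→ₗ[A] A) →ₗ[A] Q :=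
  TensorProduct.lift (LinearMap.mk₂ A (fun (f : Q) (ζ : P [⋀^Fin k]→ₗ[A] A) => ζ X • f)
    (fun _ _ _ => smul_add _ _ _) (fun c f ζ => smul_comm _ _ _)
    (fun f ζ η => by rw [AlternatingMap.add_apply, add_smul])
    (fun c f ζ => by rw [AlternatingMap.smul_apply, smul_assoc]))

lemma tensorEval_tmul {k : ℕ} (X : Fin k → P) (f : Q) (ζ : P [⋀^Fin k]→ₗ[A] A) :
    tensorEval Q X (f ⊗ₜ ζ) = ζ X • f := rfl

/-- Decomposition of alternating forms along a finite dual basis of a projective module. -/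
lemma alt_decomp_dual {m : ℕ} {X : Fin m → P} {l : Fin m → (P →ₗ[A] A)}
    (h : ∀ p, ∑ i, l i p • X i = p) {k : ℕ} (ζ : P [⋀^Fin k]→ₗ[A] A) :
    ζ = ∑ J : Fin k ↪o Fin m, ζ (fun a => X (J a)) • wedgeList k (fun a => l (J a)) := by
  -- The dual basis exhibits `P` as a direct summand of the free module `A^m`. The form is pulled
  -- back along `π`, decomposed there, and evaluated at the coordinate vectors `(l_i(p_a))_i`, which
  -- `π` sends back to `p_a`.
  let π : (Fin m → A) →ₗ[A] P := Fintype.linearCombination A X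
  have hπ : ∀ i, π (Pi.basisFun A (Fin m) i) = X i := by
    intro i
    simp [π, Fintype.linearCombination_apply, Pi.single_apply]
  have h1 := alt_decomp (Pi.basisFun A (Fin m)) (dx := fun i => LinearMap.proj i)
    (fun i j => by simp [Pi.single_apply]) (ζ.compLinearMap π)
  ext p
  have h2 := DFunLike.congr_fun h1 (fun a i => l i (p a))
  have hp : (fun a => π (fun i => l i (p a))) = p := by
    funext a
    exact h (p a)
  have e : ζ p = (ζ.compLinearMap π) (fun a i => l i (p a)) := (congrArg ζ hp).symm
  rw [e, h2]
  rw [alt_sum_apply, alt_sum_apply]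
  refine Finset.sum_congr rfl fun J _ => ?_
  rw [AlternatingMap.smul_apply, AlternatingMap.smul_apply, wedgeList_apply, wedgeList_apply]
  congr 1
  exact congrArg ζ (funext fun a => hπ (J a))

/-- A substitute for a frame: the decomposition need not be the only one with these `l_J`, but the
values `θ(X_J)` determine `θ`, which is what separation and gluing use. -/
lemma tensor_decomp_dual {m : ℕ} {X : Fin m → P} {l : Fin m → (P →ₗ[A] A)}
    (h : ∀ p, ∑ i, l i p • X i = p) {k : ℕ} (θ : Q ⊗[A] (P [⋀^Fin k]→ₗ[A] A)) :
    θ = ∑ J : Fin k ↪o Fin m,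
      tensorEval Q (fun a => X (J a)) θ ⊗ₜ[A] wedgeList k (fun a => l (J a)) := by
  induction θ using TensorProduct.induction_on with
  | zero => simp
  | tmul f ζ =>
    simp only [tensorEval_tmul]
    conv_lhs => rw [alt_decomp_dual h ζ]
    simp only [TensorProduct.tmul_sum, TensorProduct.smul_tmul]
  | add x y hx hy =>
    simp only [map_add, TensorProduct.add_tmul, Finset.sum_add_distrib]
    exact congrArg₂ (· + ·) hx hy

end Evaluation

section Differential

variable {N : ℕ} (b : Module.Basis (Fin N) A P) (dx : Fin N → (P →ₗ[A] A))
  (δ : Fin N → A →+ A)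

/-- Coefficientwise derivative of a `1`-form. -/
noncomputable def lieOne (j : Fin N) (α : P →ₗ[A] A) : P →ₗ[A] A :=
  ∑ i, δ j (α (b i)) • dx i

/-- Coefficientwise derivative of a `k`-form. -/
noncomputable def lieAlt (j : Fin N) {k : ℕ} (ζ : P [⋀^Fin k]→ₗ[A] A) : P [⋀^Fin k]→ₗ[A] A :=
  ∑ J : Fin k ↪o Fin N, δ j (ζ (fun a => b (J a))) • wedgeList k (fun a => dx (J a))

/-- The differential of a form with respect to a basis and derivations. -/
noncomputable def basisDiff {k : ℕ} (ζ : P [⋀^Fin k]→ₗ[A] A) : P [⋀^Fin (k + 1)]→ₗ[A] A :=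
  ∑ j, wedgeOne (dx j) (lieAlt b dx δ j ζ)

variable {dx}

lemma alt_ext_basis (hdx : ∀ i j, dx i (b j) = if i = j then 1 else 0) {k : ℕ} {ζ η : P [⋀^Fin k]→ₗ[A] A}
    (h : ∀ J : Fin k ↪o Fin N, ζ (fun a => b (J a)) = η (fun a => b (J a))) : ζ = η := by
  rw [alt_decomp b hdx ζ, alt_decomp b hdx η]
  exact Finset.sum_congr rfl fun J _ => by rw [h]

lemma lieOne_apply_basis (hdx : ∀ i j, dx i (b j) = if i = j then 1 else 0)
    (j i : Fin N) (α : P →ₗ[A] A) :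
    lieOne b dx δ j α (b i) = δ j (α (b i)) := by
  simp [lieOne, hdx, LinearMap.sum_apply]

lemma lieAlt_apply_basis (hdx : ∀ i j, dx i (b j) = if i = j then 1 else 0)
    (j : Fin N) {k : ℕ} (ζ : P [⋀^Fin k]→ₗ[A] A) (J : Fin k ↪o Fin N) :
    lieAlt b dx δ j ζ (fun a => b (J a)) = δ j (ζ (fun a => b (J a))) := by
  simp [lieAlt, alt_sum_apply, wedgeList_basis b hdx]

variable {δ}

/-- It suffices to compare values on increasing families of basis vectors, where `lieAlt` is `δ j`
applied to the value and the wedge is a sum of products. Deleting an entry of an increasing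
multi-index leaves an increasing one, so the rule for `δ j` applies term by term. -/
lemma lieAlt_wedgeOne (hdx : ∀ i j, dx i (b j) = if i = j then 1 else 0)
    (hδ : ∀ j r s, δ j (r * s) = δ j r * s + r * δ j s) (j : Fin N) {k : ℕ} (α : P →ₗ[A] A) (ζ : P [⋀^Fin k]→ₗ[A] A) :
    lieAlt b dx δ j (wedgeOne α ζ) =
      wedgeOne (lieOne b dx δ j α) ζ + wedgeOne α (lieAlt b dx δ j ζ) := by
  refine alt_ext_basis b hdx fun J => ?_
  rw [lieAlt_apply_basis b δ hdx, AlternatingMap.add_apply]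
  simp only [wedgeOne_apply, map_sum, map_zsmul, ← Finset.sum_add_distrib, ← smul_add]
  refine Finset.sum_congr rfl fun i _ => ?_
  have e : (i.removeNth fun a => b (J a)) =
      fun a => b (((Fin.succAboveOrderEmb i).trans J) a) := rfl
  rw [e, lieAlt_apply_basis b δ hdx, lieOne_apply_basis b δ hdx, hδ]

/-- Wedge products of differentials of functions are closed. -/
lemma basisDiff_wedgeList (hdx : ∀ i j, dx i (b j) = if i = j then 1 else 0)
    (hδ : ∀ j r s, δ j (r * s) = δ j r * s + r * δ j s)
    (hcomm : ∀ i j r, δ i (δ j r) = δ j (δ i r)) {k : ℕ}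
    (y : Fin k → A) (α : Fin k → (P →ₗ[A] A)) (hα : ∀ a j, α a (b j) = δ j (y a)) :
    basisDiff b dx δ (wedgeList k α) = 0 := by
  induction k with
  | zero =>
    have h1 : ∀ j, δ j 1 = 0 := fun j => by simpa using hδ j 1 1
    refine Finset.sum_eq_zero fun j _ => ?_
    have : lieAlt b dx δ j (wedgeList 0 α) = 0 := by
      simp [lieAlt, wedgeList, h1]
    rw [this, ← wedgeOneBilin_apply, map_zero]
  | succ k ih =>
    have h2 := ih (Fin.tail y) (Fin.tail α) fun a j => hα a.succ j
    rw [basisDiff] at h2 ⊢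
    simp only [wedgeList, lieAlt_wedgeOne b hdx hδ]
    -- With `η` the wedge of the remaining factors, `d(α_0 ∧ η)` is the sum of second derivatives of
    -- `y 0` against `dx_j ∧ dx_i ∧ η`, zero by symmetry, minus `α_0 ∧ dη`, zero by induction.
    have e1 : ∀ j, wedgeOne (dx j) (wedgeOne (lieOne b dx δ j (α 0)) (wedgeList k (Fin.tail α))) =
        ∑ i, δ j (δ i (y 0)) • wedgeOne (dx j) (wedgeOne (dx i) (wedgeList k (Fin.tail α))) := by
      intro j
      simp only [lieOne, hα, ← wedgeOneBilin_apply, map_sum, LinearMap.sum_apply, map_smul,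
        LinearMap.smul_apply]
    have e2 : ∀ j, wedgeOne (dx j) (wedgeOne (lieOne b dx δ j (α 0)) (wedgeList k (Fin.tail α)) +
        wedgeOne (α 0) (lieAlt b dx δ j (wedgeList k (Fin.tail α)))) =
        ∑ i, δ j (δ i (y 0)) • wedgeOne (dx j) (wedgeOne (dx i) (wedgeList k (Fin.tail α))) -
        wedgeOneBilin A P _ (α 0)
          (wedgeOne (dx j) (lieAlt b dx δ j (wedgeList k (Fin.tail α)))) := by
      intro j
      rw [← e1, wedgeOneBilin_apply, ← wedgeOneBilin_apply (dx j), map_add, wedgeOneBilin_apply,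
        wedgeOneBilin_apply, wedgeOne_anticomm (dx j) (α 0), sub_eq_add_neg]
    simp only [e2, Finset.sum_sub_distrib, ← map_sum]
    rw [h2, map_zero, sub_zero]
    exact sum_symm_wedgeOne _ (fun i j => hcomm i j _) _ _

variable {Q : Type*} [AddCommGroup Q] [Module A Q] (D : Fin N → Q →+ Q)

variable (dx) in
/-- The differential of a `Q`-valued form with respect to a basis and derivations. -/
noncomputable def tensorDiff {k : ℕ} :
    Q ⊗[A] (P [⋀^Fin k]→ₗ[A] A) →+ Q ⊗[A] (P [⋀^Fin (k + 1)]→ₗ[A] A) :=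
  ∑ J : Fin k ↪o Fin N, ∑ j : Fin N,
    ((TensorProduct.mk A Q (P [⋀^Fin (k + 1)]→ₗ[A] A)).flip
      (wedgeOne (dx j) (wedgeList k (fun a => dx (J a))))).toAddMonoidHom.comp
      ((D j).comp (tensorEval Q (fun a => b (J a))).toAddMonoidHom)

lemma tensorDiff_apply {k : ℕ} (θ : Q ⊗[A] (P [⋀^Fin k]→ₗ[A] A)) :
    tensorDiff b dx D θ = ∑ J : Fin k ↪o Fin N, ∑ j : Fin N,
      D j (tensorEval Q (fun a => b (J a)) θ) ⊗ₜ[A]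
        wedgeOne (dx j) (wedgeList k (fun a => dx (J a))) := by
  simp only [tensorDiff, AddMonoidHom.finsetSum_apply]
  rfl

/-- The coefficients of `f ⊗ ζ` are `ζ(b_J) • f`, and the product rule `hD` splits their derivatives
into two sums. For closed `ζ` only the first remains, so `f ⊗ ζ` can be differentiated without
expanding `ζ` in the basis. -/
lemma tensorDiff_tmul (hdx : ∀ i j, dx i (b j) = if i = j then 1 else 0)
    (hD : ∀ j r q, D j (r • q) = δ j r • q + r • D j q) {k : ℕ} (f : Q)
    (ζ : P [⋀^Fin k]→ₗ[A] A) :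
    tensorDiff b dx D (f ⊗ₜ ζ) =
      ∑ j, D j f ⊗ₜ[A] wedgeOne (dx j) ζ + f ⊗ₜ[A] basisDiff b dx δ ζ := by
  rw [tensorDiff_apply]
  simp only [tensorEval_tmul, hD, TensorProduct.add_tmul, Finset.sum_add_distrib]
  refine (add_comm _ _).trans (congrArg₂ (· + ·) ?_ ?_)
  · rw [Finset.sum_comm]
    refine Finset.sum_congr rfl fun j _ => ?_
    conv_rhs => rw [alt_decomp b hdx ζ, ← wedgeOneBilin_apply, map_sum, TensorProduct.tmul_sum]
    refine Finset.sum_congr rfl fun J _ => ?_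
    rw [map_smul, TensorProduct.smul_tmul, wedgeOneBilin_apply]
  · rw [Finset.sum_comm, basisDiff, TensorProduct.tmul_sum]
    refine Finset.sum_congr rfl fun j _ => ?_
    rw [lieAlt, ← wedgeOneBilin_apply, map_sum, TensorProduct.tmul_sum]
    refine Finset.sum_congr rfl fun J _ => ?_
    rw [map_smul, TensorProduct.smul_tmul, wedgeOneBilin_apply]

end Differential

end WedgeAlgebra

/-! ### Covector fields, differentials of functions and partial derivatives in a chart. -/

section Covectors

variable {N : ℕ} {H : Type*} [TopologicalSpace H]
  {I : ModelWithCorners ℝ (EuclideanSpace ℝ (Fin N)) H}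
  {M : Type*} [TopologicalSpace M] [ChartedSpace H M] [IsManifold I ∞ M]

variable (I) in
/-- Smooth covector fields on the open set `U`. -/
structure CovField (U : Opens M) where
  /-- The covector at a point; only relevant on `U`. -/
  val : ∀ x : M, TangentSpace I x →ₗ[ℝ] ℝ
  smooth : ∀ x ∈ U, ∀ Y : ∀ y : M, TangentSpace I y,
    ContMDiffAt I I.tangent ∞ (fun y => (⟨y, Y y⟩ : TangentBundle I M)) x →
      ContMDiffAt I 𝓘(ℝ, ℝ) ∞ (fun y => val y (Y y)) x

namespace CovField

variable {U V : Opens M}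

/-- The restriction of a covector field to a smaller open set. -/
def restrict (h : V ≤ U) (l : CovField I U) : CovField I V := ⟨l.val, fun x hx => l.smooth x (h hx)⟩

/-- A covector field as a linear form on the module of vector fields. -/
noncomputable def toDual (l : CovField I U) : smoothFields I U →ₗ[SmoothFn I U] SmoothFn I U where
  toFun X := ⟨fun p => l.val p (X.1 p), by
    intro p
    have h1 := l.smooth p p.2 _ ((contMDiff_field_iff X.1).1 X.2 p p.2)
    refine ((contMDiffAt_subtype_iff (U := U) (x := p)).2 h1).congr_of_eventuallyEq
      (Eventually.of_forall fun q => ?_)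
    simp [extField_of_mem]⟩
  map_add' X Y := by
    ext p
    exact (l.val p).map_add (X.1 p) (Y.1 p)
  map_smul' h X := by
    ext p
    exact (l.val p).map_smul (h p) (X.1 p)

lemma toDual_apply (l : CovField I U) (X : smoothFields I U) (p : U) :
    l.toDual X p = l.val p (X.1 p) := rfl

/-- Evaluation of smooth functions at a point. -/
noncomputable def evalRingHom (p : U) : SmoothFn I U →+* ℝ :=
  (Pi.evalRingHom (fun _ : U => ℝ) p).comp ContMDiffMap.coeFnRingHom

lemma evalRingHom_apply (p : U) (f : SmoothFn I U) : evalRingHom p f = f p := rfl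

lemma wedgeList_toDual_apply {k : ℕ} (l : Fin k → CovField I U) (X : Fin k → smoothFields I U)
    (p : U) : wedgeList k (fun a => (l a).toDual) X p =
      Matrix.det (Matrix.of fun i j => (l i).val p ((X j).1 p)) := by
  rw [wedgeList_apply, ← evalRingHom_apply, RingHom.map_det]
  rfl

/-- A wedge of covector fields is computed pointwise, as a determinant. The vector fields over `U`
entering the definition of the restriction may therefore be replaced by their values at `p`. -/
lemma resAlt_wedgeList [T2Space M] (h : V ≤ U) {k : ℕ} (l : Fin k → CovField I U) :
    resAlt h (wedgeList k fun a => (l a).toDual) =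
      wedgeList k fun a => ((l a).restrict h).toDual := by
  ext Y p
  choose X hX using fun i => exists_near h p (Y i)
  refine (resVal_eq h _ Y p X hX).trans ?_
  rw [wedgeList_toDual_apply, wedgeList_toDual_apply]
  congr 2
  funext i j
  have h1 : (X j).1 (Opens.inclusion h p) = (Y j).1 p :=
    (hX j).self_of_nhds.trans (extField_of_mem (Y j).1 p)
  exact congrArg ((l i).val p) h1

end CovField

section Functions

variable {U V : Opens M}

/-- The differential of a smooth function. -/
noncomputable def diffCov (r : SmoothFn I U) : CovField I U where
  val p := (mfderiv I 𝓘(ℝ, ℝ) (Function.extend Subtype.val r 0) p).toLinearMap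
  smooth x hx Y hY := by
    have h0 : ContMDiffOn I 𝓘(ℝ, ℝ) ∞ (Function.extend Subtype.val r 0) (U : Set M) :=
      fun y hy => (contMDiffAt_extend_fn r hy).contMDiffWithinAt
    have h1 := h0.contMDiffOn_tangentMapWithin (m := ∞) (by simp) U.isOpen.uniqueMDiffOn
    have hn : Bundle.TotalSpace.proj ⁻¹' (U : Set M) ∈ 𝓝 (⟨x, Y x⟩ : TangentBundle I M) :=
      (FiberBundle.continuous_proj _ _).continuousAt.preimage_mem_nhds (U.isOpen.mem_nhds hx)
    have h2 := (h1 ⟨x, Y x⟩ hx).contMDiffAt hn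
    have h3 := h2.comp x hY
    have h4 := (contMDiff_snd_tangentBundle_modelSpace ℝ 𝓘(ℝ, ℝ) (n := ∞)).contMDiffAt.comp x h3
    refine h4.congr_of_eventuallyEq ?_
    filter_upwards [U.isOpen.mem_nhds hx] with y hy
    simp only [Function.comp, tangentMapWithin]
    rw [mfderivWithin_of_isOpen U.isOpen hy]
    rfl

lemma extend_resFn_eventuallyEq (h : V ≤ U) (r : SmoothFn I U) {p : M} (hp : p ∈ V) :
    Function.extend Subtype.val (resFn I h r) 0 =ᶠ[𝓝 p] Function.extend Subtype.val r 0 := by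
  filter_upwards [V.isOpen.mem_nhds hp] with q hq
  rw [extend_apply_of_mem _ (show q ∈ V from hq), extend_apply_of_mem _ (h hq)]
  rfl

lemma toDual_restrict_diffCov (h : V ≤ U) (r : SmoothFn I U) :
    ((diffCov r).restrict h).toDual = (diffCov (resFn I h r)).toDual := by
  ext X p
  have := (extend_resFn_eventuallyEq h r p.2).mfderiv_eq (I := I) (I' := 𝓘(ℝ, ℝ))
  rw [CovField.toDual_apply, CovField.toDual_apply]
  simp only [diffCov, CovField.restrict]
  rw [this]

end Functions

section Coordinates

variable {φ ψ : OpenPartialHomeomorph M H}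

/-- The coordinate functions of a chart. -/
noncomputable def coordFn (hφ : φ ∈ IsManifold.maximalAtlas I ∞ M) (j : Fin N) :
    SmoothFn I (chartDom φ) :=
  ⟨fun p => φ.extend I (p : M) j, by
    intro p
    have h2 := (EuclideanSpace.proj (𝕜 := ℝ) j).contMDiff (n := ∞) |>.contMDiffAt.comp (p : M)
      (φ.contMDiffAt_extend hφ p.2)
    exact (contMDiffAt_subtype_iff (U := chartDom φ) (x := p)).2 h2⟩

/-- This presents the coordinate forms as wedges of differentials of functions, a class which is
stable under restriction and makes sense independently of the chart. -/
lemma diffCov_coordFn (hφ : φ ∈ IsManifold.maximalAtlas I ∞ M) (j : Fin N) :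
    (diffCov (coordFn hφ j)).toDual = coordDiff hφ j := by
  ext X p
  have he : Function.extend Subtype.val (coordFn hφ j) 0 =ᶠ[𝓝 (p : M)]
      (EuclideanSpace.proj (𝕜 := ℝ) j : EuclideanSpace ℝ (Fin N) → ℝ) ∘ φ.extend I := by
    filter_upwards [φ.open_source.mem_nhds p.2] with q hq
    rw [extend_apply_of_mem _ (show q ∈ chartDom φ from hq)]
    rfl
  have h1 : mfderiv I 𝓘(ℝ, ℝ) (Function.extend Subtype.val (coordFn hφ j) 0) (p : M) =
      (EuclideanSpace.proj (𝕜 := ℝ) j : EuclideanSpace ℝ (Fin N) →L[ℝ] ℝ).comp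
        (mfderiv I 𝓘(ℝ, EuclideanSpace ℝ (Fin N)) (φ.extend I) (p : M)) := by
    rw [he.mfderiv_eq, mfderiv_comp (I' := 𝓘(ℝ, EuclideanSpace ℝ (Fin N))) _
      (EuclideanSpace.proj (𝕜 := ℝ) j).mdifferentiableAt (mdiffAt_extend hφ p.2)]
    rw [ContinuousLinearMap.mfderiv_eq]
    rfl
  rw [CovField.toDual_apply]
  exact DFunLike.congr_fun h1 (X.1 p)

/-- The derivative of a function along a coordinate field is the partial derivative. -/
lemma diffCov_coordField (hφ : φ ∈ IsManifold.maximalAtlas I ∞ M) (j : Fin N)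
    (r : SmoothFn I (chartDom φ)) (p : chartDom φ) :
    (diffCov r).toDual (coordField hφ j) p =
      fderivWithin ℝ (chartRep I φ r) (φ.extend I).target (φ.extend I p)
        (EuclideanSpace.single j 1) := by
  have hp : (p : M) ∈ (φ.extend I).source := by rw [φ.extend_source]; exact p.2
  have hy := (φ.extend I).map_source hp
  have hU : UniqueMDiffWithinAt 𝓘(ℝ, EuclideanSpace ℝ (Fin N)) (φ.extend I).target
      (φ.extend I p) := (uniqueDiffOn_target φ _ hy).uniqueMDiffWithinAt
  have h1 := contMDiffOn_extend_symm hφ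
  rw [← φ.extend_target'] at h1
  have h2 := mfderiv_comp_mfderivWithin_of_eq (I := 𝓘(ℝ, EuclideanSpace ℝ (Fin N))) (I' := I)
    (I'' := 𝓘(ℝ, ℝ)) (g := Function.extend Subtype.val r 0) (f := (φ.extend I).symm)
    (s := (φ.extend I).target) (x := φ.extend I p) (y := (p : M))
    ((contMDiffAt_extend_fn r p.2).mdifferentiableAt (by simp))
    ((h1 _ hy).mdifferentiableWithinAt (by simp)) hU ((φ.extend I).left_inv hp)
  rw [mfderivWithin_eq_fderivWithin] at h2
  exact (DFunLike.congr_fun h2 (EuclideanSpace.single j 1)).symm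

lemma extend_mem_target (p : chartDom φ) : φ.extend I p ∈ (φ.extend I).target :=
  (φ.extend I).map_source (by rw [φ.extend_source]; exact p.2)

lemma chartRep_extend {Y : Type*} [AddCommGroup Y] [Module ℝ Y] [TopologicalSpace Y]
    (f : chartDom φ → Y) (p : chartDom φ) :
    chartRep I φ f (φ.extend I p) = f p := by
  rw [chartRep_apply (U := chartDom φ) subset_rfl f (extend_mem_target p)]
  exact congrArg f (Subtype.ext (φ.extend_left_inv p.2))

/-- The partial derivative of a smooth function, as an additive map. -/
noncomputable def partialFn (hφ : φ ∈ IsManifold.maximalAtlas I ∞ M) (j : Fin N) :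
    SmoothFn I (chartDom φ) →+ SmoothFn I (chartDom φ) :=
  AddMonoidHom.mk' (fun r => (diffCov r).toDual (coordField hφ j)) (by
    intro r s
    ext p
    rw [ContMDiffMap.coe_add, Pi.add_apply, diffCov_coordField, diffCov_coordField,
      diffCov_coordField, ← _root_.add_apply, ← fderivWithin_add
        (uniqueDiffOn_target φ _ (extend_mem_target p))
        ((contDiffOn_chartRep hφ subset_rfl r).differentiableOn (by simp) _ (extend_mem_target p))
        ((contDiffOn_chartRep hφ subset_rfl s).differentiableOn (by simp) _ (extend_mem_target p))]
    refine congrArg (fun L : _ →L[ℝ] ℝ => L (EuclideanSpace.single j 1)) (fderivWithin_congr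
      (fun y hy => ?_) ?_)
    · rw [Pi.add_apply]
      simp only [chartRep_apply (U := chartDom φ) subset_rfl _ hy]
      rfl
    · rw [Pi.add_apply]
      simp only [chartRep_extend]
      rfl)

lemma partialFn_apply_apply (hφ : φ ∈ IsManifold.maximalAtlas I ∞ M) (j : Fin N)
    (r : SmoothFn I (chartDom φ)) (p : chartDom φ) :
    partialFn hφ j r p = fderivWithin ℝ (chartRep I φ r) (φ.extend I).target (φ.extend I p)
        (EuclideanSpace.single j 1) := diffCov_coordField hφ j r p

lemma partialFn_mul (hφ : φ ∈ IsManifold.maximalAtlas I ∞ M) (j : Fin N)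
    (r s : SmoothFn I (chartDom φ)) :
    partialFn hφ j (r * s) = partialFn hφ j r * s + r * partialFn hφ j s := by
  ext p
  have h1 := fderivWithin_mul (uniqueDiffOn_target φ _ (extend_mem_target p))
    ((contDiffOn_chartRep hφ subset_rfl r).differentiableOn (by simp) _ (extend_mem_target p))
    ((contDiffOn_chartRep hφ subset_rfl s).differentiableOn (by simp) _ (extend_mem_target p))
  have h2 : fderivWithin ℝ (chartRep I φ (r * s)) (φ.extend I).target (φ.extend I p) =
      fderivWithin ℝ (chartRep I φ r * chartRep I φ s) (φ.extend I).target (φ.extend I p) := by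
    refine fderivWithin_congr (fun y hy => ?_) ?_
    · rw [Pi.mul_apply]
      simp only [chartRep_apply (U := chartDom φ) subset_rfl _ hy]
      rfl
    · rw [Pi.mul_apply]
      simp only [chartRep_extend]
      rfl
  have e : (partialFn hφ j r * s + r * partialFn hφ j s) p =
      partialFn hφ j r p * s p + r p * partialFn hφ j s p := rfl
  rw [e, partialFn_apply_apply, partialFn_apply_apply, partialFn_apply_apply, h2, h1]
  simp only [chartRep_extend, _root_.add_apply, _root_.smul_apply, smul_eq_mul]
  ring

/-- Both sides are values of the second derivative of the chart representation within the chart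
image. It is symmetric also at boundary points, because these lie in the closure of the interior. -/
lemma partialFn_comm (hφ : φ ∈ IsManifold.maximalAtlas I ∞ M) (i j : Fin N)
    (r : SmoothFn I (chartDom φ)) :
    partialFn hφ i (partialFn hφ j r) = partialFn hφ j (partialFn hφ i r) := by
  have key : ∀ (i j : Fin N) (p : chartDom φ), partialFn hφ i (partialFn hφ j r) p =
      fderivWithin ℝ (fderivWithin ℝ (chartRep I φ r) (φ.extend I).target) (φ.extend I).target
        (φ.extend I p) (EuclideanSpace.single i 1) (EuclideanSpace.single j 1) := by
    intro i j p
    have hS := uniqueDiffOn_target (I := I) φ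
    have hd := contDiffOn_chartRep hφ subset_rfl r
    have h1 : fderivWithin ℝ (chartRep I φ (partialFn hφ j r)) (φ.extend I).target
        (φ.extend I p) = fderivWithin ℝ (fun y => fderivWithin ℝ (chartRep I φ r)
          (φ.extend I).target y (EuclideanSpace.single j 1)) (φ.extend I).target
            (φ.extend I p) := by
      have aux : ∀ y ∈ (φ.extend I).target, chartRep I φ (partialFn hφ j r) y =
          fderivWithin ℝ (chartRep I φ r) (φ.extend I).target y (EuclideanSpace.single j 1) := by
        intro y hy
        rw [chartRep_apply (U := chartDom φ) subset_rfl _ hy, partialFn_apply_apply,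
          (φ.extend I).right_inv hy]
      exact fderivWithin_congr aux (aux _ (extend_mem_target p))
    rw [partialFn_apply_apply, h1, fderivWithin_clm_apply (hS _ (extend_mem_target p))
      ((hd.fderivWithin (m := ∞) hS (by simp)).differentiableOn (by simp) _ (extend_mem_target p))
      (differentiableWithinAt_const _)]
    simp
  ext p
  rw [key, key]
  have hd := contDiffOn_chartRep hφ subset_rfl r
  exact ((hd _ (extend_mem_target p)).isSymmSndFDerivWithinAt
    (by simpa using WithTop.coe_le_coe.2 (le_top : (2 : ℕ∞) ≤ ⊤))
    (uniqueDiffOn_target (I := I) φ) (target_subset_closure φ (extend_mem_target p))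
    (extend_mem_target p)) _ _

end Coordinates

end Covectors

/-! ### Independence of the chart differential from the chart. -/

section Naturality

variable {N : ℕ} {H : Type*} [TopologicalSpace H]
  {I : ModelWithCorners ℝ (EuclideanSpace ℝ (Fin N)) H}
  {M : Type*} [TopologicalSpace M] [ChartedSpace H M] [IsManifold I ∞ M]
  {G : Type*} [AddCommGroup G] [Module ℝ G] [TopologicalSpace G]
  [IsTopologicalAddGroup G] [ContinuousSMul ℝ G] [LocallyConvexSpace ℝ G] [T2Space G]
  {φ ψ : OpenPartialHomeomorph M H}

/-- The partial derivative of `G`-valued maps on a chart domain, as an additive map. -/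
noncomputable def partialMap (hφ : φ ∈ IsManifold.maximalAtlas I ∞ M) (j : Fin N) :
    smoothMaps I G (chartDom φ) →+ smoothMaps I G (chartDom φ) :=
  AddMonoidHom.mk' (partialDeriv hφ j) (by
    intro f g
    refine Subtype.ext (funext fun p => ?_)
    refine BastianiSmoothOn.deriv_add (target_subset_closure φ) (smoothMaps_rep hφ f)
      (smoothMaps_rep hφ g) (smoothMaps_rep hφ (f + g)) (fun y hy => ?_) (extend_mem_target p) _
    simp only [chartRep_apply (U := chartDom φ) subset_rfl _ hy]
    rfl)

lemma partialMap_smul (hφ : φ ∈ IsManifold.maximalAtlas I ∞ M) (j : Fin N)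
    (r : SmoothFn I (chartDom φ)) (f : smoothMaps I G (chartDom φ)) :
    partialMap hφ j (r • f) = partialFn hφ j r • f + r • partialMap hφ j f := by
  refine Subtype.ext (funext fun p => ?_)
  have h := BastianiSmoothOn.deriv_smul (target_subset_closure φ) (uniqueDiffOn_target φ)
    (contDiffOn_chartRep hφ subset_rfl r) (smoothMaps_rep hφ f)
    (smoothMaps_rep hφ (r • f)) (fun y hy => by
      simp only [chartRep_apply (U := chartDom φ) subset_rfl _ hy]
      rfl) (extend_mem_target p) (EuclideanSpace.single j 1)
  rw [chartRep_extend, chartRep_extend, ← partialFn_apply_apply hφ j r p, add_comm] at h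
  exact h

/-- The chain rule `∂_i^ψ f = ∑_j (∂_i^ψ x_j) ∂_j^φ f`, obtained by differentiating the
representation of `f` in `φ` composed with the transition map. -/
lemma partialMap_resMap (hφ : φ ∈ IsManifold.maximalAtlas I ∞ M)
    (hψ : ψ ∈ IsManifold.maximalAtlas I ∞ M) (h : chartDom ψ ≤ chartDom φ) (i : Fin N)
    (f : smoothMaps I G (chartDom φ)) :
    partialMap hψ i (resMap I G h f) =
      ∑ j, partialFn hψ i (resFn I h (coordFn hφ j)) • resMap I G h (partialMap hφ j f) := by
  obtain ⟨h1, h2, h3⟩ := transition_interior hφ hψ h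
  refine Subtype.ext (funext fun p => ?_)
  have hc := BastianiSmoothOn.deriv_comp (target_subset_closure ψ) (uniqueDiffOn_target ψ)
    (smoothMaps_rep hφ f) h1 h2 h3 (smoothMaps_rep hψ (resMap I G h f)) (fun y hy => by
      have hy' := symm_mem (U := chartDom ψ) subset_rfl hy
      simp only [chartRep_apply (U := chartDom ψ) subset_rfl _ hy]
      rw [chartRep_apply (U := chartDom φ) subset_rfl _ (h2 hy)]
      exact congrArg f.1 (Subtype.ext (φ.extend_left_inv (h hy')).symm)) (extend_mem_target p)
    (EuclideanSpace.single i 1)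
  have hT : ∀ j, (fderivWithin ℝ (fun y => φ.extend I ((ψ.extend I).symm y)) (ψ.extend I).target
      (ψ.extend I p) (EuclideanSpace.single i 1)) j =
        partialFn hψ i (resFn I h (coordFn hφ j)) p := by
    intro j
    rw [partialFn_apply_apply]
    have hd := (h1.differentiableOn (by simp) _ (extend_mem_target (I := I) p))
    have e : fderivWithin ℝ (chartRep I ψ (resFn I h (coordFn hφ j))) (ψ.extend I).target
        (ψ.extend I p) = fderivWithin ℝ ((EuclideanSpace.proj (𝕜 := ℝ) j :
          EuclideanSpace ℝ (Fin N) → ℝ) ∘ fun y => φ.extend I ((ψ.extend I).symm y))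
          (ψ.extend I).target (ψ.extend I p) := by
      have aux : ∀ y ∈ (ψ.extend I).target, chartRep I ψ (resFn I h (coordFn hφ j)) y =
          ((EuclideanSpace.proj (𝕜 := ℝ) j : EuclideanSpace ℝ (Fin N) → ℝ) ∘
            fun y => φ.extend I ((ψ.extend I).symm y)) y := by
        intro y hy
        rw [chartRep_apply (U := chartDom ψ) subset_rfl _ hy]
        rfl
      exact fderivWithin_congr aux (aux _ (extend_mem_target p))
    rw [e, (EuclideanSpace.proj (𝕜 := ℝ) j).hasFDerivAt.comp_hasFDerivWithinAt _
      hd.hasFDerivWithinAt |>.fderivWithin (uniqueDiffOn_target ψ _ (extend_mem_target p))]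
    rfl
  set v := fderivWithin ℝ (fun y => φ.extend I ((ψ.extend I).symm y)) (ψ.extend I).target
      (ψ.extend I p) (EuclideanSpace.single i 1) with hv
  -- Expanding the direction in the standard basis uses that the Bastiani derivative is linear in
  -- the direction, at boundary points too.
  have hvs : v = ∑ j, v j • EuclideanSpace.single j (1 : ℝ) := by
    ext k
    simp [Finset.sum_apply, Pi.single_apply]
  rw [hvs, BastianiSmoothOn.deriv_sum (target_subset_closure φ) (smoothMaps_rep hφ f)
    (h2 (extend_mem_target p))] at hc
  refine hc.trans ?_
  rw [AddSubgroup.val_finsetSum, Finset.sum_apply]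
  refine Finset.sum_congr rfl fun j _ => ?_
  rw [hT, smoothMaps_smul_apply]
  congr 1
  have hl : (ψ.extend I).symm (ψ.extend I p) = p := ψ.extend_left_inv p.2
  beta_reduce
  rw [hl]
  rfl

/-- The coefficients, chosen through unique existence, are the values on the coordinate fields. This
makes additivity of the chart differential available. -/
lemma chartDiffAlt_eq (hφ : φ ∈ IsManifold.maximalAtlas I ∞ M) {k : ℕ}
    (θ : GAlt I G (chartDom φ) k) :
    chartDiffAlt hφ θ = tensorDiff (coordBasis hφ) (coordDiff hφ) (partialMap hφ) θ := by
  have hdx : ∀ i j, coordDiff hφ i (coordBasis hφ j) = if i = j then 1 else 0 :=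
    fun i j => by rw [coordBasis_apply, coordDiff_coordField]
  have hc : ∀ J, coeff hφ θ J = tensorEval _ (fun a => coordBasis hφ (J a)) θ := by
    intro J
    conv_rhs => rw [eq_sum_coeff hφ θ]
    simp only [map_sum, tensorEval_tmul, coordForm, wedgeList_basis _ hdx, ite_smul, one_smul,
      zero_smul, Finset.sum_ite_eq', Finset.mem_univ, if_true]
  rw [chartDiffAlt, tensorDiff_apply]
  simp only [hc]
  rfl

/-- The functions `y a` are arbitrary: their differentials have a closed wedge product in the chart
`φ`. The intended case is that of restricted coordinates of a different chart. -/
lemma chartDiffAlt_tmul (hφ : φ ∈ IsManifold.maximalAtlas I ∞ M) {k : ℕ}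
    (f : smoothMaps I G (chartDom φ)) (y : Fin k → SmoothFn I (chartDom φ)) :
    chartDiffAlt hφ (f ⊗ₜ wedgeList k fun a => (diffCov (y a)).toDual) =
      ∑ j, partialMap hφ j f ⊗ₜ[SmoothFn I (chartDom φ)]
        wedgeOne (coordDiff hφ j) (wedgeList k fun a => (diffCov (y a)).toDual) := by
  have hdx : ∀ i j, coordDiff hφ i (coordBasis hφ j) = if i = j then 1 else 0 :=
    fun i j => by rw [coordBasis_apply, coordDiff_coordField]
  have h := tensorDiff_tmul (A := SmoothFn I (chartDom φ)) (P := smoothFields I (chartDom φ))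
    (Q := smoothMaps I G (chartDom φ)) (δ := partialFn hφ) (coordBasis hφ) (partialMap hφ) hdx
    (partialMap_smul hφ) f (wedgeList k fun a => (diffCov (y a)).toDual)
  rw [basisDiff_wedgeList _ hdx (partialFn_mul hφ) (partialFn_comm hφ) y _ (fun a j => by
      rw [coordBasis_apply]; rfl), TensorProduct.tmul_zero, add_zero] at h
  exact (chartDiffAlt_eq hφ _).trans h

/-- A `1`-form is the combination of the coordinate differentials. -/
lemma eq_sum_coordDiff (hφ : φ ∈ IsManifold.maximalAtlas I ∞ M)
    (α : smoothFields I (chartDom φ) →ₗ[SmoothFn I (chartDom φ)] SmoothFn I (chartDom φ)) :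
    α = ∑ i, α (coordField hφ i) • coordDiff hφ i := by
  refine (coordBasis hφ).ext fun j => ?_
  rw [LinearMap.sum_apply]
  simp [coordBasis_apply, coordDiff_coordField]

/-- The differential on chart domains commutes with restriction and changes of charts. -/
theorem resGAlt_chartDiffAlt [T2Space M] (hφ : φ ∈ IsManifold.maximalAtlas I ∞ M)
    (hψ : ψ ∈ IsManifold.maximalAtlas I ∞ M) (h : chartDom ψ ≤ chartDom φ) {k : ℕ}
    (θ : GAlt I G (chartDom φ) k) :
    resGAlt I G h (k + 1) (chartDiffAlt hφ θ) = chartDiffAlt hψ (resGAlt I G h k θ) := by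
  -- By additivity of both sides it is enough to treat one term `f ⊗ dx_J`; the form `tensorDiff` is
  -- used only to distribute over the sum.
  rw [eq_sum_coeff hφ θ, chartDiffAlt_eq hψ, chartDiffAlt_eq hφ]
  simp only [map_sum]
  refine Finset.sum_congr rfl fun J _ => ?_
  rw [← chartDiffAlt_eq hψ, ← chartDiffAlt_eq hφ]
  set f := coeff hφ θ J
  have hres : ∀ {l : ℕ} (y : Fin l → SmoothFn I (chartDom φ)),
      resAlt h (wedgeList l fun a => (diffCov (y a)).toDual) =
        wedgeList l fun a => (diffCov (resFn I h (y a))).toDual := by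
    intro l y
    rw [CovField.resAlt_wedgeList]
    simp only [toDual_restrict_diffCov]
  have hJ : coordForm hφ J = wedgeList k fun a => (diffCov (coordFn hφ (J a))).toDual := by
    simp only [diffCov_coordFn]
    rfl
  have hw : ∀ j, wedgeOne (coordDiff hφ j) (coordForm hφ J) = wedgeList (k + 1) fun a =>
      (diffCov ((Fin.cons (coordFn hφ j) fun a => coordFn hφ (J a) :
        Fin (k + 1) → SmoothFn I (chartDom φ)) a)).toDual := by
    intro j
    rw [hJ, wedgeList, ← diffCov_coordFn]
    rfl
  rw [resGAlt_tmul, hJ, hres, chartDiffAlt_tmul, chartDiffAlt_tmul, ← hJ, map_sum]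
  simp only [resGAlt_tmul, hw, hres]
  have hw' : ∀ j, (wedgeList (k + 1) fun a => (diffCov (resFn I h
      ((Fin.cons (coordFn hφ j) fun a => coordFn hφ (J a) :
        Fin (k + 1) → SmoothFn I (chartDom φ)) a))).toDual) =
      wedgeOne (diffCov (resFn I h (coordFn hφ j))).toDual
        (wedgeList k fun a => (diffCov (resFn I h (coordFn hφ (J a)))).toDual) := fun j => rfl
  simp only [hw']
  simp only [partialMap_resMap hφ hψ h, TensorProduct.sum_tmul]
  rw [Finset.sum_comm]
  refine Finset.sum_congr rfl fun j _ => ?_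
  -- The chain rule has put the factors `∂_i^ψ x_j` on the map side. Expanding `dx_j` in the
  -- differentials of `ψ` produces the same factors on the form side, and they cross the tensor
  -- sign.
  conv_lhs => rw [eq_sum_coordDiff hψ (diffCov (resFn I h (coordFn hφ j))).toDual,
    ← wedgeOneBilin_apply, map_sum, LinearMap.sum_apply, TensorProduct.tmul_sum]
  refine Finset.sum_congr rfl fun i _ => ?_
  rw [map_smul, LinearMap.smul_apply, TensorProduct.smul_tmul, wedgeOneBilin_apply]
  rfl

end Naturality

/-! ### A finite dual basis for the vector fields on an open set. -/

section DualBasis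

variable {N : ℕ} {H : Type*} [TopologicalSpace H]
  {I : ModelWithCorners ℝ (EuclideanSpace ℝ (Fin N)) H}
  {M : Type*} [TopologicalSpace M] [ChartedSpace H M] [IsManifold I ∞ M]

lemma eventually_nhds_subtype {U : Opens M} {p : U} {P : M → Prop}
    (h : ∀ᶠ q : U in 𝓝 p, P q) : ∀ᶠ q in 𝓝 (p : M), P q := by
  rw [← U.isOpen.isOpenEmbedding_subtypeVal.map_nhds_eq p]
  exact h

variable (I) in
/-- On an open set of a manifold there are finitely many families of charts, with locally constant
choices in each family, and a partition of unity of products subordinate to them. -/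
lemma exists_local_charts [T2Space M] [SecondCountableTopology M] (U : Opens M) :
    ∃ (κ : (Fin N → ZMod 2) × ZMod 3 → M → OpenPartialHomeomorph M H)
      (τ σ : (Fin N → ZMod 2) × ZMod 3 → SmoothFn I U),
      (∀ c x, κ c x ∈ IsManifold.maximalAtlas I ∞ M) ∧
      (∀ c (p : U), ((p : M) ∈ (κ c p).source ∧ ∀ᶠ q in 𝓝 (p : M), κ c q = κ c p) ∨
        ∀ᶠ q in 𝓝 p, τ c q = 0 ∧ σ c q = 0) ∧
      ∀ p, ∑ c, σ c p * τ c p = 1 := by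
  classical
  have : LocallyCompactSpace H := I.locallyCompactSpace
  have : LocallyCompactSpace U := ChartedSpace.locallyCompactSpace H U
  -- The dimension hypothesis is met by compact neighbourhoods inside chart domains, embedded in
  -- `ℝ^N` by the chart.
  obtain ⟨W, n, hWo, hWU, hWs, hWn⟩ := exists_finite_coloring (X := U) (N := N)
    (s := fun x => Subtype.val ⁻¹' (chartAt H (x : M)).source) (fun x => by
      have ho : IsOpen (Subtype.val ⁻¹' (chartAt H (x : M)).source : Set U) :=
        (chartAt H (x : M)).open_source.preimage continuous_subtype_val
      obtain ⟨K, hK, hKs, hKc⟩ := local_compact_nhds (ho.mem_nhds (mem_chart_source H (x : M)))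
      refine ⟨K, hK, hKc, fun y i => (chartAt H (x : M)).extend I (y : M) i, ?_, ?_⟩
      · have h1 : ContinuousOn (fun y : U => (chartAt H (x : M)).extend I (y : M)) K :=
          ((chartAt H (x : M)).continuousOn_extend (I := I)).comp
            continuous_subtype_val.continuousOn
            fun y hy => by rw [OpenPartialHomeomorph.extend_source]; exact hKs hy
        exact (EuclideanSpace.equiv (Fin N) ℝ).continuous.comp_continuousOn h1
      · intro y hy z hz hyz
        refine Subtype.ext (((chartAt H (x : M)).extend I).injOn ?_ ?_ ?_)
        · rw [OpenPartialHomeomorph.extend_source]; exact hKs hy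
        · rw [OpenPartialHomeomorph.extend_source]; exact hKs hz
        · ext i
          exact congrFun hyz i)
    (fun x => (chartAt H (x : M)).open_source.preimage continuous_subtype_val)
    (fun x => mem_chart_source H (x : M))
  obtain ⟨τ, hτ⟩ := SmoothPartitionOfUnity.exists_isSubordinate I (M := U) isClosed_univ W hWo
    hWU.ge
  have hsum : ∀ p, ∑ c, τ c p = 1 := fun p => by
    rw [← finsum_eq_sum_of_fintype]
    exact τ.sum_eq_one (mem_univ p)
  -- Fields and covectors must both be cut off, so the products of the cut-offs have to add up to
  -- one: `σ_c = τ_c / ∑ τ²`, where the denominator vanishes nowhere since the `τ_c` sum to one.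
  let T : SmoothFn I U := ∑ c, τ c * τ c
  have hT : ∀ p, T p = ∑ c, τ c p * τ c p := by
    intro p
    exact map_sum (CovField.evalRingHom p) (fun c => τ c * τ c) Finset.univ
  have hT0 : ∀ p, T p ≠ 0 := by
    intro p h0
    rw [hT, Finset.sum_eq_zero_iff_of_nonneg fun c _ => mul_self_nonneg _] at h0
    have := hsum p
    rw [Finset.sum_eq_zero fun c hc => mul_self_eq_zero.1 (h0 c hc)] at this
    exact zero_ne_one this
  let T' : SmoothFn I U := ⟨fun p => (T p)⁻¹, T.contMDiff.inv₀ hT0⟩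
  let m : (Fin N → ZMod 2) × ZMod 3 → M → M := fun c x =>
    if h : x ∈ U then (n c ⟨x, h⟩ : M) else x
  have hm : ∀ c (p : U), m c p = n c p := fun c p => by simp [m]
  refine ⟨fun c x => chartAt H (m c x), fun c => τ c, fun c => T' * τ c,
    fun c x => IsManifold.chart_mem_maximalAtlas _, fun c p => ?_, fun p => ?_⟩
  · by_cases hp : p ∈ W c
    · left
      constructor
      · beta_reduce
        rw [hm]
        exact hWs c p hp
      · refine eventually_nhds_subtype ?_
        filter_upwards [hWn c p hp] with q hq
        rw [hm, hm, hq]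
    · right
      have : ∀ᶠ q in 𝓝 p, τ c q = 0 := notMem_tsupport_iff_eventuallyEq.1 fun h => hp (hτ c h)
      filter_upwards [this] with q hq
      refine ⟨hq, ?_⟩
      rw [ContMDiffMap.coe_mul, Pi.mul_apply, hq, mul_zero]
  · have : ∀ c, (T' * τ c) p * τ c p = (T p)⁻¹ * (τ c p * τ c p) := fun c => mul_assoc _ _ _
    simp only [this]
    rw [← Finset.mul_sum, ← hT, inv_mul_cancel₀ (hT0 p)]

/-- The module of vector fields on an open set of a manifold has a finite dual basis, given by
vector fields and smooth covector fields. -/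
theorem exists_dualBasis [T2Space M] [SecondCountableTopology M] (U : Opens M) :
    ∃ (m : ℕ) (X : Fin m → smoothFields I U) (l : Fin m → CovField I U),
      ∀ (p : U) (v : TangentSpace I (p : M)), ∑ i, (l i).val p v • (X i).1 p = v := by
  obtain ⟨κ, τ, σ, hκ, hloc, hsum⟩ := exists_local_charts I U
  let X : ((Fin N → ZMod 2) × ZMod 3) × Fin N → smoothFields I U := fun c =>
    ⟨fun p => τ c.1 p • chartSymmDeriv (κ c.1 p) p (EuclideanSpace.single c.2 1), by
      refine (contMDiff_field_iff _).2 fun x hx => ?_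
      -- Near `x` either the chart of this colour is fixed, and the field is `τ` times a coordinate
      -- field of that chart, or `τ` vanishes identically.
      rcases hloc c.1 ⟨x, hx⟩ with ⟨hs, hev⟩ | h0
      · have h1 := (contMDiffAt_extend_fn (τ c.1) hx).smul_section ((contMDiff_field_iff _).1
          (coordField (hκ c.1 x) c.2).2 x hs)
        refine h1.congr_of_eventuallyEq ?_
        filter_upwards [hev, U.isOpen.mem_nhds hx, (κ c.1 x).open_source.mem_nhds hs]
          with q hq hqU hqs
        have e1 := extField_of_mem (coordField (hκ c.1 x) c.2).1 ⟨q, hqs⟩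
        have e2 := extField_of_mem (I := I) (fun p : U => τ c.1 p • chartSymmDeriv (I := I)
          (κ c.1 p) p (EuclideanSpace.single c.2 1)) ⟨q, hqU⟩
        have e3 := extend_apply_of_mem (τ c.1) (show q ∈ U from hqU)
        dsimp only at e1 e2 e3 hq
        rw [Pi.smul_apply', e2, e1, e3, hq]
        rfl
      · refine (Bundle.contMDiffAt_zeroSection ℝ
          (TangentSpace I : M → Type _)).congr_of_eventuallyEq ?_
        have h1 : ∀ᶠ q in 𝓝 x, ∀ hq : q ∈ U, τ c.1 ⟨q, hq⟩ = 0 :=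
          eventually_nhds_subtype (p := ⟨x, hx⟩) (by
            filter_upwards [h0] with q hq _
            exact hq.1)
        filter_upwards [h1, U.isOpen.mem_nhds hx] with q hq hqU
        have e2 := extField_of_mem (I := I) (fun p : U => τ c.1 p • chartSymmDeriv (I := I)
          (κ c.1 p) p (EuclideanSpace.single c.2 1)) ⟨q, hqU⟩
        dsimp only at e2
        rw [e2, hq hqU, zero_smul]
        rfl⟩
  let l : ((Fin N → ZMod 2) × ZMod 3) × Fin N → CovField I U := fun c =>
    ⟨fun x => Function.extend Subtype.val (σ c.1) 0 x •
      ((EuclideanSpace.proj (𝕜 := ℝ) c.2).toLinearMap ∘ₗ chartDeriv (κ c.1 x) x), by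
      intro x hx Y hY
      rcases hloc c.1 ⟨x, hx⟩ with ⟨hs, hev⟩ | h0
      · have h1 := contMDiffAt_chartDeriv (hκ c.1 x) hs hY
        have h2 := (EuclideanSpace.proj (𝕜 := ℝ) c.2).contMDiff (n := ∞) |>.contMDiffAt.comp x h1
        refine ((contMDiffAt_extend_fn (σ c.1) hx).mul h2).congr_of_eventuallyEq ?_
        filter_upwards [hev] with q hq
        rw [hq]
        rfl
      · refine contMDiffAt_const (c := (0 : ℝ)) |>.congr_of_eventuallyEq ?_
        have h1 : ∀ᶠ q in 𝓝 x, ∀ hq : q ∈ U, σ c.1 ⟨q, hq⟩ = 0 :=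
          eventually_nhds_subtype (p := ⟨x, hx⟩) (by
            filter_upwards [h0] with q hq _
            exact hq.2)
        filter_upwards [h1, U.isOpen.mem_nhds hx] with q hq hqU
        rw [extend_apply_of_mem (σ c.1) (show q ∈ U from hqU), hq hqU, zero_smul]
        rfl⟩
  let e := (Fintype.equivFin (((Fin N → ZMod 2) × ZMod 3) × Fin N)).symm
  refine ⟨_, fun i => X (e i), fun i => l (e i), fun p v => ?_⟩
  rw [e.sum_comp fun c => (l c).val p v • (X c).1 p, Fintype.sum_prod_type]
  -- Within one colour the coordinate fields and differentials at `p` belong to the same chart and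
  -- are dual, so they reproduce `v` up to the cut-offs.
  have key : ∀ c, ∑ j, (l (c, j)).val p v • (X (c, j)).1 p = (σ c p * τ c p) • v := by
    intro c
    have h1 : ∀ j, (l (c, j)).val p v • (X (c, j)).1 p = (σ c p * τ c p) •
        chartSymmDeriv (κ c p) (p : M)
          (chartDeriv (κ c p) (p : M) v j • EuclideanSpace.single j (1 : ℝ)) := by
      intro j
      have e1 : (l (c, j)).val p v = σ c p * chartDeriv (κ c p) (p : M) v j := by
        simp only [l]
        rw [extend_apply_of_mem (σ c) p.2]
        rfl
      rw [e1, _root_.map_smul, smul_smul, smul_smul]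
      congr 1
      ring
    simp only [h1]
    rw [← Finset.smul_sum, ← map_sum]
    have h2 : ∑ j, chartDeriv (κ c p) (p : M) v j • EuclideanSpace.single j (1 : ℝ) =
        chartDeriv (κ c p) (p : M) v := by
      ext k
      simp [Finset.sum_apply, Pi.single_apply]
    rw [h2]
    -- When `p` is not known to lie in the chart domain, the chart derivatives carry no information,
    -- but the factor `τ` is zero.
    rcases hloc c p with ⟨hs, -⟩ | h0
    · rw [chartSymmDeriv_deriv (hκ c p) hs]
    · rw [h0.self_of_nhds.1, mul_zero, zero_smul, zero_smul]
  simp only [key]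
  rw [← Finset.sum_smul, hsum, one_smul]

end DualBasis

/-! ### Separation and gluing for `G`-valued maps and forms. -/

section Sheaf

variable {N : ℕ} {H : Type*} [TopologicalSpace H]
  {I : ModelWithCorners ℝ (EuclideanSpace ℝ (Fin N)) H}
  {M : Type*} [TopologicalSpace M] [ChartedSpace H M] [IsManifold I ∞ M]
  {G : Type*} [AddCommGroup G] [Module ℝ G] [TopologicalSpace G]
  [IsTopologicalAddGroup G]

lemma smoothMaps_ext_of_cover {U : Opens M} {ι : Type*} {V : ι → Opens M} (hV : ∀ i, V i ≤ U)
    (hc : ∀ x ∈ U, ∃ i, x ∈ V i) {f g : smoothMaps I G U}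
    (h : ∀ i, resMap I G (hV i) f = resMap I G (hV i) g) : f = g := by
  refine Subtype.ext (funext fun p => ?_)
  obtain ⟨i, hi⟩ := hc p p.2
  exact congrFun (congrArg Subtype.val (h i)) ⟨p, hi⟩

/-- Smooth maps into `G` glue. -/
lemma exists_smoothMaps_glue [T2Space G] {U : Opens M} {ι : Type*} {V : ι → Opens M}
    (hV : ∀ i, V i ≤ U) (hc : ∀ x ∈ U, ∃ i, x ∈ V i) (f : ∀ i, smoothMaps I G (V i))
    (hf : ∀ i j x (hi : x ∈ V i) (hj : x ∈ V j), (f i).1 ⟨x, hi⟩ = (f j).1 ⟨x, hj⟩) :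
    ∃ g : smoothMaps I G U, ∀ i, resMap I G (hV i) g = f i := by
  choose i hi using fun p : U => hc p p.2
  let g : U → G := fun p => (f (i p)).1 ⟨p, hi p⟩
  have hg : ∀ j (p : U) (hj : (p : M) ∈ V j), g p = (f j).1 ⟨p, hj⟩ := fun j p hj =>
    hf _ _ _ _ _
  refine ⟨⟨g, fun χ hχ hχU k => ?_⟩, fun j => Subtype.ext (funext fun p =>
    hg j ⟨p, hV j p.2⟩ p.2)⟩
  -- Smoothness must be tested in charts `χ` with domain in `U`, not in some `V j`. Around each
  -- point `χ` is restricted to a `V j`; the result is again a smooth chart, to which smoothness of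
  -- `f j` applies.
  refine BastianiOn.of_locally (target_subset_closure χ) fun y hy => ?_
  set j := i ⟨(χ.extend I).symm y, symm_mem hχU hy⟩
  have hj : (χ.extend I).symm y ∈ V j := hi ⟨(χ.extend I).symm y, symm_mem hχU hy⟩
  have hχ' : χ.restr (V j : Set M) ∈ IsManifold.maximalAtlas I ∞ M :=
    restr_mem_maximalAtlas (contDiffGroupoid ∞ I) hχ (V j).isOpen
  have hs : (χ.restr (V j : Set M)).source = χ.source ∩ V j := χ.restr_source' _ (V j).isOpen
  have ht : ((χ.restr (V j : Set M)).extend I).target =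
      I.symm ⁻¹' (χ.target ∩ χ.symm ⁻¹' V j) ∩ range I := by
    rw [OpenPartialHomeomorph.extend_target]
    have : (χ.restr (V j : Set M)).target = χ.target ∩ χ.symm ⁻¹' V j := by
      simp [(V j).isOpen.interior_eq]
    rw [this]
  refine ⟨I.symm ⁻¹' (χ.target ∩ χ.symm ⁻¹' V j),
    (χ.isOpen_inter_preimage_symm (V j).isOpen).preimage I.continuous_symm, ?_, ?_⟩
  · rw [χ.extend_target] at hy
    exact ⟨hy.1, hj⟩
  · have hsV : (χ.restr (V j : Set M)).source ⊆ V j := hs ▸ inter_subset_right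
    have hsub : (χ.extend I).target ∩ I.symm ⁻¹' (χ.target ∩ χ.symm ⁻¹' V j) ⊆
        ((χ.restr (V j : Set M)).extend I).target := by
      rw [ht, χ.extend_target]
      exact fun z hz => ⟨hz.2, hz.1.2⟩
    refine (((f j).2 _ hχ' hsV k).mono hsub).congr fun z hz => ?_
    rw [chartRep_apply hχU _ hz.1, chartRep_apply hsV _ (hsub hz)]
    exact (hg j ⟨(χ.extend I).symm z, _⟩ (symm_mem hsV (hsub hz))).symm

variable [ContinuousSMul ℝ G] [LocallyConvexSpace ℝ G] [T2Space M]

/-- Both sides at `p` can be evaluated on fields over `U` having the germs of `Y` at `p`, and there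
both give the value of `ζ`. -/
lemma resAlt_resAlt {U V W : Opens M} (hV : V ≤ U) (hW : W ≤ V) {k : ℕ} (ζ : Alt I U k) :
    resAlt hW (resAlt hV ζ) = resAlt (hW.trans hV) ζ := by
  ext Y p
  choose X hX using fun i => exists_near (hW.trans hV) p (Y i)
  have hc : Tendsto (Opens.inclusion hV) (𝓝 (Opens.inclusion hW p))
      (𝓝 (Opens.inclusion (hW.trans hV) p)) :=
    (contMDiff_inclusion (I := I) (n := ∞) hV).continuous.tendsto _
  refine (resVal_eq hW _ Y p (fun i => resField I hV (X i)) fun i => ?_).trans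
    ((DFunLike.congr_fun (resAlt_resField hV ζ X) (Opens.inclusion hW p)).trans
      (resVal_eq (hW.trans hV) ζ Y p X hX).symm)
  filter_upwards [hc.eventually (hX i)] with x hx
  exact hx

lemma resGAlt_resGAlt {U V W : Opens M} (hV : V ≤ U) (hW : W ≤ V) {k : ℕ} (θ : GAlt I G U k) :
    resGAlt I G hW k (resGAlt I G hV k θ) = resGAlt I G (hW.trans hV) k θ := by
  induction θ using TensorProduct.induction_on with
  | zero => simp
  | tmul f ζ =>
    rw [resGAlt_tmul, resGAlt_tmul, resGAlt_tmul, resAlt_resAlt]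
    rfl
  | add x y hx hy => rw [map_add, map_add, hx, hy, map_add]

/-- This reduces the sheaf property of forms to that of maps: with one dual basis over `U`, the
coefficients of a restricted form are the restricted coefficients. -/
lemma tensorEval_resGAlt {U V : Opens M} (hV : V ≤ U) {k : ℕ} (X : Fin k → smoothFields I U)
    (θ : GAlt I G U k) :
    tensorEval (smoothMaps I G V) (fun a => resField I hV (X a)) (resGAlt I G hV k θ) =
      resMap I G hV (tensorEval (smoothMaps I G U) X θ) := by
  induction θ using TensorProduct.induction_on with
  | zero => simp
  | tmul f ζ =>
    rw [resGAlt_tmul, tensorEval_tmul, tensorEval_tmul, resAlt_resField]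
    rfl
  | add x y hx hy => simp only [map_add, hx, hy]

/-- A pointwise dual basis over `U` gives a decomposition of forms over smaller open sets. -/
lemma gAlt_decomp {U V : Opens M} (hV : V ≤ U) {m : ℕ} {X : Fin m → smoothFields I U}
    {l : Fin m → CovField I U}
    (h : ∀ (p : U) (v : TangentSpace I (p : M)), ∑ i, (l i).val p v • (X i).1 p = v) {k : ℕ}
    (θ : GAlt I G V k) :
    θ = ∑ J : Fin k ↪o Fin m,
      tensorEval (smoothMaps I G V) (fun a => resField I hV (X (J a))) θ ⊗ₜ[SmoothFn I V]
        wedgeList k (fun a => ((l (J a)).restrict hV).toDual) := by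
  refine tensor_decomp_dual (X := fun i => resField I hV (X i))
    (l := fun i => ((l i).restrict hV).toDual) (fun Y => ?_) θ
  refine Subtype.ext (funext fun p => ?_)
  rw [AddSubgroup.val_finsetSum, Finset.sum_apply]
  exact h (Opens.inclusion hV p) (Y.1 p)

variable [SecondCountableTopology M]

/-- Forms are determined by their restrictions to an open cover. -/
theorem gAlt_ext_of_cover {U : Opens M} {ι : Type*} {V : ι → Opens M} (hV : ∀ i, V i ≤ U)
    (hc : ∀ x ∈ U, ∃ i, x ∈ V i) {k : ℕ} {θ η : GAlt I G U k}
    (h : ∀ i, resGAlt I G (hV i) k θ = resGAlt I G (hV i) k η) : θ = η := by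
  obtain ⟨m, X, l, hX⟩ := exists_dualBasis (I := I) U
  rw [gAlt_decomp le_rfl hX θ, gAlt_decomp le_rfl hX η]
  refine Finset.sum_congr rfl fun J _ => ?_
  congr 1
  refine smoothMaps_ext_of_cover hV hc fun i => ?_
  rw [← tensorEval_resGAlt, ← tensorEval_resGAlt, h]

/-- Compatible forms on the members of an open cover glue. -/
theorem exists_gAlt_glue [T2Space G] {U : Opens M} {ι : Type*} {V : ι → Opens M}
    (hV : ∀ i, V i ≤ U) (hc : ∀ x ∈ U, ∃ i, x ∈ V i) {k : ℕ} (η : ∀ i, GAlt I G (V i) k)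
    (h : ∀ i j x, x ∈ V i → x ∈ V j → ∃ (W : Opens M) (hi : W ≤ V i) (hj : W ≤ V j), x ∈ W ∧
      resGAlt I G hi k (η i) = resGAlt I G hj k (η j)) :
    ∃ θ : GAlt I G U k, ∀ i, resGAlt I G (hV i) k θ = η i := by
  obtain ⟨m, X, l, hX⟩ := exists_dualBasis (I := I) U
  have hglue : ∀ J : Fin k ↪o Fin m, ∃ g : smoothMaps I G U, ∀ i, resMap I G (hV i) g =
      tensorEval (smoothMaps I G (V i)) (fun a => resField I (hV i) (X (J a))) (η i) := by
    intro J
    -- The `J`-th coefficients of the `η i` agree at `x` because the forms agree on a neighbourhood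
    -- `W` of `x`, and evaluation commutes with restriction to `W`.
    refine exists_smoothMaps_glue hV hc _ fun i j x hi hj => ?_
    obtain ⟨W, hWi, hWj, hxW, hW⟩ := h i j x hi hj
    have h1 := tensorEval_resGAlt hWi (fun a => resField I (hV i) (X (J a))) (η i)
    have h2 := tensorEval_resGAlt hWj (fun a => resField I (hV j) (X (J a))) (η j)
    rw [← hW] at h2
    exact congrFun (congrArg Subtype.val (h1.symm.trans h2)) ⟨x, hxW⟩
  choose g hg using hglue
  refine ⟨∑ J, g J ⊗ₜ[SmoothFn I U] wedgeList k (fun a => (l (J a)).toDual), fun i => ?_⟩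
  rw [gAlt_decomp (hV i) hX (η i), map_sum]
  refine Finset.sum_congr rfl fun J _ => ?_
  rw [resGAlt_tmul, hg, CovField.resAlt_wedgeList]

end Sheaf

/-! ### The global differential. -/

section Global

variable {N : ℕ} {H : Type*} [TopologicalSpace H]
  {I : ModelWithCorners ℝ (EuclideanSpace ℝ (Fin N)) H}
  {M : Type*} [TopologicalSpace M] [ChartedSpace H M] [IsManifold I ∞ M]
  [T2Space M]
  {G : Type*} [AddCommGroup G] [Module ℝ G] [TopologicalSpace G]
  [IsTopologicalAddGroup G] [ContinuousSMul ℝ G] [LocallyConvexSpace ℝ G] [T2Space G]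
  {U : Opens M} {D : Type*} {φ : D → OpenPartialHomeomorph M H}

/-- The local differentials of a form, in the charts of an atlas, glue. -/
theorem exists_diff [SecondCountableTopology M] (hφ : ∀ α, φ α ∈ IsManifold.maximalAtlas I ∞ M)
    (hU : ∀ α, chartDom (φ α) ≤ U) (hcover : ∀ x ∈ U, ∃ α, x ∈ (φ α).source) {k : ℕ}
    (θ : GAlt I G U k) :
    ∃ η : GAlt I G U (k + 1), ∀ α,
      resGAlt I G (hU α) (k + 1) η = chartDiffAlt (hφ α) (resGAlt I G (hU α) k θ) := by
  refine exists_gAlt_glue hU hcover _ fun α β x hα hβ => ?_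
  -- On the overlap of two chart domains `φ α` is itself a smooth chart. By naturality both local
  -- differentials restrict to the differential of this chart applied to the restriction of `θ`.
  have hχ : (φ α).restr (φ β).source ∈ IsManifold.maximalAtlas I ∞ M :=
    restr_mem_maximalAtlas (contDiffGroupoid ∞ I) (hφ α) (φ β).open_source
  have hs : ((φ α).restr (φ β).source).source = (φ α).source ∩ (φ β).source :=
    (φ α).restr_source' _ (φ β).open_source
  have h1 : chartDom ((φ α).restr (φ β).source) ≤ chartDom (φ α) := fun y hy => (hs.le hy).1
  have h2 : chartDom ((φ α).restr (φ β).source) ≤ chartDom (φ β) := fun y hy => (hs.le hy).2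
  refine ⟨_, h1, h2, hs.ge ⟨hα, hβ⟩, ?_⟩
  rw [resGAlt_chartDiffAlt (hφ α) hχ, resGAlt_chartDiffAlt (hφ β) hχ, resGAlt_resGAlt,
    resGAlt_resGAlt]

/-- The differential on a chart domain as an additive map. -/
noncomputable def chartDiffAltHom {χ : OpenPartialHomeomorph M H}
    (hχ : χ ∈ IsManifold.maximalAtlas I ∞ M) (k : ℕ) :
    GAlt I G (chartDom χ) k →+ GAlt I G (chartDom χ) (k + 1) :=
  AddMonoidHom.mk' (chartDiffAlt hχ) fun θ η => by
    rw [chartDiffAlt_eq, chartDiffAlt_eq, chartDiffAlt_eq, map_add]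

/-- The sum over the support hides additivity; written as a homomorphism, the differential can be
compared with another one on homogeneous forms. -/
lemma chartDiff_eq {χ : OpenPartialHomeomorph M H} (hχ : χ ∈ IsManifold.maximalAtlas I ∞ M)
    (θ : GForms I G (chartDom χ)) :
    chartDiff hχ θ = DirectSum.toAddMonoid (fun k =>
      (DirectSum.of (fun k => GAlt I G (chartDom χ) k) (k + 1)).comp (chartDiffAltHom hχ k)) θ := by
  classical
  conv_rhs => rw [← DirectSum.sum_support_of θ, map_sum]
  rw [chartDiff]
  refine Finset.sum_congr (by congr) fun k _ => ?_
  rw [DirectSum.toAddMonoid_of]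
  rfl

end Global

end GForm

theorem mainTheorem3 (𝕜 : Type*) [RCLike 𝕜]
    {N : ℕ} [NeZero N] {H : Type*} [TopologicalSpace H]
    (I : ModelWithCorners ℝ (EuclideanSpace ℝ (Fin N)) H)
    {M : Type*} [TopologicalSpace M] [ChartedSpace H M] [IsManifold I ∞ M]
    [T2Space M] [SecondCountableTopology M]
    (G : Type*) [AddCommGroup G] [Module 𝕜 G] [Module ℝ G] [IsScalarTower ℝ 𝕜 G]
    [TopologicalSpace G] [IsTopologicalAddGroup G] [ContinuousSMul 𝕜 G] [ContinuousSMul ℝ G]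
    [LocallyConvexSpace ℝ G] [T2Space G]
    (U : TopologicalSpace.Opens M)
    {D : Type*} (φ : D → OpenPartialHomeomorph M H)
    (hφ : ∀ α, φ α ∈ IsManifold.maximalAtlas I ∞ M)
    (hU : ∀ α, GForm.chartDom (φ α) ≤ U)
    (hcover : ∀ x ∈ U, ∃ α, x ∈ (φ α).source) :
    ∃! d : GForm.GForms I G U → GForm.GForms I G U,
      (∀ (k : ℕ) (θ : GForm.GAlt I G U k), ∃ η : GForm.GAlt I G U (k + 1),
        d (DirectSum.of (fun k => GForm.GAlt I G U k) k θ) =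
          DirectSum.of (fun k => GForm.GAlt I G U k) (k + 1) η) ∧
      ∀ (θ : GForm.GForms I G U) (α : D),
        GForm.resGForms I G (hU α) (d θ) =
          GForm.chartDiff (hφ α) (GForm.resGForms I G (hU α) θ) := by
  choose d hd using fun k (θ : GForm.GAlt I G U k) => GForm.exists_diff hφ hU hcover θ
  have hsep : ∀ {k : ℕ} {θ η : GForm.GAlt I G U k}, (∀ α,
      GForm.resGAlt I G (hU α) k θ = GForm.resGAlt I G (hU α) k η) → θ = η := fun h =>
    GForm.gAlt_ext_of_cover hU hcover h
  let d' : ∀ k, GForm.GAlt I G U k →+ GForm.GAlt I G U (k + 1) := fun k =>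
    -- The values of `d k` come from choice, form by form. They are additive because a form is
    -- determined by its restrictions and the chart differentials are additive.
    AddMonoidHom.mk' (d k) fun θ η => hsep fun α => by
      rw [hd, map_add, map_add, hd, hd]
      exact (GForm.chartDiffAltHom (hφ α) k).map_add _ _
  let δ : GForm.GForms I G U →+ GForm.GForms I G U := DirectSum.toAddMonoid fun k =>
    (DirectSum.of (fun k => GForm.GAlt I G U k) (k + 1)).comp (d' k)
  have hδ : ∀ (θ : GForm.GForms I G U) (α : D), GForm.resGForms I G (hU α) (δ θ) =
      GForm.chartDiff (hφ α) (GForm.resGForms I G (hU α) θ) := by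
    intro θ α
    rw [GForm.chartDiff_eq]
    induction θ using DirectSum.induction_on with
    | zero => simp only [map_zero]
    | of k θ =>
      rw [DirectSum.toAddMonoid_of, GForm.resGForms, DirectSum.map_of, DirectSum.toAddMonoid_of]
      exact (DirectSum.map_of _ _ _).trans (congrArg _ (hd k θ α))
    | add θ η hθ hη => simp only [map_add, hθ, hη]
  refine ⟨δ, ⟨fun k θ => ⟨d k θ, DirectSum.toAddMonoid_of _ _ _⟩, hδ⟩, fun e he => ?_⟩
  -- Uniqueness holds among all maps, with no additivity assumed: each homogeneous component of `e
  -- θ` has the same restrictions to the `U_α` as that of `δ θ`.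
  refine funext fun θ => DFinsupp.ext fun k => hsep fun α => ?_
  exact DFunLike.congr_fun ((he.2 θ α).trans (hδ θ α).symm) k
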